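/- **Notation.** $\mu$ and $\lambda$ are the Möbius and Liouville functions. For a prime $r$, $\chi$ runs over the Dirichlet characters mod $r$, $\chi_0$ is the principal one, $L(s,\chi)$ is the (meromorphically continued) Dirichlet $L$-function, $\mathbb E_\chi=\frac1{r-1}\sum_\chi$, and, for $r>2$, $\mathbb E_{\chi\ne\chi_0}=\frac1{r-2}\sum_{\chi\ne\chi_0}$. GRH mod $r$ means that for every $\chi$ mod $r$ (including $\chi_0$) all zeros of $L(s,\chi)$ with $0<\Re(s)<1$ satisfy $\Re(s)=\frac12$. $\mathbb E_f$ is the expectation over a Steinhaus random completely multiplicative function $f$: the values $f(p)$, $p$ prime, are independent and uniform on the unit circle. Put $f^\ast(n)=f(n)\mathbf 1_{\gcd(n,r)=1}$, $1/L^\ast(s,f)=\sum_n \mu(n)f^\ast(n)n^{-s}$, $1/L^\flat(s,f)=\sum_n\lambda(n)f^\ast(n)n^{-s}$, and $L^\flat(s,\chi)=L(s,\chi)/L(2s,\chi^2)$. For a product of such Dirichlet series in $f$ and $\overline f$, $\mathbb E_f$ is applied to each coefficient of the formally expanded multiple Dirichlet series. Let $\mathcal R$ be a set of primes (for instance, all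 primes). * For $\omega\in(0,\frac12]$, the *twisted Ratios Conjecture with saving $r^{\omega}$* says: for all sufficiently small $\varepsilon,\hbar>0$, all primes $r\in\mathcal R$ with $r>2$, all $s_1,s_2$ with $\Re(s_1)=\Re(s_2)=\frac12+\varepsilon$, and all integers $1\le m_1,m_2\le r^\hbar$, with $T=\max(|\Im s_1|,|\Im s_2|)$, $$\mathbb E_{\chi\ne\chi_0}\frac{\chi(m_1)\overline\chi(m_2)}{L(s_1,\chi)L(s_2,\overline\chi)}=\mathbb E_f\frac{f^\ast(m_1)\overline{f}^\ast(m_2)}{L^\ast(s_1,f)L^\ast(s_2,\overline f)}+O_\varepsilon\big((1+T)^\varepsilon r^{-\omega}\big).$$ * For $\eta>0$, let $(\ast)_\eta$ be the statement, with the same quantifiers, that $$\mathbb E_{\chi\ne\chi_0}\frac{\chi(m_1)\overline\chi(m_2)}{L^\flat(s_1,\chi)L^\flat(s_2,\overline\chi)}=\mathbb E_f\frac{f^\ast(m_1)\overline{f}^\ast(m_2)}{L^\flat(s_1,f)L^\flat(s_2,\overline f)}+O_\varepsilon\big((1+T)^\varepsilon r^{-\eta}\big).$$ For a finite nonempty set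 $\mathcal P$ of primes, let $\mathcal Q=\mathcal P\cup\{p^2:p\in\mathcal P\}$, $U=\max\mathcal Q$, and, for complex numbers $a(q)$, $Q(f)=\sum_{q\in\mathcal Q}q^{-1/2}a(q)f(q)$. Let $\tilde d(n)$ be the number of divisors of $n$ all of whose prime factors lie in $\mathcal P$, and let $v_q=1$ if $q\in\mathcal P$ and $v_q=6$ if $q\in\mathcal Q\setminus\mathcal P$. **Lemma.** (i) Let $\omega\in(0,\frac12]$. Assume GRH mod $r$ for all $r\in\mathcal R$, and the twisted Ratios Conjecture with saving $r^\omega$. Then $(\ast)_\eta$ holds for some $\eta\in(0,\omega]$. Moreover, for every $\eta\in(0,\omega]$ for which $(\ast)_\eta$ holds and every $A>0$, there is $\varepsilon_0>0$ such that for all $0<\varepsilon\le\varepsilon_0$, $$\mathbb E_\chi\,\chi(m_1)\overline\chi(m_2)\Big|\sum_{n\le x}c(n)\chi(n)\Big|^2-\mathbb E_f\,f(m_1)\overline f(m_2)\Big|\sum_{n\le x}c(n)f(n)\Big|^2\ll\frac{x}{r^{\eta/2}},$$ uniformly over $r\in\mathcal R$, $c\in\{\mu,\lambda\}$, $\mathcal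 P$ as above, integers $k\ge0$ with $U^k\le r^\varepsilon$, real $1\le x\le r^A$, and integers $1\le m_1,m_2\le U^k$. Here $\varepsilon_0$ and the implied constant depend only on $A$, on $\eta$, and on $\mathcal R$, $\omega$ and the thresholds and constants in the assumed estimates. (ii) Unconditionally, with an absolute implied constant, for all $c\in\{\mu,\lambda\}$, all $\mathcal P$ and $a(q)$ as above, all integers $k\ge0$ and all real $x\ge1$, $$\mathbb E_f|Q(f)|^{2k}\Big|\sum_{n\le x}c(n)f(n)\Big|^2\ll\sum_{n\le x}\tilde d(n)|c(n)|^2\cdot k!\Big(2\sum_{q\in\mathcal Q}q^{-1}v_q|a(q)|^2\Big)^k.$$ -/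

import Mathlib

open scoped ArithmeticFunction

noncomputable section

namespace EvenMoment

/-! ### The Steinhaus model -/

/-- The law of a family of independent uniformly distributed points of `ℝ/ℤ`, indexed by `ℕ`
(only the coordinates at primes are used below). -/
def steinhausMeasure : MeasureTheory.Measure (ℕ → UnitAddCircle) :=
  MeasureTheory.Measure.infinitePi fun _ => AddCircle.haarAddCircle

/-- The completely multiplicative function `f` on the positive integers with
`f(p) = exp (2 π i θ_p)` for every prime `p`. -/
def steinhausFun (θ : ℕ → UnitAddCircle) (n : ℕ) : ℂ :=
  n.factorization.prod fun p k => (AddCircle.toCircle (θ p) : ℂ) ^ k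

/-- The Steinhaus average `𝔼_f A(f)`, with the values `f(p)` independent and uniform on the unit
circle. -/
def steinhausAvg {E : Type*} [NormedAddCommGroup E] [NormedSpace ℝ E] (A : (ℕ → ℂ) → E) : E :=
  ∫ θ, A (steinhausFun θ) ∂steinhausMeasure

/-- `f^*(n) = f(n) 1_{gcd(n, r) = 1}`. -/
def starFun (r : ℕ) (f : ℕ → ℂ) (n : ℕ) : ℂ :=
  if Nat.Coprime n r then f n else 0

/-- The Steinhaus average of
`f^*(m₁) conj(f^*(m₂)) (∑_{n₁} c(n₁) f^*(n₁) n₁^{-s₁}) (∑_{n₂} c(n₂) conj(f^*(n₂)) n₂^{-s₂})`,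
formed by averaging over `f` each coefficient of the two-variable Dirichlet series.
Since `1 / L^*(s, f) = ∑ μ(n) f^*(n) n^{-s}` and `1 / L^♭(s, f) = ∑ λ(n) f^*(n) n^{-s}`, where
`L^♭(s, f) = L^*(s, f) / L^*(2s, f²)`, the choices `c = μ` and `c = λ` give the averages of
`f^*(m₁) conj(f^*(m₂)) / (L(s₁, f) L(s₂, conj f))` for `L = L^*` and for `L = L^♭`. -/
def steinhausTwistedSeries (c : ArithmeticFunction ℤ) (r m₁ m₂ : ℕ) (s₁ s₂ : ℂ) : ℂ :=
  ∑' n : ℕ × ℕ,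
    steinhausAvg (fun f =>
      starFun r f m₁ * star (starFun r f m₂) *
        ((c n.1 : ℂ) * starFun r f n.1) * ((c n.2 : ℂ) * star (starFun r f n.2))) /
      ((n.1 : ℂ) ^ s₁ * (n.2 : ℂ) ^ s₂)

/-! ### Dirichlet characters modulo a prime -/

/-- `𝔼_χ = (r - 1)⁻¹ ∑_χ`, over all Dirichlet characters modulo the prime `r`. -/
def charAvg (r : ℕ) [NeZero r] (F : DirichletCharacter ℂ r → ℂ) : ℂ :=
  (∑ χ : DirichletCharacter ℂ r, F χ) / ((r : ℂ) - 1)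

open Classical in
/-- `𝔼_{χ ≠ χ₀} = (r - 2)⁻¹ ∑_{χ ≠ χ₀}`, over the nonprincipal Dirichlet characters modulo the
prime `r`. -/
def charAvgNonprincipal (r : ℕ) [NeZero r] (F : DirichletCharacter ℂ r → ℂ) : ℂ :=
  (∑ χ : DirichletCharacter ℂ r with χ ≠ 1, F χ) / ((r : ℂ) - 2)

/-- The Generalized Riemann Hypothesis for all `L(s, χ)` with `χ` a Dirichlet character mod `r`,
including the principal one: zeros in the open critical strip lie on the critical line. -/
def GRH (r : ℕ) [NeZero r] : Prop :=
  ∀ (χ : DirichletCharacter ℂ r) (s : ℂ), 0 < s.re → s.re < 1 → χ.LFunction s = 0 → s.re = 1 / 2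

/-- `L^♭(s, χ) = L(s, χ) / L(2s, χ²)`. -/
def LFlat {r : ℕ} [NeZero r] (χ : DirichletCharacter ℂ r) (s : ℂ) : ℂ :=
  χ.LFunction s / (χ ^ 2).LFunction (2 * s)

/-- The estimate
`𝔼_{χ ≠ χ₀} χ(m₁) conj(χ(m₂)) / (𝓛(s₁, χ) 𝓛(s₂, conj χ))
  = 𝔼_f [the corresponding Steinhaus quantity] + O_ε((1 + T)^ε r^{-w})`
for all sufficiently small `ε, ħ > 0`, all `s₁, s₂` of real part `1/2 + ε`, and all
`1 ≤ m₁, m₂ ≤ r^ħ`, where `T = max(|Im s₁|, |Im s₂|)`, uniformly over the odd primes `r ∈ R`. -/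
def TwistedEstimate (R : Set ℕ)
    (𝓛 : ∀ (r : ℕ) [NeZero r], DirichletCharacter ℂ r → ℂ → ℂ)
    (c : ArithmeticFunction ℤ) (w : ℝ) : Prop :=
  ∃ δ : ℝ, 0 < δ ∧ ∀ ε : ℝ, 0 < ε → ε < δ → ∃ C : ℝ, ∀ ħ : ℝ, 0 < ħ → ħ < δ →
    ∀ (r : ℕ) [Fact r.Prime], r ∈ R → 2 < r →
    ∀ s₁ s₂ : ℂ, s₁.re = 1 / 2 + ε → s₂.re = 1 / 2 + ε →
    ∀ m₁ m₂ : ℕ, 1 ≤ m₁ → 1 ≤ m₂ → (m₁ : ℝ) ≤ (r : ℝ) ^ ħ → (m₂ : ℝ) ≤ (r : ℝ) ^ ħ →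
      ‖charAvgNonprincipal r (fun χ =>
            χ (m₁ : ZMod r) * (star χ) (m₂ : ZMod r) / (𝓛 r χ s₁ * 𝓛 r (star χ) s₂))
          - steinhausTwistedSeries c r m₁ m₂ s₁ s₂‖
        ≤ C * (1 + max |s₁.im| |s₂.im|) ^ ε * (r : ℝ) ^ (-w)

/-- The twisted Ratios Conjecture with power saving `r^{-ω}`, for the prime moduli in `R`. -/
def TwistedRatiosConjecture (R : Set ℕ) (ω : ℝ) : Prop :=
  TwistedEstimate R (fun _ _ χ s => χ.LFunction s) ArithmeticFunction.moebius ω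

/-- The analogue of the twisted Ratios Conjecture for `1 / L^♭`, with power saving `r^{-η}`. -/
def LiouvilleTwistedEstimate (R : Set ℕ) (η : ℝ) : Prop :=
  TwistedEstimate R (fun _ _ χ s => LFlat χ s) ArithmeticFunction.liouville η

/-! ### Partial sums and the weights -/

/-- `∑_{n ≤ x} c(n) g(n)`. -/
def partialSum (c : ArithmeticFunction ℤ) (g : ℕ → ℂ) (x : ℝ) : ℂ :=
  ∑ n ∈ Finset.Icc 1 ⌊x⌋₊, (c n : ℂ) * g n

/-- `𝓠 = 𝓟 ∪ {p² : p ∈ 𝓟}`. -/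
def withSquares (P : Finset ℕ) : Finset ℕ := P ∪ P.image (· ^ 2)

/-- `U = max 𝓠`, for `𝓟` nonempty. -/
def maxQ (P : Finset ℕ) : ℕ := (withSquares P).sup id

/-- `Q(f) = ∑_{q ∈ 𝓠} q^{-1/2} a(q) f(q)`. -/
def weightSum (P : Finset ℕ) (a f : ℕ → ℂ) : ℂ :=
  ∑ q ∈ withSquares P, ((Real.sqrt q)⁻¹ : ℂ) * a q * f q

/-- `d̃(n)`, the number of divisors of `n` all of whose prime factors belong to `𝓟`. -/
def dTilde (P : Finset ℕ) (n : ℕ) : ℕ := (n.divisors.filter fun d => d.primeFactors ⊆ P).card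

/-- `v_q = 1` if `q ∈ 𝓟` and `v_q = 6` otherwise. -/
def vWeight (P : Finset ℕ) (q : ℕ) : ℝ := if q ∈ P then 1 else 6

end EvenMoment

end

/-!
The second part is a weighted Cauchy inequality. By orthogonality of the Steinhaus model the left
side is `∑_N |∑_{nm = N} c(n) b(m)|²`, where `b` is the `k`-fold Dirichlet convolution power of the
coefficients of `Q`. At most `d̃(N)` of the terms in the inner sum are nonzero. With weights `1` on
primes and `4` on squares of primes, `|b(m)|²` is at most `k!` times a convolution power of the weighted
squares of the coefficients (`steinhausAvg_weightSum_pow_mul_le`); submultiplicativity of `d̃`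
then decouples `n` from `m`.

For the first part, GRH gives `1 / L(s, χ) ≪ (r (1 + |t|))^κ` to the right of the critical line, for
every `κ > 0` and uniformly in `χ` (`exists_norm_LInv_le`). This is Littlewood's argument:
Borel–Carathéodory for `log L`, followed by Hadamard's three circles theorem.

The estimate for `1 / L^♭ (s, χ) = L(2s, χ²) / L(s, χ)` follows from the twisted Ratios Conjecture by
truncating `L(2s, χ²)` at a small power `D` of `r` (`exists_liouvilleTwistedEstimate`). The truncated
sums only change the twists `m₁, m₂` into `m₁ d₁², m₂ d₂²`. On the character side the tails are small
in mean square, because `∑_χ` selects the pairs `d₁ ≡ ± d₂ (mod r)`, and the remaining factors are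
controlled pointwise by GRH. On the Steinhaus side, `λ(d² e) = μ(e)` for squarefree `e` expresses the
series for `λ` through the series for `μ`, and the tail is bounded by `∑ lcm(d₁, d₂)⁻²`.

The second moment of the partial sums is a double Perron integral on `Re s = 1/2 + e` of the left side
of the twisted estimate, and the diagonal `m₁ n₁ = m₂ n₂` is the same integral of the right side
(`norm_charAvgNonprincipal_sum_sub_le`). The kernel is that of a continuous piecewise linear cutoff,
which equals the sharp cutoff at the integers, so that all integrals converge absolutely. The loss
`x^{6e}` is absorbed in half of the saving `r^{-η}`. The principal character is treated by the same
contour shift under GRH, and replacing `f^*` by `f` only affects `n₁, n₂` divisible by `r`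
(`exists_moment_bound`).
-/


open scoped ArithmeticFunction

noncomputable section

namespace EvenMoment

section

open MeasureTheory Finset

/-! ### Orthogonality for Steinhaus random multiplicative functions -/

instance : IsProbabilityMeasure steinhausMeasure := by
  unfold steinhausMeasure; infer_instance

lemma steinhausFun_eq_prod (θ : ℕ → UnitAddCircle) (n : ℕ) :
    steinhausFun θ n =
      ∏ p ∈ n.primeFactors, (AddCircle.toCircle (θ p) : ℂ) ^ n.factorization p := rfl

lemma steinhausFun_mul (θ : ℕ → UnitAddCircle) {m n : ℕ} (hm : m ≠ 0) (hn : n ≠ 0) :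
    steinhausFun θ (m * n) = steinhausFun θ m * steinhausFun θ n := by
  unfold steinhausFun
  rw [Nat.factorization_mul hm hn, Finsupp.prod_add_index']
  · simp
  · intro a b c; rw [pow_add]

lemma steinhausFun_one (θ : ℕ → UnitAddCircle) : steinhausFun θ 1 = 1 := by
  simp [steinhausFun]

lemma norm_steinhausFun (θ : ℕ → UnitAddCircle) (n : ℕ) : ‖steinhausFun θ n‖ = 1 := by
  rw [steinhausFun_eq_prod, norm_prod]
  simp [Circle.norm_coe]

lemma measurable_steinhausFun (n : ℕ) : Measurable fun θ => steinhausFun θ n := by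
  simp only [steinhausFun_eq_prod]
  refine Finset.measurable_fun_prod _ fun p _ => Measurable.pow_const ?_ _
  have h : Continuous fun t : UnitAddCircle => (AddCircle.toCircle t : ℂ) := by
    have := (AddCircle.continuous_toCircle (T := (1 : ℝ)))
    fun_prop
  exact h.measurable.comp (measurable_pi_apply p)

lemma integrable_steinhausFun_mul_star (a b : ℕ) :
    Integrable (fun θ => steinhausFun θ a * star (steinhausFun θ b)) steinhausMeasure := by
  refine Integrable.of_bound (C := 1) ?_ (.of_forall fun θ => ?_)
  · exact ((measurable_steinhausFun a).mul
      (continuous_star.measurable.comp (measurable_steinhausFun b))).aestronglyMeasurable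
  · simp [norm_steinhausFun]

/-- The law of the angles is invariant under translations. -/
lemma measurePreserving_add_steinhausMeasure (v : ℕ → UnitAddCircle) :
    MeasurePreserving (MeasurableEquiv.addRight v) steinhausMeasure steinhausMeasure := by
  refine ⟨(MeasurableEquiv.addRight v).measurable, ?_⟩
  have h := Measure.infinitePi_map_pi (fun _ : ℕ => (AddCircle.haarAddCircle (T := 1)))
    (f := fun i t => t + v i) (fun i => by fun_prop)
  have h2 : ∀ i, (AddCircle.haarAddCircle (T := 1)).map (fun t => t + v i)
      = AddCircle.haarAddCircle := fun i => map_add_right_eq_self _ _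
  simp only [h2] at h
  exact h

/-- Rotating the value of `f` at the single prime `p` by the angle `t`. -/
lemma steinhausFun_add_single (θ : ℕ → UnitAddCircle) (p : ℕ) (t : UnitAddCircle) (n : ℕ) :
    steinhausFun (θ + Pi.single p t) n =
      steinhausFun θ n * (AddCircle.toCircle t : ℂ) ^ n.factorization p := by
  simp only [steinhausFun_eq_prod, Pi.add_apply, AddCircle.toCircle_add, Circle.coe_mul, mul_pow,
    Finset.prod_mul_distrib]
  congr 1
  by_cases hp : p ∈ n.primeFactors
  · rw [Finset.prod_eq_single p]
    · simp
    · intro q _ hq; simp [Pi.single_eq_of_ne hq]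
    · exact fun h => absurd hp h
  · rw [Finset.prod_eq_one, Finsupp.notMem_support_iff.mp (by simpa using hp), pow_zero]
    intro q hq
    have : q ≠ p := fun h => hp (h ▸ hq)
    simp [Pi.single_eq_of_ne this]

lemma exists_toCircle_pow_ne {k l : ℕ} (h : k ≠ l) :
    ∃ t : UnitAddCircle, (AddCircle.toCircle t : ℂ) ^ k * star ((AddCircle.toCircle t : ℂ) ^ l) ≠ 1 := by
  have hkl : ((k : ℝ) - l) ≠ 0 := sub_ne_zero.2 (by exact_mod_cast h)
  refine ⟨((1 / (2 * ((k : ℝ) - l)) : ℝ) : UnitAddCircle), ?_⟩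
  rw [AddCircle.toCircle_apply_mk, Circle.coe_exp, star_pow, Complex.star_def, ← Complex.exp_conj,
    ← Complex.exp_nat_mul, ← Complex.exp_nat_mul, ← Complex.exp_add]
  have : (k : ℂ) * ((2 * Real.pi / 1 * (1 / (2 * ((k : ℝ) - l))) : ℝ) * Complex.I) +
      l * (starRingEnd ℂ) (((2 * Real.pi / 1 * (1 / (2 * ((k : ℝ) - l))) : ℝ) : ℂ) * Complex.I)
      = Real.pi * Complex.I := by
    have hkl' : ((k : ℂ) - l) ≠ 0 := by exact_mod_cast hkl
    rw [map_mul, Complex.conj_ofReal, Complex.conj_I]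
    push_cast
    field_simp
    ring
  rw [this, Complex.exp_pi_mul_I]
  norm_num

lemma steinhausAvg_mul_star {a b : ℕ} (ha : a ≠ 0) (hb : b ≠ 0) :
    steinhausAvg (fun f => f a * star (f b)) = if a = b then 1 else 0 := by
  unfold steinhausAvg
  split_ifs with h
  · subst h
    simp_rw [Complex.star_def, Complex.mul_conj, Complex.normSq_eq_norm_sq, norm_steinhausFun]
    simp
  · obtain ⟨p, hp⟩ : ∃ p, a.factorization p ≠ b.factorization p := by
      by_contra! hc
      exact h (Nat.eq_of_factorization_eq ha hb hc)
    obtain ⟨t, ht⟩ := exists_toCircle_pow_ne hp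
    have key := (measurePreserving_add_steinhausMeasure (Pi.single p t)).integral_comp'
      (fun θ => steinhausFun θ a * star (steinhausFun θ b))
    have h2 : ∀ θ, steinhausFun (MeasurableEquiv.addRight (Pi.single p t) θ) a *
        star (steinhausFun (MeasurableEquiv.addRight (Pi.single p t) θ) b) =
        ((AddCircle.toCircle t : ℂ) ^ a.factorization p *
          star ((AddCircle.toCircle t : ℂ) ^ b.factorization p)) *
          (steinhausFun θ a * star (steinhausFun θ b)) := by
      intro θ
      have e : MeasurableEquiv.addRight (Pi.single p t) θ = θ + Pi.single p t := rfl
      rw [e, steinhausFun_add_single, steinhausFun_add_single, star_mul]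
      ring
    simp_rw [h2] at key
    rw [integral_const_mul] at key
    have h3 : ((AddCircle.toCircle t : ℂ) ^ a.factorization p *
          star ((AddCircle.toCircle t : ℂ) ^ b.factorization p) - 1) *
          ∫ θ, steinhausFun θ a * star (steinhausFun θ b) ∂steinhausMeasure = 0 := by
      rw [sub_mul, one_mul, key, sub_self]
    exact (mul_eq_zero.1 h3).resolve_left (sub_ne_zero.2 ht)

/-- Averages of products of two Dirichlet polynomials, expanded by orthogonality. -/
lemma steinhausAvg_sum_mul_star_sum {ι κ : Type*} (s : Finset ι) (t : Finset κ)
    (u : ι → ℂ) (v : κ → ℂ) (a : ι → ℕ) (b : κ → ℕ)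
    (ha : ∀ i ∈ s, a i ≠ 0) (hb : ∀ j ∈ t, b j ≠ 0) :
    steinhausAvg (fun f => (∑ i ∈ s, u i * f (a i)) * star (∑ j ∈ t, v j * f (b j))) =
      ∑ i ∈ s, ∑ j ∈ t, u i * star (v j) * if a i = b j then 1 else 0 := by
  have h1 : ∀ f : ℕ → ℂ, (∑ i ∈ s, u i * f (a i)) * star (∑ j ∈ t, v j * f (b j)) =
      ∑ i ∈ s, ∑ j ∈ t, (u i * star (v j)) * (f (a i) * star (f (b j))) := by
    intro f
    rw [star_sum, Finset.sum_mul_sum]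
    refine Finset.sum_congr rfl fun i _ => Finset.sum_congr rfl fun j _ => ?_
    rw [star_mul]; ring
  simp_rw [h1]
  unfold steinhausAvg
  rw [integral_finsetSum _ fun i _ => integrable_finsetSum _ fun j _ =>
    (integrable_steinhausFun_mul_star _ _).const_mul _]
  refine Finset.sum_congr rfl fun i hi => ?_
  rw [integral_finsetSum _ fun j _ => (integrable_steinhausFun_mul_star _ _).const_mul _]
  refine Finset.sum_congr rfl fun j hj => ?_
  rw [integral_const_mul]
  congr 1
  exact steinhausAvg_mul_star (ha i hi) (hb j hj)

/-- Parseval's identity for a Dirichlet polynomial in a Steinhaus random function. -/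
lemma steinhausAvg_norm_sq_sum (s : Finset ℕ) (g : ℕ → ℂ) (hs : 0 ∉ s) :
    steinhausAvg (fun f => ‖∑ n ∈ s, g n * f n‖ ^ 2) = ∑ n ∈ s, ‖g n‖ ^ 2 := by
  have hne : ∀ i ∈ s, i ≠ 0 := fun i hi h => hs (h ▸ hi)
  have h := steinhausAvg_sum_mul_star_sum s s g g id id hne hne
  have h2 : ∀ z : ℂ, z * star z = ((‖z‖ ^ 2 : ℝ) : ℂ) := fun z => by
    rw [Complex.star_def, Complex.mul_conj, Complex.normSq_eq_norm_sq]
  simp_rw [h2] at h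
  have h3 : ((steinhausAvg (fun f => ‖∑ n ∈ s, g n * f n‖ ^ 2) : ℝ) : ℂ) =
      ((∑ n ∈ s, ‖g n‖ ^ 2 : ℝ) : ℂ) := by
    have : ((steinhausAvg (fun f => ‖∑ n ∈ s, g n * f n‖ ^ 2) : ℝ) : ℂ) =
        steinhausAvg (fun f => ((‖∑ n ∈ s, g n * f n‖ ^ 2 : ℝ) : ℂ)) := by
      unfold steinhausAvg; exact integral_ofReal.symm
    rw [this]
    simp only [id] at h
    rw [h]
    push_cast
    refine Finset.sum_congr rfl fun i hi => ?_
    simp only [mul_ite, mul_one, mul_zero]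
    rw [Finset.sum_ite_eq, if_pos hi, h2]
    push_cast; rfl
  exact_mod_cast h3

end

section

open MeasureTheory Finset
open scoped Pointwise

/-! ### Dirichlet convolution powers of finitely supported functions -/

/-- The function `φ` restricted to the finite set `s`, as an arithmetic function. -/
def restrictTo {K : Type*} [Zero K] (s : Finset ℕ) (φ : ℕ → K) : ArithmeticFunction K :=
  ⟨fun n => if n ∈ s ∧ n ≠ 0 then φ n else 0, by simp⟩

lemma restrictTo_apply {K : Type*} [Zero K] (s : Finset ℕ) (φ : ℕ → K) (n : ℕ) :
    restrictTo s φ n = if n ∈ s ∧ n ≠ 0 then φ n else 0 := rfl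

lemma mul_apply_eq_sum_of_support {K : Type*} [CommSemiring K] {F G : ArithmeticFunction K}
    {s t : Finset ℕ} (hF : ∀ n, F n ≠ 0 → n ∈ s) (hG : ∀ n, G n ≠ 0 → n ∈ t)
    {N : ℕ} (hN : N ≠ 0) :
    (F * G) N = ∑ y ∈ s, ∑ z ∈ t, if y * z = N then F y * G z else 0 := by
  rw [ArithmeticFunction.mul_apply, ← Finset.sum_product', ← Finset.sum_filter]
  symm
  apply Finset.sum_subset
  · intro x hx
    simp only [mem_filter] at hx
    simp [Nat.mem_divisorsAntidiagonal, hx.2, hN]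
  · intro x hx hx'
    simp only [Nat.mem_divisorsAntidiagonal] at hx
    simp only [mem_filter, mem_product, not_and] at hx'
    by_contra h
    exact hx' ⟨hF _ (left_ne_zero_of_mul h), hG _ (right_ne_zero_of_mul h)⟩ hx.1

lemma mul_support {K : Type*} [CommSemiring K] {F G : ArithmeticFunction K}
    {s t : Finset ℕ} (hF : ∀ n, F n ≠ 0 → n ∈ s) (hG : ∀ n, G n ≠ 0 → n ∈ t)
    (N : ℕ) (h : (F * G) N ≠ 0) : N ∈ s * t := by
  have hN : N ≠ 0 := by rintro rfl; simp at h
  rw [mul_apply_eq_sum_of_support hF hG hN] at h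
  obtain ⟨y, hy, h⟩ := Finset.exists_ne_zero_of_sum_ne_zero h
  obtain ⟨z, hz, h⟩ := Finset.exists_ne_zero_of_sum_ne_zero h
  have : y * z = N := by by_contra hh; simp [hh] at h
  exact this ▸ Finset.mul_mem_mul hy hz

lemma pow_support {K : Type*} [CommSemiring K] {F : ArithmeticFunction K}
    {s : Finset ℕ} (hF : ∀ n, F n ≠ 0 → n ∈ s) (k : ℕ) :
    ∀ N, (F ^ k) N ≠ 0 → N ∈ s ^ k := by
  induction k with
  | zero =>
    intro N h
    rw [pow_zero, ArithmeticFunction.one_apply] at h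
    have : N = 1 := by by_contra hh; simp [hh] at h
    simp [this]
  | succ k ih =>
    intro N h
    rw [pow_succ] at h ⊢
    exact mul_support ih hF N h

lemma ne_zero_of_mem_pow {s : Finset ℕ} (hs : 0 ∉ s) (k : ℕ) : 0 ∉ s ^ k := by
  induction k with
  | zero => simp
  | succ k ih =>
    rw [pow_succ]
    intro h
    obtain ⟨y, hy, z, hz, h⟩ := Finset.mem_mul.1 h
    rcases Nat.mul_eq_zero.1 h with rfl | rfl
    · exact ih hy
    · exact hs hz

/-- A completely multiplicative function turns Dirichlet convolution into multiplication. -/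
lemma sum_mul_apply_mul {F G : ArithmeticFunction ℂ} {s t : Finset ℕ}
    (hF : ∀ n, F n ≠ 0 → n ∈ s) (hG : ∀ n, G n ≠ 0 → n ∈ t) (hs : 0 ∉ s) (ht : 0 ∉ t)
    {f : ℕ → ℂ} (hf : ∀ m n, m ≠ 0 → n ≠ 0 → f (m * n) = f m * f n) :
    ∑ N ∈ s * t, (F * G) N * f N = (∑ y ∈ s, F y * f y) * ∑ z ∈ t, G z * f z := by
  have hst : ∀ N ∈ s * t, N ≠ 0 := by
    rintro N hN rfl
    obtain ⟨y, hy, z, hz, h⟩ := Finset.mem_mul.1 hN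
    rcases Nat.mul_eq_zero.1 h with rfl | rfl
    · exact hs hy
    · exact ht hz
  rw [Finset.sum_congr rfl fun N hN => by
    rw [mul_apply_eq_sum_of_support hF hG (hst N hN), Finset.sum_mul]]
  rw [Finset.sum_comm, Finset.sum_mul_sum]
  refine Finset.sum_congr rfl fun y hy => ?_
  simp_rw [Finset.sum_mul]
  rw [Finset.sum_comm]
  refine Finset.sum_congr rfl fun z hz => ?_
  rw [Finset.sum_eq_single (y * z)]
  · rw [if_pos rfl, hf y z (fun h => hs (h ▸ hy)) (fun h => ht (h ▸ hz))]; ring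
  · intro N _ hN; rw [if_neg (Ne.symm hN), zero_mul]
  · intro h; exact absurd (Finset.mul_mem_mul hy hz) h

lemma sum_pow_apply_mul {F : ArithmeticFunction ℂ} {s : Finset ℕ}
    (hF : ∀ n, F n ≠ 0 → n ∈ s) (hs : 0 ∉ s)
    {f : ℕ → ℂ} (hf : ∀ m n, m ≠ 0 → n ≠ 0 → f (m * n) = f m * f n) (hf1 : f 1 = 1) (k : ℕ) :
    ∑ N ∈ s ^ k, (F ^ k) N * f N = (∑ y ∈ s, F y * f y) ^ k := by
  induction k with
  | zero =>
    change ∑ N ∈ ({1} : Finset ℕ), _ = _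
    simp [hf1]
  | succ k ih =>
    simp only [pow_succ]
    rw [sum_mul_apply_mul (pow_support hF k) hF (ne_zero_of_mem_pow hs k) hs hf, ih]

/-- For a submultiplicative weight `d`, the weighted sum of a Dirichlet convolution is at most the
product of the weighted sums. -/
lemma sum_weight_mul_apply_le {F G : ArithmeticFunction ℝ} {s t : Finset ℕ}
    (hF : ∀ n, F n ≠ 0 → n ∈ s) (hG : ∀ n, G n ≠ 0 → n ∈ t) (hs : 0 ∉ s) (ht : 0 ∉ t)
    (hF0 : ∀ n, 0 ≤ F n) (hG0 : ∀ n, 0 ≤ G n)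
    {d : ℕ → ℝ} (hd : ∀ m n, m ≠ 0 → n ≠ 0 → d (m * n) ≤ d m * d n) :
    ∑ N ∈ s * t, d N * (F * G) N ≤ (∑ y ∈ s, d y * F y) * ∑ z ∈ t, d z * G z := by
  have hst : ∀ N ∈ s * t, N ≠ 0 := by
    rintro N hN rfl
    obtain ⟨y, hy, z, hz, h⟩ := Finset.mem_mul.1 hN
    rcases Nat.mul_eq_zero.1 h with rfl | rfl
    · exact hs hy
    · exact ht hz
  rw [Finset.sum_congr rfl fun N hN => by
    rw [mul_apply_eq_sum_of_support hF hG (hst N hN), Finset.mul_sum]]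
  rw [Finset.sum_comm, Finset.sum_mul_sum]
  refine Finset.sum_le_sum fun y hy => ?_
  simp_rw [Finset.mul_sum]
  rw [Finset.sum_comm]
  refine Finset.sum_le_sum fun z hz => ?_
  rw [Finset.sum_eq_single (y * z)]
  · rw [if_pos rfl]
    have := hd y z (fun h => hs (h ▸ hy)) (fun h => ht (h ▸ hz))
    calc d (y * z) * (F y * G z) ≤ (d y * d z) * (F y * G z) :=
          mul_le_mul_of_nonneg_right this (mul_nonneg (hF0 _) (hG0 _))
      _ = _ := by ring
  · intro N _ hN; rw [if_neg (Ne.symm hN), mul_zero]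
  · intro h; exact absurd (Finset.mul_mem_mul hy hz) h

lemma mul_apply_nonneg {F G : ArithmeticFunction ℝ} (hF : ∀ n, 0 ≤ F n) (hG : ∀ n, 0 ≤ G n)
    (n : ℕ) : 0 ≤ (F * G) n := by
  rw [ArithmeticFunction.mul_apply]
  exact Finset.sum_nonneg fun x _ => mul_nonneg (hF _) (hG _)

lemma pow_apply_nonneg {F : ArithmeticFunction ℝ} (hF : ∀ n, 0 ≤ F n) (k n : ℕ) :
    0 ≤ (F ^ k) n := by
  induction k generalizing n with
  | zero => rw [pow_zero, ArithmeticFunction.one_apply]; split_ifs <;> norm_num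
  | succ k ih => rw [pow_succ]; exact mul_apply_nonneg ih hF n

lemma sum_weight_pow_apply_le {F : ArithmeticFunction ℝ} {s : Finset ℕ}
    (hF : ∀ n, F n ≠ 0 → n ∈ s) (hs : 0 ∉ s) (hF0 : ∀ n, 0 ≤ F n)
    {d : ℕ → ℝ} (hd : ∀ m n, m ≠ 0 → n ≠ 0 → d (m * n) ≤ d m * d n) (hd0 : ∀ n, 0 ≤ d n)
    (hd1 : d 1 = 1) (k : ℕ) :
    ∑ N ∈ s ^ k, d N * (F ^ k) N ≤ (∑ y ∈ s, d y * F y) ^ k := by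
  induction k with
  | zero =>
    change ∑ N ∈ ({1} : Finset ℕ), _ ≤ _
    simp [hd1]
  | succ k ih =>
    simp only [pow_succ]
    refine (sum_weight_mul_apply_le (pow_support hF k) hF (ne_zero_of_mem_pow hs k) hs
      (pow_apply_nonneg hF0 k) hF0 hd).trans ?_
    exact mul_le_mul_of_nonneg_right ih (Finset.sum_nonneg fun y _ => mul_nonneg (hd0 _) (hF0 _))

/-- Cauchy–Schwarz for Dirichlet convolutions. -/
lemma norm_mul_apply_sq_le {α β : ArithmeticFunction ℂ} {g h B C : ArithmeticFunction ℝ}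
    (hg : ∀ n, 0 ≤ g n) (hh : ∀ n, 0 ≤ h n) (hB : ∀ n, 0 ≤ B n) (hC : ∀ n, 0 ≤ C n)
    (hα : ∀ n, ‖α n‖ ^ 2 ≤ g n * B n) (hβ : ∀ n, ‖β n‖ ^ 2 ≤ h n * C n) (n : ℕ) :
    ‖(α * β) n‖ ^ 2 ≤ (g * h) n * (B * C) n := by
  simp only [ArithmeticFunction.mul_apply]
  calc ‖∑ x ∈ n.divisorsAntidiagonal, α x.1 * β x.2‖ ^ 2
      ≤ (∑ x ∈ n.divisorsAntidiagonal, ‖α x.1‖ * ‖β x.2‖) ^ 2 := by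
        gcongr
        refine (norm_sum_le _ _).trans_eq ?_
        simp
    _ ≤ _ := by
        refine Finset.sum_sq_le_sum_mul_sum_of_sq_le_mul _ (fun x _ => mul_nonneg (hg _) (hh _))
          (fun x _ => mul_nonneg (hB _) (hC _)) fun x _ => ?_
        calc (‖α x.1‖ * ‖β x.2‖) ^ 2 = ‖α x.1‖ ^ 2 * ‖β x.2‖ ^ 2 := by ring
          _ ≤ (g x.1 * B x.1) * (h x.2 * C x.2) :=
            mul_le_mul (hα _) (hβ _) (by positivity) (mul_nonneg (hg _) (hB _))
          _ = _ := by ring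

lemma norm_pow_apply_sq_le {α : ArithmeticFunction ℂ} {g B : ArithmeticFunction ℝ}
    (hg : ∀ n, 0 ≤ g n) (hB : ∀ n, 0 ≤ B n)
    (hα : ∀ n, ‖α n‖ ^ 2 ≤ g n * B n) (k n : ℕ) :
    ‖(α ^ k) n‖ ^ 2 ≤ (g ^ k) n * (B ^ k) n := by
  induction k generalizing n with
  | zero =>
    simp only [pow_zero, ArithmeticFunction.one_apply]
    split_ifs <;> simp
  | succ k ih =>
    simp only [pow_succ]
    exact norm_mul_apply_sq_le (pow_apply_nonneg hg k) hg (pow_apply_nonneg hB k) hB ih hα n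

lemma nsmul_apply (j : ℕ) (F : ArithmeticFunction ℝ) (n : ℕ) : (j • F) n = (j : ℝ) * F n := by
  induction j with
  | zero => simp
  | succ j ih => rw [succ_nsmul, ArithmeticFunction.add_apply, ih]; push_cast; ring

/-- Multiplication by the `p`-adic valuation, a derivation for Dirichlet convolution. -/
def mulFactorization (p : ℕ) (F : ArithmeticFunction ℝ) : ArithmeticFunction ℝ :=
  ⟨fun n => n.factorization p * F n, by simp⟩

lemma mulFactorization_mul (p : ℕ) (F G : ArithmeticFunction ℝ) :
    mulFactorization p (F * G) = mulFactorization p F * G + F * mulFactorization p G := by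
  ext n
  rw [ArithmeticFunction.add_apply]
  change (n.factorization p : ℝ) * (F * G) n = _
  simp only [ArithmeticFunction.mul_apply, Finset.mul_sum, ← Finset.sum_add_distrib]
  refine Finset.sum_congr rfl fun x hx => ?_
  obtain ⟨h, hn⟩ := Nat.mem_divisorsAntidiagonal.1 hx
  have h1 : x.1 ≠ 0 := by rintro h'; rw [h'] at h; simp at h; exact hn h.symm
  have h2 : x.2 ≠ 0 := by rintro h'; rw [h'] at h; simp at h; exact hn h.symm
  change _ = (x.1.factorization p * F x.1) * G x.2 + F x.1 * (x.2.factorization p * G x.2)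
  rw [← h, Nat.factorization_mul h1 h2]
  simp only [Finsupp.coe_add, Pi.add_apply, Nat.cast_add]
  ring

lemma mulFactorization_pow_succ (p : ℕ) (F : ArithmeticFunction ℝ) (k : ℕ) :
    mulFactorization p (F ^ (k + 1)) = (k + 1 : ℕ) • (mulFactorization p F * F ^ k) := by
  induction k with
  | zero => simp
  | succ k ih =>
    rw [pow_succ, mulFactorization_mul, ih, pow_succ F k, succ_nsmul _ (k + 1)]
    simp only [smul_mul_assoc, mul_assoc]
    congr 1
    ring

/-- The weight `1` on primes and `1/4` on squares of primes. -/
def reprWeight (P : Finset ℕ) : ArithmeticFunction ℝ :=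
  restrictTo (withSquares P) fun q => if q ∈ P then 1 else 1 / 4

lemma mem_withSquares {P : Finset ℕ} {q : ℕ} :
    q ∈ withSquares P ↔ q ∈ P ∨ ∃ p ∈ P, p ^ 2 = q := by
  simp [withSquares]

lemma zero_notMem_withSquares {P : Finset ℕ} (hP : ∀ p ∈ P, p.Prime) : 0 ∉ withSquares P := by
  rw [mem_withSquares]
  rintro (h | ⟨p, hp, h⟩)
  · exact Nat.not_prime_zero (hP _ h)
  · exact (hP p hp).ne_zero (by simpa using h)

lemma reprWeight_nonneg (P : Finset ℕ) (n : ℕ) : 0 ≤ reprWeight P n := by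
  rw [reprWeight, restrictTo_apply]
  split_ifs <;> norm_num

lemma reprWeight_one {P : Finset ℕ} (hP : ∀ p ∈ P, p.Prime) : reprWeight P 1 = 0 := by
  rw [reprWeight, restrictTo_apply, if_neg]
  rw [mem_withSquares]
  rintro ⟨h | ⟨p, hp, h⟩, -⟩
  · exact Nat.not_prime_one (hP _ h)
  · exact (hP p hp).one_lt.ne' (by simpa using h)

lemma sum_divisors_mulFactorization_reprWeight_le {P : Finset ℕ} (hP : ∀ p ∈ P, p.Prime)
    {p m : ℕ} (hp : p.Prime) (hm : m ≠ 0) (hpm : p ∣ m) :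
    ∑ x ∈ m.divisors, mulFactorization p (reprWeight P) x ≤ m.factorization p := by
  have hval : ∀ x, mulFactorization p (reprWeight P) x = x.factorization p * reprWeight P x :=
    fun _ => rfl
  -- only `p` and `p²` contribute, at most `1` and `2 · 1/4`
  have hzero : ∀ x ∈ m.divisors, x ∉ m.divisors.filter (fun x => x = p ∨ x = p ^ 2) →
      mulFactorization p (reprWeight P) x = 0 := by
    intro x hx hx'
    rw [hval]
    by_contra hne
    have h1 := left_ne_zero_of_mul hne
    have h2 := right_ne_zero_of_mul hne
    rw [reprWeight, restrictTo_apply] at h2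
    have h3 : x ∈ withSquares P := by by_contra h; simp [h] at h2
    have h1' : p ∣ x := by
      by_contra h; exact h1 (by exact_mod_cast Nat.factorization_eq_zero_of_not_dvd h)
    refine hx' (Finset.mem_filter.2 ⟨hx, ?_⟩)
    rcases mem_withSquares.1 h3 with h | ⟨q, hq, rfl⟩
    · exact Or.inl ((Nat.prime_dvd_prime_iff_eq hp (hP _ h)).1 h1').symm
    · right
      rw [(Nat.prime_dvd_prime_iff_eq hp (hP _ hq)).1 (hp.dvd_of_dvd_pow h1')]
  rw [← Finset.sum_subset (Finset.filter_subset _ _) hzero]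
  have hp1 : mulFactorization p (reprWeight P) p ≤ 1 := by
    rw [hval, hp.factorization_self, reprWeight, restrictTo_apply]
    split_ifs <;> norm_num
  have hp2 : mulFactorization p (reprWeight P) (p ^ 2) ≤ 1 / 2 := by
    have hn : p ^ 2 ∉ P := fun h => (Nat.Prime.not_prime_pow (le_refl 2)) (hP _ h)
    rw [hval, hp.factorization_pow, reprWeight, restrictTo_apply]
    simp only [Finsupp.single_eq_same]
    split_ifs <;> norm_num
  by_cases h2 : p ^ 2 ∣ m
  · have hv : 2 ≤ m.factorization p := (hp.pow_dvd_iff_le_factorization hm).1 h2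
    have hsub : m.divisors.filter (fun x => x = p ∨ x = p ^ 2) ⊆ {p, p ^ 2} := by
      intro x; simp
    calc ∑ x ∈ m.divisors.filter (fun x => x = p ∨ x = p ^ 2), mulFactorization p (reprWeight P) x
        ≤ ∑ x ∈ {p, p ^ 2}, mulFactorization p (reprWeight P) x :=
          Finset.sum_le_sum_of_subset_of_nonneg hsub fun x _ _ => by
            rw [hval]; exact mul_nonneg (by positivity) (reprWeight_nonneg _ _)
      _ = mulFactorization p (reprWeight P) p + mulFactorization p (reprWeight P) (p ^ 2) := by
          refine Finset.sum_pair ?_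
          have := hp.two_le
          nlinarith
      _ ≤ 2 := by linarith
      _ ≤ m.factorization p := by exact_mod_cast hv
  · have hv : 1 ≤ m.factorization p := (hp.dvd_iff_one_le_factorization hm).1 hpm
    have hsub : m.divisors.filter (fun x => x = p ∨ x = p ^ 2) ⊆ {p} := by
      intro x
      simp only [mem_filter, Nat.mem_divisors, mem_singleton]
      rintro ⟨⟨h, -⟩, h' | h'⟩
      · exact h'
      · exact absurd (h' ▸ h) h2
    calc ∑ x ∈ m.divisors.filter (fun x => x = p ∨ x = p ^ 2), mulFactorization p (reprWeight P) x
        ≤ ∑ x ∈ {p}, mulFactorization p (reprWeight P) x :=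
          Finset.sum_le_sum_of_subset_of_nonneg hsub fun x _ _ => by
            rw [hval]; exact mul_nonneg (by positivity) (reprWeight_nonneg _ _)
      _ ≤ 1 := by rw [Finset.sum_singleton]; exact hp1
      _ ≤ m.factorization p := by exact_mod_cast hv

/-- Counted with weight `1/4` for each square, the ordered factorizations of `m` into `k` elements of
`𝓠` number at most `k!`. Fix a prime `p ∣ m`: weighting each factorization by
`v_p(m) = ∑ v_p(q_i)` and using symmetry in the factors reduces to factorizations with `k - 1`
factors of `m / p` and `m / p²`. -/
lemma reprWeight_pow_apply_le {P : Finset ℕ} (hP : ∀ p ∈ P, p.Prime) (k m : ℕ) :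
    (reprWeight P ^ k) m ≤ k.factorial := by
  induction k generalizing m with
  | zero =>
    rw [pow_zero, ArithmeticFunction.one_apply]
    split_ifs <;> simp
  | succ k ih =>
    rcases Nat.eq_zero_or_pos m with rfl | hm
    · simp
    by_cases h1 : m = 1
    · subst h1
      rw [pow_succ, ArithmeticFunction.mul_apply]
      simp only [Nat.divisorsAntidiagonal_one, sum_singleton, reprWeight_one hP, mul_zero]
      positivity
    · have hp := Nat.minFac_prime h1
      have hpm := Nat.minFac_dvd m
      set p := m.minFac
      have hv : 0 < (m.factorization p : ℝ) := by
        exact_mod_cast hp.factorization_pos_of_dvd hm.ne' hpm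
      -- Leibniz rule for the derivation `F ↦ v_p F`
      have key : (m.factorization p : ℝ) * (reprWeight P ^ (k + 1)) m =
          (k + 1) * (mulFactorization p (reprWeight P) * reprWeight P ^ k) m := by
        have := congrArg (fun F : ArithmeticFunction ℝ => F m)
          (mulFactorization_pow_succ p (reprWeight P) k)
        have e : ∀ F : ArithmeticFunction ℝ, ((k + 1 : ℕ) • F) m = (k + 1 : ℝ) * F m := by
          intro F; rw [nsmul_apply]; push_cast; ring
        rw [← e, ← this]; rfl
      have hle : (mulFactorization p (reprWeight P) * reprWeight P ^ k) m ≤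
          k.factorial * m.factorization p := by
        rw [ArithmeticFunction.mul_apply]
        calc ∑ x ∈ m.divisorsAntidiagonal,
              mulFactorization p (reprWeight P) x.1 * (reprWeight P ^ k) x.2
            ≤ ∑ x ∈ m.divisorsAntidiagonal,
              mulFactorization p (reprWeight P) x.1 * k.factorial :=
              Finset.sum_le_sum fun x _ => mul_le_mul_of_nonneg_left (ih _)
                (mul_nonneg (by positivity) (reprWeight_nonneg _ _))
          _ = k.factorial * ∑ x ∈ m.divisors, mulFactorization p (reprWeight P) x := by
              rw [← Finset.sum_mul, mul_comm, Nat.sum_divisorsAntidiagonal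
                (fun x _ => mulFactorization p (reprWeight P) x)]
          _ ≤ _ := by
              gcongr
              exact sum_divisors_mulFactorization_reprWeight_le hP hp hm.ne' hpm
      rw [Nat.factorial_succ]
      push_cast
      have : (m.factorization p : ℝ) * (reprWeight P ^ (k + 1)) m ≤
          m.factorization p * ((k + 1) * k.factorial) := by
        rw [key]
        calc _ ≤ (k + 1 : ℝ) * (k.factorial * m.factorization p) := by gcongr
          _ = _ := by ring
      exact le_of_mul_le_mul_left this hv

/-! ### The weighted second moment -/

lemma dTilde_mul_le (P : Finset ℕ) (m n : ℕ) :
    dTilde P (m * n) ≤ dTilde P m * dTilde P n := by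
  classical
  unfold dTilde
  have hsub : (m * n).divisors.filter (fun d => d.primeFactors ⊆ P) ⊆
      (m.divisors.filter fun d => d.primeFactors ⊆ P) *
        (n.divisors.filter fun d => d.primeFactors ⊆ P) := by
    intro d hd
    rw [mem_filter, Nat.divisors_mul] at hd
    obtain ⟨hd, hP⟩ := hd
    obtain ⟨y, hy, z, hz, rfl⟩ := Finset.mem_mul.1 hd
    have hy0 : y ≠ 0 := (Nat.pos_of_mem_divisors hy).ne'
    have hz0 : z ≠ 0 := (Nat.pos_of_mem_divisors hz).ne'
    rw [Nat.primeFactors_mul hy0 hz0, union_subset_iff] at hP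
    exact Finset.mul_mem_mul (mem_filter.2 ⟨hy, hP.1⟩) (mem_filter.2 ⟨hz, hP.2⟩)
  exact (Finset.card_le_card hsub).trans Finset.card_mul_le

lemma dTilde_one (P : Finset ℕ) : dTilde P 1 = 1 := by
  simp [dTilde, Finset.filter_singleton]

lemma dTilde_le_card_divisors (P : Finset ℕ) (n : ℕ) : dTilde P n ≤ n.divisors.card :=
  Finset.card_filter_le _ _

/-- The indicator function of the integers all of whose prime factors belong to `P`. -/
def smoothIndicator (P : Finset ℕ) : ArithmeticFunction ℝ :=
  ⟨fun n => if n ≠ 0 ∧ n.primeFactors ⊆ P then 1 else 0, by simp⟩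

lemma smoothIndicator_apply (P : Finset ℕ) (n : ℕ) :
    smoothIndicator P n = if n ≠ 0 ∧ n.primeFactors ⊆ P then 1 else 0 := rfl

lemma smoothIndicator_mul_zeta_apply (P : Finset ℕ) (n : ℕ) :
    (smoothIndicator P * ((ArithmeticFunction.zeta : ArithmeticFunction ℕ) :
      ArithmeticFunction ℝ)) n = dTilde P n := by
  rw [ArithmeticFunction.coe_mul_zeta_apply, dTilde, Finset.card_filter]
  push_cast
  refine Finset.sum_congr rfl fun d hd => ?_
  rw [smoothIndicator_apply]
  simp [(Nat.pos_of_mem_divisors hd).ne']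

lemma primeFactors_subset_of_mem_pow {P : Finset ℕ} (hP : ∀ p ∈ P, p.Prime) (k : ℕ) :
    ∀ n ∈ withSquares P ^ k, n.primeFactors ⊆ P := by
  induction k with
  | zero => intro n hn; simp at hn; simp [hn]
  | succ k ih =>
    intro n hn
    rw [pow_succ] at hn
    obtain ⟨y, hy, z, hz, rfl⟩ := Finset.mem_mul.1 hn
    have hQ0 := zero_notMem_withSquares hP
    rw [Nat.primeFactors_mul (fun h => ne_zero_of_mem_pow hQ0 k (h ▸ hy)) (fun h => hQ0 (h ▸ hz))]
    refine union_subset (ih y hy) ?_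
    rcases mem_withSquares.1 hz with h | ⟨p, hp, rfl⟩
    · rw [(hP z h).primeFactors]; simpa using h
    · rw [Nat.primeFactors_prime_pow two_ne_zero (hP p hp)]; simpa using hp

/-- The coefficients of the weight `Q(f)`. -/
def weightCoeff (P : Finset ℕ) (a : ℕ → ℂ) : ArithmeticFunction ℂ :=
  restrictTo (withSquares P) fun q => ((Real.sqrt q)⁻¹ : ℂ) * a q

/-- `|α(q)|²` for the coefficients `α` of `Q(f)`, divided by the weight `reprWeight`. -/
def weightCoeffSq (P : Finset ℕ) (a : ℕ → ℂ) : ArithmeticFunction ℝ :=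
  restrictTo (withSquares P) fun q => (if q ∈ P then 1 else 4) * ((q : ℝ)⁻¹ * ‖a q‖ ^ 2)

lemma restrictTo_support {K : Type*} [Zero K] {s : Finset ℕ} {φ : ℕ → K} (n : ℕ)
    (h : restrictTo s φ n ≠ 0) : n ∈ s := by
  by_contra hn
  exact h (by rw [restrictTo_apply, if_neg fun h' => hn h'.1])

lemma weightCoeffSq_nonneg (P : Finset ℕ) (a : ℕ → ℂ) (n : ℕ) : 0 ≤ weightCoeffSq P a n := by
  rw [weightCoeffSq, restrictTo_apply]
  split_ifs <;> positivity

lemma norm_weightCoeff_sq_le (P : Finset ℕ) (a : ℕ → ℂ) (n : ℕ) :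
    ‖weightCoeff P a n‖ ^ 2 ≤ reprWeight P n * weightCoeffSq P a n := by
  rw [weightCoeff, weightCoeffSq, reprWeight, restrictTo_apply, restrictTo_apply, restrictTo_apply]
  by_cases h : n ∈ withSquares P ∧ n ≠ 0
  · simp only [if_pos h]
    have : ‖((Real.sqrt n)⁻¹ : ℂ) * a n‖ ^ 2 = (n : ℝ)⁻¹ * ‖a n‖ ^ 2 := by
      rw [norm_mul, mul_pow, norm_inv, Complex.norm_real, inv_pow, Real.norm_eq_abs, sq_abs,
        Real.sq_sqrt (by positivity)]
    rw [this]
    split_ifs <;> linarith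
  · simp [h]

lemma dTilde_mul_weightCoeffSq_le {P : Finset ℕ} (hP : ∀ p ∈ P, p.Prime) (a : ℕ → ℂ) (q : ℕ)
    (hq : q ∈ withSquares P) :
    (dTilde P q : ℝ) * weightCoeffSq P a q ≤ 2 * ((q : ℝ)⁻¹ * vWeight P q * ‖a q‖ ^ 2) := by
  have h0 : q ≠ 0 := fun h => zero_notMem_withSquares hP (h ▸ hq)
  rw [weightCoeffSq, restrictTo_apply, if_pos ⟨hq, h0⟩, vWeight]
  have hn : (0 : ℝ) ≤ (q : ℝ)⁻¹ * ‖a q‖ ^ 2 := by positivity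
  by_cases h : q ∈ P
  · simp only [if_pos h]
    have hd : (dTilde P q : ℝ) ≤ 2 := by
      have := dTilde_le_card_divisors P q
      rw [(hP q h).divisors, Finset.card_pair (hP q h).one_lt.ne] at this
      exact_mod_cast this
    nlinarith
  · simp only [if_neg h]
    obtain ⟨p, hp, rfl⟩ := (mem_withSquares.1 hq).resolve_left h
    have hd : (dTilde P (p ^ 2) : ℝ) ≤ 3 := by
      have := dTilde_le_card_divisors P (p ^ 2)
      rw [Nat.divisors_prime_pow (hP p hp), Finset.card_map, Finset.card_range] at this
      exact_mod_cast this
    nlinarith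

/-- The weighted second moment: expanding `Q(f)^k` into a Dirichlet polynomial, Parseval's identity
and the Cauchy–Schwarz inequality reduce it to the count of factorizations into elements of `𝓠`. -/
theorem steinhausAvg_weightSum_pow_mul_le (c : ArithmeticFunction ℤ) {P : Finset ℕ}
    (hP : ∀ p ∈ P, p.Prime) (a : ℕ → ℂ) (k : ℕ) (x : ℝ) :
    steinhausAvg (fun f => ‖weightSum P a f‖ ^ (2 * k) * ‖partialSum c f x‖ ^ 2) ≤
      (∑ n ∈ Finset.Icc 1 ⌊x⌋₊, (dTilde P n : ℝ) * |(c n : ℝ)| ^ 2) *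
        ((k.factorial : ℝ) *
          (2 * ∑ q ∈ withSquares P, (q : ℝ)⁻¹ * vWeight P q * ‖a q‖ ^ 2) ^ k) := by
  set Q := withSquares P with hQdef
  set I := Finset.Icc 1 ⌊x⌋₊ with hI
  set α := weightCoeff P a with hα
  set γ : ArithmeticFunction ℂ := restrictTo I fun n => (c n : ℂ) with hγ
  set γ2 : ArithmeticFunction ℝ := restrictTo I fun n => |(c n : ℝ)| ^ 2 with hγ2
  set B := weightCoeffSq P a with hB
  have hQ0 : 0 ∉ Q := zero_notMem_withSquares hP
  have hI0 : 0 ∉ I := by simp [hI]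
  have hαs : ∀ n, α n ≠ 0 → n ∈ Q := fun n h => restrictTo_support n h
  have hγs : ∀ n, γ n ≠ 0 → n ∈ I := fun n h => restrictTo_support n h
  have hγ2s : ∀ n, γ2 n ≠ 0 → n ∈ I := fun n h => restrictTo_support n h
  have hBs : ∀ n, B n ≠ 0 → n ∈ Q := fun n h => restrictTo_support n h
  have hγ20 : ∀ n, 0 ≤ γ2 n := fun n => by
    rw [hγ2, restrictTo_apply]; split_ifs <;> positivity
  have hB0 := weightCoeffSq_nonneg P a
  have hQk0 : 0 ∉ Q ^ k := ne_zero_of_mem_pow hQ0 k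
  -- expand `Q(f)^k ∑ c(n) f(n)` as a Dirichlet polynomial
  have hexp : ∀ θ, ‖weightSum P a (steinhausFun θ)‖ ^ (2 * k) *
      ‖partialSum c (steinhausFun θ) x‖ ^ 2 =
      ‖∑ N ∈ Q ^ k * I, (α ^ k * γ) N * steinhausFun θ N‖ ^ 2 := by
    intro θ
    have hf : ∀ m n, m ≠ 0 → n ≠ 0 →
        steinhausFun θ (m * n) = steinhausFun θ m * steinhausFun θ n :=
      fun m n hm hn => steinhausFun_mul θ hm hn
    have hw : weightSum P a (steinhausFun θ) = ∑ q ∈ Q, α q * steinhausFun θ q := by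
      unfold weightSum
      refine Finset.sum_congr rfl fun q hq => ?_
      rw [hα, weightCoeff, restrictTo_apply, if_pos ⟨hq, fun h => hQ0 (h ▸ hq)⟩]
    have hs : partialSum c (steinhausFun θ) x = ∑ n ∈ I, γ n * steinhausFun θ n := by
      unfold partialSum
      refine Finset.sum_congr rfl fun n hn => ?_
      rw [hγ, restrictTo_apply, if_pos ⟨hn, fun h => hI0 (h ▸ hn)⟩]
    rw [sum_mul_apply_mul (pow_support hαs k) hγs hQk0 hI0 hf,
      sum_pow_apply_mul hαs hQ0 hf (steinhausFun_one θ), norm_mul, mul_pow, norm_pow, ← pow_mul,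
      mul_comm k 2, hw, hs]
  have hW0 : 0 ∉ Q ^ k * I := by
    intro h
    obtain ⟨y, hy, z, hz, h⟩ := Finset.mem_mul.1 h
    rcases Nat.mul_eq_zero.1 h with rfl | rfl
    · exact hQk0 hy
    · exact hI0 hz
  have h1 : steinhausAvg (fun f => ‖weightSum P a f‖ ^ (2 * k) * ‖partialSum c f x‖ ^ 2) =
      ∑ N ∈ Q ^ k * I, ‖(α ^ k * γ) N‖ ^ 2 := by
    rw [← steinhausAvg_norm_sq_sum _ _ hW0]
    unfold steinhausAvg
    exact integral_congr_ae (.of_forall hexp)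
  rw [h1]
  -- coefficients of `Q(f)^k`
  have hcoef : ∀ n, ‖(α ^ k) n‖ ^ 2 ≤ smoothIndicator P n * (k.factorial • B ^ k) n := by
    intro n
    rw [nsmul_apply]
    by_cases h : (α ^ k) n = 0
    · rw [h, norm_zero, zero_pow two_ne_zero, smoothIndicator_apply]
      have := pow_apply_nonneg hB0 k n
      split_ifs <;> positivity
    · have hn := pow_support hαs k n h
      rw [smoothIndicator_apply, if_pos ⟨fun h' => hQk0 (h' ▸ hn),
        primeFactors_subset_of_mem_pow hP k n hn⟩, one_mul]
      exact (norm_pow_apply_sq_le (reprWeight_nonneg P) hB0 (norm_weightCoeff_sq_le P a) k n).trans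
        (mul_le_mul_of_nonneg_right (reprWeight_pow_apply_le hP k n) (pow_apply_nonneg hB0 k n))
  have hBk : ∀ n, (k.factorial • B ^ k) n = k.factorial * (B ^ k) n := fun n => nsmul_apply _ _ n
  have hBk0 : ∀ n, 0 ≤ (k.factorial • B ^ k) n := fun n => by
    rw [hBk]; exact mul_nonneg (by positivity) (pow_apply_nonneg hB0 k n)
  have hsm0 : ∀ n, 0 ≤ smoothIndicator P n := fun n => by
    rw [smoothIndicator_apply]; split_ifs <;> norm_num
  have hterm : ∀ N, ‖(α ^ k * γ) N‖ ^ 2 ≤ dTilde P N * ((k.factorial • B ^ k) * γ2) N := by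
    intro N
    rw [← smoothIndicator_mul_zeta_apply]
    refine norm_mul_apply_sq_le hsm0 (fun n => ?_) hBk0 hγ20 hcoef (fun n => ?_) N
    · rw [ArithmeticFunction.natCoe_apply]; positivity
    · rw [hγ, hγ2, restrictTo_apply, restrictTo_apply]
      by_cases hn : n ∈ I ∧ n ≠ 0
      · rw [if_pos hn, if_pos hn, ArithmeticFunction.natCoe_apply,
          ArithmeticFunction.zeta_apply_ne hn.2]
        simp
      · rw [if_neg hn, if_neg hn]; simp
  have hBks : ∀ n, (k.factorial • B ^ k) n ≠ 0 → n ∈ Q ^ k := fun n h =>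
    pow_support hBs k n fun h' => h (by rw [hBk, h', mul_zero])
  have hd : ∀ m n, m ≠ 0 → n ≠ 0 → (dTilde P (m * n) : ℝ) ≤ dTilde P m * dTilde P n :=
    fun m n _ _ => by exact_mod_cast dTilde_mul_le P m n
  calc ∑ N ∈ Q ^ k * I, ‖(α ^ k * γ) N‖ ^ 2
      ≤ ∑ N ∈ Q ^ k * I, (dTilde P N : ℝ) * ((k.factorial • B ^ k) * γ2) N :=
        Finset.sum_le_sum fun N _ => hterm N
    _ ≤ (∑ y ∈ Q ^ k, (dTilde P y : ℝ) * (k.factorial • B ^ k) y) *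
        ∑ z ∈ I, (dTilde P z : ℝ) * γ2 z :=
        sum_weight_mul_apply_le hBks hγ2s hQk0 hI0 hBk0 hγ20 hd
    _ = (∑ z ∈ I, (dTilde P z : ℝ) * |(c z : ℝ)| ^ 2) *
        (k.factorial * ∑ y ∈ Q ^ k, (dTilde P y : ℝ) * (B ^ k) y) := by
        rw [mul_comm]
        congr 1
        · refine Finset.sum_congr rfl fun n hn => ?_
          rw [hγ2, restrictTo_apply, if_pos ⟨hn, fun h => hI0 (h ▸ hn)⟩]
        · rw [Finset.mul_sum]
          refine Finset.sum_congr rfl fun n _ => ?_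
          rw [hBk]; ring
    _ ≤ _ := by
        refine mul_le_mul_of_nonneg_left (mul_le_mul_of_nonneg_left ?_ (by positivity))
          (Finset.sum_nonneg fun n _ => by positivity)
        refine (sum_weight_pow_apply_le hBs hQ0 hB0 hd (fun n => by positivity)
          (by exact_mod_cast dTilde_one P) k).trans ?_
        refine pow_le_pow_left₀ (Finset.sum_nonneg fun n _ => mul_nonneg (by positivity) (hB0 n)) ?_ k
        rw [Finset.mul_sum]
        exact Finset.sum_le_sum fun q hq => dTilde_mul_weightCoeffSq_le hP a q hq

end

section

open Complex Metric Set

/-! ### Lower bounds for nonvanishing holomorphic functions -/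

/-- A holomorphic logarithm of a nonvanishing holomorphic function on a disc. -/
lemma exists_log_on_ball {R : ℝ} (hR : 0 < R) {H : ℂ → ℂ} (hH : DifferentiableOn ℂ H (ball 0 R))
    (h0 : ∀ z ∈ ball (0 : ℂ) R, H z ≠ 0) :
    ∃ F : ℂ → ℂ, DifferentiableOn ℂ F (ball 0 R) ∧ F 0 = Complex.log (H 0) ∧
      ∀ z ∈ ball (0 : ℂ) R, Complex.exp (F z) = H z := by
  have hd : DifferentiableOn ℂ (fun z => deriv H z / H z) (ball 0 R) :=
    (hH.deriv isOpen_ball).div hH h0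
  obtain ⟨F, hF0, hF⟩ := (hd.isExactOn_ball).with_val_at 0 (Complex.log (H 0))
  have h0R : (0 : ℂ) ∈ ball (0 : ℂ) R := mem_ball_self hR
  refine ⟨F, fun z hz => (hF z hz).differentiableAt.differentiableWithinAt, hF0, ?_⟩
  have hder : ∀ z ∈ ball (0 : ℂ) R, HasDerivAt (fun z => Complex.exp (-F z) * H z) 0 z := by
    intro z hz
    have h1 := ((hF z hz).neg.cexp).mul ((hH.differentiableAt (isOpen_ball.mem_nhds hz)).hasDerivAt)
    have h2 : Complex.exp (-F z) * -(deriv H z / H z) * H z + Complex.exp (-F z) * deriv H z = 0 := by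
      rw [mul_assoc, neg_mul, div_mul_cancel₀ _ (h0 z hz)]
      ring
    exact h2 ▸ h1
  intro z hz
  have hconst : Complex.exp (-F z) * H z = Complex.exp (-F 0) * H 0 := by
    refine isOpen_ball.is_const_of_deriv_eq_zero (convex_ball 0 R).isPreconnected
      (f := fun z => Complex.exp (-F z) * H z)
      (fun w hw => (hder w hw).differentiableAt.differentiableWithinAt)
      (fun w hw => (hder w hw).deriv) hz h0R
  rw [hF0, Complex.exp_neg (Complex.log (H 0)), Complex.exp_log (h0 0 h0R),
    inv_mul_cancel₀ (h0 0 h0R), Complex.exp_neg] at hconst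
  field_simp at hconst
  exact hconst.symm

/-- Hadamard's three circles theorem, deduced from the three lines theorem by the exponential map. -/
lemma norm_le_of_three_circles {R r₁ r₂ a b : ℝ} (h1 : 0 < r₁) (h12 : r₁ < r₂) (h2 : r₂ < R)
    {F : ℂ → ℂ} (hF : DifferentiableOn ℂ F (ball 0 R))
    (ha : ∀ z : ℂ, ‖z‖ ≤ r₁ → ‖F z‖ ≤ a) (hb : ∀ z : ℂ, ‖z‖ ≤ r₂ → ‖F z‖ ≤ b)
    {z : ℂ} (hz1 : r₁ ≤ ‖z‖) (hz2 : ‖z‖ ≤ r₂) :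
    ‖F z‖ ≤ a ^ (1 - (Real.log ‖z‖ - Real.log r₁) / (Real.log r₂ - Real.log r₁)) *
      b ^ ((Real.log ‖z‖ - Real.log r₁) / (Real.log r₂ - Real.log r₁)) := by
  have hr2 : 0 < r₂ := h1.trans h12
  have hz0 : 0 < ‖z‖ := h1.trans_le hz1
  set l := Real.log r₂ - Real.log r₁ with hl
  have hlpos : 0 < l := sub_pos.2 (Real.log_lt_log h1 h12)
  set θ := (Real.log ‖z‖ - Real.log r₁) / l with hθ
  -- maps the strip `0 ≤ Re w ≤ 1` to the annulus, and the real point `θ` to `z`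
  set e : ℂ → ℂ := fun w => Complex.exp (Real.log r₁ + w * l + Complex.arg z * I) with he
  have hen : ∀ w, ‖e w‖ = Real.exp (Real.log r₁ + w.re * l) := by
    intro w
    rw [he, Complex.norm_exp]
    simp
  have hle : ∀ w : ℂ, w.re ≤ 1 → ‖e w‖ ≤ r₂ := by
    intro w hw
    rw [hen, ← Real.exp_log hr2, Real.exp_le_exp]
    nlinarith
  have hdiff : Differentiable ℂ e := by fun_prop
  have hθ0 : 0 ≤ θ := div_nonneg (sub_nonneg.2 (Real.log_le_log h1 hz1)) hlpos.le
  have hθ1 : θ ≤ 1 := by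
    rw [hθ, div_le_one hlpos, hl]
    linarith [Real.log_le_log hz0 hz2]
  have hez : e θ = z := by
    have : (Real.log r₁ + (θ : ℂ) * l) = ((Real.log ‖z‖ : ℝ) : ℂ) := by
      rw [hθ]
      push_cast
      rw [div_mul_cancel₀ _ (by exact_mod_cast hlpos.ne')]
      ring
    rw [he]
    simp only
    rw [this, Complex.exp_add, ← Complex.ofReal_exp, Real.exp_log hz0,
      Complex.norm_mul_exp_arg_mul_I]
  have hclos : closure (HadamardThreeLines.verticalStrip 0 1) =
      HadamardThreeLines.verticalClosedStrip 0 1 := by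
    rw [HadamardThreeLines.verticalStrip, HadamardThreeLines.verticalClosedStrip,
      Complex.closure_preimage_re, closure_Ioo zero_ne_one]
  have key := HadamardThreeLines.norm_le_interp_of_mem_verticalClosedStrip₀₁' (fun w => F (e w))
    (z := (θ : ℂ)) (a := a) (b := b) ⟨by simpa using hθ0, by simpa using hθ1⟩ ?_ ?_ ?_ ?_
  · simpa [hez] using key
  · apply DifferentiableOn.diffContOnCl
    rw [hclos]
    refine hF.comp hdiff.differentiableOn fun w hw => ?_
    rw [mem_ball_zero_iff]
    exact (hle w hw.2).trans_lt h2
  · refine ⟨b, ?_⟩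
    rintro _ ⟨w, hw, rfl⟩
    exact hb _ (hle w hw.2)
  · intro w hw
    refine ha _ ?_
    have : w.re = 0 := hw
    rw [hen, this, zero_mul, add_zero, Real.exp_log h1]
  · intro w hw
    have : w.re = 1 := hw
    exact hb _ (hle w this.le)

lemma norm_log_le_abs_log_norm_add_pi (w : ℂ) : ‖Complex.log w‖ ≤ |Real.log ‖w‖| + Real.pi := by
  refine (Complex.norm_le_abs_re_add_abs_im _).trans ?_
  rw [Complex.log_re, Complex.log_im]
  gcongr
  exact Complex.abs_arg_le_pi w

/-- Littlewood's bound: let `H` be holomorphic and nonvanishing on the disc of radius `3/2`, of norm at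
most `B` there, and of norm within fixed bounds on the disc of radius `1/2`. Then `1 / H` is `O(B^κ)` on
every smaller concentric disc, for every `κ > 0`. Indeed `log H` is `O(log B)` by the
Borel–Carathéodory theorem and `O(1)` near the centre, so the three circles theorem bounds it by
`O((log B)^θ)` with `θ < 1` in between. -/
theorem exists_norm_inv_le_rpow {ε κ K : ℝ} (hε : 0 < ε) (hε' : ε ≤ 1 / 2) (hκ : 0 < κ)
    (hK : 0 ≤ K) :
    ∃ C : ℝ, 0 < C ∧ ∀ (H : ℂ → ℂ) (B : ℝ), 1 ≤ B → DifferentiableOn ℂ H (ball 0 (3 / 2)) →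
      (∀ z ∈ ball (0 : ℂ) (3 / 2), H z ≠ 0) → (∀ z ∈ ball (0 : ℂ) (3 / 2), ‖H z‖ ≤ B) →
      (∀ z ∈ ball (0 : ℂ) (1 / 2), Real.exp (-K) ≤ ‖H z‖ ∧ ‖H z‖ ≤ Real.exp K) →
      ∀ z : ℂ, ‖z‖ ≤ 3 / 2 - ε → ‖(H z)⁻¹‖ ≤ C * B ^ κ := by
  have hpi := Real.pi_pos
  set l : ℝ := Real.log (3 / 2 - ε / 2) - Real.log (1 / 4) with hl
  have hlpos : 0 < l := sub_pos.2 (Real.log_lt_log (by norm_num) (by linarith))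
  set θ₀ : ℝ := (Real.log (3 / 2 - ε) - Real.log (1 / 4)) / l with hθ₀
  have hθ₀1 : θ₀ < 1 := by
    rw [hθ₀, div_lt_one hlpos, hl]
    linarith [Real.log_lt_log (show (0 : ℝ) < 3 / 2 - ε by linarith)
      (show 3 / 2 - ε < 3 / 2 - ε / 2 by linarith)]
  -- if `Y` is the bound for `log H` on the outer circle, the three circles bound is at most
  -- `K₁ L` when `Y ≤ L K₁`, and at most `Y L^{-(1 - θ₀)} ≤ κ log B + O(1)` otherwise
  obtain ⟨L, hL1, hLsmall⟩ : ∃ L : ℝ, 1 ≤ L ∧ L ^ (-(1 - θ₀)) ≤ κ * ε / 6 := by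
    have h1 := (tendsto_rpow_neg_atTop (sub_pos.2 hθ₀1)).eventually_le_const
      (show 0 < κ * ε / 6 by positivity)
    obtain ⟨L, h2, h3⟩ := (h1.and (Filter.eventually_ge_atTop 1)).exists
    exact ⟨L, h3, h2⟩
  set K₁ : ℝ := 2 * (K + 1) + 3 * (K + Real.pi) with hK₁
  have hK₁pos : 0 < K₁ := by positivity
  set C' : ℝ := K₁ * L + κ * (1 + K + Real.pi) with hC'
  refine ⟨Real.exp C', Real.exp_pos _, fun H B hB hH h0 hHB hHK => ?_⟩
  obtain ⟨F, hFd, hF0, hFe⟩ := exists_log_on_ball (by norm_num) hH h0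
  have hnorm : ∀ z ∈ ball (0 : ℂ) (3 / 2), ‖H z‖ = Real.exp (F z).re := fun z hz => by
    rw [← hFe z hz, Complex.norm_exp]
  have hlogB : 0 ≤ Real.log B := Real.log_nonneg hB
  set M := Real.log B + 1 with hM
  have hMpos : 0 < M := by positivity
  have hF0n : ‖F 0‖ ≤ K + Real.pi := by
    rw [hF0]
    refine (norm_log_le_abs_log_norm_add_pi _).trans (add_le_add ?_ le_rfl)
    obtain ⟨h1, h2⟩ := hHK 0 (by simp)
    have hp : 0 < ‖H 0‖ := (Real.exp_pos _).trans_le h1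
    rw [abs_le]
    constructor
    · rwa [Real.le_log_iff_exp_le hp]
    · rwa [Real.log_le_iff_le_exp hp]
  have hsub : ball (0 : ℂ) (1 / 2) ⊆ ball 0 (3 / 2) := ball_subset_ball (by norm_num)
  have hin : ∀ z : ℂ, ‖z‖ ≤ 1 / 4 → ‖F z‖ ≤ K₁ := by
    intro z hz
    have hzb : z ∈ ball (0 : ℂ) (1 / 2) := by rw [mem_ball_zero_iff]; linarith
    have h1 := Complex.borelCaratheodory (M := K + 1) (by positivity) (hFd.mono hsub)
      (fun w hw => by
        have h2 := (hHK w hw).2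
        rw [hnorm w (hsub hw), Real.exp_le_exp] at h2
        change (F w).re ≤ K + 1
        linarith) (by norm_num) hzb
    have hden : 0 < 1 / 2 - ‖z‖ := by linarith
    have hz0 := norm_nonneg z
    refine h1.trans (add_le_add ?_ ?_)
    · rw [div_le_iff₀ hden]; nlinarith
    · rw [div_le_iff₀ hden]
      calc ‖F 0‖ * (1 / 2 + ‖z‖) ≤ (K + Real.pi) * (1 / 2 + ‖z‖) := by gcongr
        _ ≤ 3 * (K + Real.pi) * (1 / 2 - ‖z‖) := by nlinarith [mul_nonneg hK hz0]
  set Y := (6 * M + 6 * (K + Real.pi)) / ε with hY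
  have hYpos : 0 < Y := by positivity
  have hout : ∀ z : ℂ, ‖z‖ ≤ 3 / 2 - ε / 2 → ‖F z‖ ≤ Y := by
    intro z hz
    have hzb : z ∈ ball (0 : ℂ) (3 / 2) := by rw [mem_ball_zero_iff]; linarith
    have h1 := Complex.borelCaratheodory (M := M) hMpos hFd
      (fun w hw => by
        have h2 := hHB w hw
        rw [hnorm w hw, ← Real.le_log_iff_exp_le (by linarith)] at h2
        change (F w).re ≤ M
        linarith) (by norm_num) hzb
    have hden : ε / 2 ≤ 3 / 2 - ‖z‖ := by linarith
    have hz0 := norm_nonneg z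
    calc ‖F z‖ ≤ 2 * M * ‖z‖ / (3 / 2 - ‖z‖) + ‖F 0‖ * (3 / 2 + ‖z‖) / (3 / 2 - ‖z‖) := h1
      _ ≤ 2 * M * (3 / 2) / (ε / 2) + (K + Real.pi) * (3 / 2 + 3 / 2) / (ε / 2) := by
          have : ‖z‖ ≤ 3 / 2 := by linarith
          gcongr
      _ = Y := by rw [hY]; field_simp; ring
  have hmain : ∀ z : ℂ, ‖z‖ ≤ 3 / 2 - ε → ‖F z‖ ≤ κ * Real.log B + C' := by
    intro z hz
    have hx : K₁ ≤ K₁ * L := le_mul_of_one_le_right hK₁pos.le hL1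
    rcases le_total ‖z‖ (1 / 4) with h | h
    · have := hin z h
      have h5 : 0 ≤ κ * Real.log B := by positivity
      have h6 : 0 ≤ κ * (1 + K + Real.pi) := by positivity
      rw [hC']; linarith
    · have h3 := norm_le_of_three_circles (by norm_num) (by linarith) (by linarith) hFd hin hout h
        (by linarith)
      set θ := (Real.log ‖z‖ - Real.log (1 / 4)) / (Real.log (3 / 2 - ε / 2) - Real.log (1 / 4))
        with hθ
      have hθ0 : 0 ≤ θ := div_nonneg (sub_nonneg.2 (Real.log_le_log (by norm_num) h)) hlpos.le
      have hθθ₀ : θ ≤ θ₀ := by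
        rw [hθ, hθ₀, hl]
        have := Real.log_le_log (by linarith) hz
        gcongr
      have h1θ : 0 ≤ 1 - θ := by linarith
      rcases le_total Y (L * K₁) with hYL | hYL
      · have : K₁ ^ (1 - θ) * Y ^ θ ≤ K₁ * L := by
          calc K₁ ^ (1 - θ) * Y ^ θ ≤ (L * K₁) ^ (1 - θ) * (L * K₁) ^ θ := by
                gcongr
                linarith
            _ = L * K₁ := by
                rw [← Real.rpow_add (by positivity)]; simp
            _ = K₁ * L := mul_comm _ _
        have h5 : 0 ≤ κ * Real.log B := by positivity
        have h6 : 0 ≤ κ * (1 + K + Real.pi) := by positivity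
        rw [hC']; linarith
      · have hLpos : 0 < L := by linarith
        have hKY : K₁ ≤ Y / L := by rw [le_div_iff₀ hLpos, mul_comm]; exact hYL
        have : K₁ ^ (1 - θ) * Y ^ θ ≤ Y * (κ * ε / 6) := by
          calc K₁ ^ (1 - θ) * Y ^ θ ≤ (Y / L) ^ (1 - θ) * Y ^ θ := by gcongr
            _ = Y * L ^ (-(1 - θ)) := by
                rw [Real.div_rpow hYpos.le hLpos.le, Real.rpow_neg hLpos.le, div_mul_eq_mul_div,
                  ← Real.rpow_add hYpos]
                simp [div_eq_mul_inv]
            _ ≤ Y * L ^ (-(1 - θ₀)) := by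
                gcongr
            _ ≤ _ := by gcongr
        have hYe : Y * (κ * ε / 6) = κ * Real.log B + κ * (1 + K + Real.pi) := by
          rw [hY, hM]; field_simp; ring
        have h7 : 0 ≤ K₁ * L := by positivity
        rw [hC']; linarith
  intro z hz
  have hzb : z ∈ ball (0 : ℂ) (3 / 2) := by rw [mem_ball_zero_iff]; linarith
  rw [norm_inv, hnorm z hzb, ← Real.exp_neg]
  have hBpos : 0 < B := by linarith
  calc Real.exp (-(F z).re) ≤ Real.exp (κ * Real.log B + C') := by
        rw [Real.exp_le_exp]
        exact ((neg_le_abs _).trans (Complex.abs_re_le_norm _)).trans (hmain z hz)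
    _ = Real.exp C' * B ^ κ := by
        rw [Real.exp_add, Real.rpow_def_of_pos hBpos, mul_comm κ, mul_comm]

end

section

open Complex Metric Set Filter MeasureTheory DirichletCharacter

/-! ### Polynomial bounds for Dirichlet `L`-functions -/

/-- The mean value of `χ` over a period. -/
def charMean {r : ℕ} [NeZero r] (χ : DirichletCharacter ℂ r) : ℂ :=
  (∑ a : ZMod r, χ a) / r

lemma charMean_of_ne_one {r : ℕ} [NeZero r] {χ : DirichletCharacter ℂ r} (hχ : χ ≠ 1) :
    charMean χ = 0 := by
  rw [charMean, MulChar.sum_eq_zero_of_ne_one hχ, zero_div]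

lemma norm_charMean_le {r : ℕ} [NeZero r] (χ : DirichletCharacter ℂ r) : ‖charMean χ‖ ≤ 1 := by
  have hr : (0 : ℝ) < r := by exact_mod_cast Nat.pos_of_ne_zero (NeZero.ne r)
  rw [charMean, norm_div, Complex.norm_natCast, div_le_one hr]
  refine (norm_sum_le _ _).trans ((Finset.sum_le_sum fun a _ => χ.norm_le_one a).trans ?_)
  simp [ZMod.card]

lemma sum_range_period {r : ℕ} [NeZero r] (χ : DirichletCharacter ℂ r) (N : ℕ) :
    ∑ k ∈ Finset.range r, χ ((N + k : ℕ) : ZMod r) = ∑ a : ZMod r, χ a := by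
  refine Finset.sum_bij' (fun k _ => ((N + k : ℕ) : ZMod r)) (fun a _ => (a - N).val) ?_ ?_ ?_ ?_ ?_
  · simp
  · intro a _; exact Finset.mem_range.2 (ZMod.val_lt _)
  · intro k hk
    simp only [Nat.cast_add, add_sub_cancel_left]
    exact ZMod.val_cast_of_lt (Finset.mem_range.1 hk)
  · intro a _
    simp
  · simp

lemma norm_sum_sub_charMean_mul_le {r : ℕ} [NeZero r] (χ : DirichletCharacter ℂ r) (N : ℕ) :
    ‖∑ k ∈ Finset.Icc 1 N, χ (k : ZMod r) - charMean χ * N‖ ≤ 2 * r := by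
  set D : ℕ → ℂ := fun N => ∑ k ∈ Finset.range N, χ ((1 + k : ℕ) : ZMod r) - charMean χ * N with hD
  have hr : (r : ℂ) ≠ 0 := by exact_mod_cast NeZero.ne r
  have hper : Function.Periodic D r := by
    intro M
    simp only [hD]
    rw [Finset.sum_range_add]
    have : ∑ k ∈ Finset.range r, χ ((1 + (M + k) : ℕ) : ZMod r) = charMean χ * r := by
      rw [charMean, div_mul_cancel₀ _ hr, ← sum_range_period χ (1 + M)]
      simp only [add_assoc]
    rw [this]
    push_cast
    ring
  have hD' : ∑ k ∈ Finset.Icc 1 N, χ (k : ZMod r) - charMean χ * N = D N := by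
    simp only [hD]
    congr 1
    clear_value D
    induction N with
    | zero => simp
    | succ N ih => rw [Finset.sum_Icc_succ_top (by lia), ih, Finset.sum_range_succ, add_comm N 1]
  rw [hD', ← hper.map_mod_nat]
  have hlt : N % r < r := Nat.mod_lt _ (Nat.pos_of_ne_zero (NeZero.ne r))
  have hle : ((N % r : ℕ) : ℝ) ≤ r := by exact_mod_cast hlt.le
  calc ‖D (N % r)‖ ≤ ‖∑ k ∈ Finset.range (N % r), χ ((1 + k : ℕ) : ZMod r)‖ +
        ‖charMean χ * (N % r : ℕ)‖ := norm_sub_le _ _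
    _ ≤ (N % r : ℕ) + 1 * (N % r : ℕ) := by
        refine add_le_add ?_ ?_
        · refine (norm_sum_le _ _).trans ((Finset.sum_le_sum fun a _ => χ.norm_le_one _).trans ?_)
          simp
        · rw [norm_mul, Complex.norm_natCast]
          exact mul_le_mul_of_nonneg_right (norm_charMean_le χ) (by positivity)
    _ ≤ 2 * r := by linarith

/-- The deviation of the summatory function of `χ` from its mean, on `(1, ∞)`. -/
def charRemainder {r : ℕ} [NeZero r] (χ : DirichletCharacter ℂ r) : ℝ → ℂ :=
  indicator (Ioi 1) fun t => ∑ k ∈ Finset.Icc 1 ⌊t⌋₊, χ (k : ZMod r) - charMean χ * t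

lemma norm_charRemainder_le {r : ℕ} [NeZero r] (χ : DirichletCharacter ℂ r) (t : ℝ) :
    ‖charRemainder χ t‖ ≤ 3 * r := by
  have hr1 : (1 : ℝ) ≤ r := by exact_mod_cast Nat.one_le_iff_ne_zero.2 (NeZero.ne r)
  rw [charRemainder]
  by_cases ht : t ∈ Ioi (1 : ℝ)
  · have ht0 : 0 ≤ t := le_trans zero_le_one (le_of_lt ht)
    rw [indicator_of_mem ht]
    have h1 := norm_sum_sub_charMean_mul_le χ ⌊t⌋₊
    have h2 : ‖charMean χ * ((⌊t⌋₊ : ℂ) - t)‖ ≤ 1 := by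
      rw [norm_mul]
      have : ‖((⌊t⌋₊ : ℂ) - t)‖ ≤ 1 := by
        have e : ((⌊t⌋₊ : ℂ) - t) = (((⌊t⌋₊ : ℝ) - t : ℝ) : ℂ) := by push_cast; ring
        rw [e, Complex.norm_real, Real.norm_eq_abs, abs_le]
        constructor
        · linarith [Nat.lt_floor_add_one t]
        · linarith [Nat.floor_le ht0]
      calc ‖charMean χ‖ * ‖((⌊t⌋₊ : ℂ) - t)‖ ≤ 1 * 1 :=
            mul_le_mul (norm_charMean_le χ) this (norm_nonneg _) zero_le_one
        _ = 1 := one_mul 1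
    have e : (∑ k ∈ Finset.Icc 1 ⌊t⌋₊, χ (k : ZMod r) - charMean χ * t) =
        (∑ k ∈ Finset.Icc 1 ⌊t⌋₊, χ (k : ZMod r) - charMean χ * (⌊t⌋₊ : ℂ)) +
        charMean χ * ((⌊t⌋₊ : ℂ) - t) := by ring
    rw [e]
    exact (norm_add_le _ _).trans (by linarith)
  · rw [indicator_of_notMem ht, norm_zero]; positivity

lemma measurable_charRemainder {r : ℕ} [NeZero r] (χ : DirichletCharacter ℂ r) :
    Measurable (charRemainder χ) := by
  refine Measurable.indicator ?_ measurableSet_Ioi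
  refine Measurable.sub ?_ (by fun_prop)
  exact (measurable_from_nat (f := fun N : ℕ => ∑ k ∈ Finset.Icc 1 N, χ (k : ZMod r))).comp
    Nat.measurable_floor

/-- The Mellin transform of the remainder, `∫_1^∞ (S(t) - c t) t^{-s-1} dt`. -/
def charMellin {r : ℕ} [NeZero r] (χ : DirichletCharacter ℂ r) (s : ℂ) : ℂ :=
  mellin (charRemainder χ) (-s)

lemma charMellin_eq {r : ℕ} [NeZero r] (χ : DirichletCharacter ℂ r) (s : ℂ) :
    charMellin χ s = ∫ t in Ioi (1 : ℝ),
      (∑ k ∈ Finset.Icc 1 ⌊t⌋₊, χ (k : ZMod r) - charMean χ * t) * (t : ℂ) ^ (-(s + 1)) := by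
  have h : ∀ t : ℝ, (t : ℂ) ^ (-s - 1) • charRemainder χ t = indicator (Ioi 1) (fun t : ℝ =>
      (∑ k ∈ Finset.Icc 1 ⌊t⌋₊, χ (k : ZMod r) - charMean χ * t) * (t : ℂ) ^ (-(s + 1))) t := by
    intro t
    rw [charRemainder]
    by_cases ht : t ∈ Ioi (1 : ℝ)
    · rw [indicator_of_mem ht, indicator_of_mem ht, smul_eq_mul, mul_comm, neg_add']
    · rw [indicator_of_notMem ht, indicator_of_notMem ht, smul_zero]
  rw [charMellin, mellin]
  simp_rw [h]
  rw [setIntegral_indicator measurableSet_Ioi]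
  congr 2
  ext t; simp only [mem_inter_iff, mem_Ioi]
  constructor
  · exact fun h => h.2
  · exact fun h => ⟨by linarith, h⟩

lemma differentiableAt_charMellin {r : ℕ} [NeZero r] (χ : DirichletCharacter ℂ r) {s : ℂ}
    (hs : 0 < s.re) : DifferentiableAt ℂ (charMellin χ) s := by
  have h : DifferentiableAt ℂ (mellin (charRemainder χ)) (-s) := by
    refine mellin_differentiableAt_of_isBigO_rpow (a := 0) (b := (-s).re - 1) ?_ ?_ (by simpa using hs)
      ?_ (by linarith)
    · refine LocallyIntegrable.locallyIntegrableOn ?_ _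
      refine (locallyIntegrable_const (3 * r : ℝ)).mono
        (measurable_charRemainder χ).aestronglyMeasurable (.of_forall fun t => ?_)
      exact (norm_charRemainder_le χ t).trans (Real.le_norm_self _)
    · refine Asymptotics.IsBigO.of_bound (3 * r) (.of_forall fun t => ?_)
      simpa using norm_charRemainder_le χ t
    · refine Asymptotics.IsBigO.of_bound 1 ?_
      have : Iio (1 : ℝ) ∈ nhdsWithin (0 : ℝ) (Ioi 0) :=
        mem_nhdsWithin_of_mem_nhds (Iio_mem_nhds zero_lt_one)
      filter_upwards [this] with t ht
      rw [charRemainder, indicator_of_notMem (by simpa using (le_of_lt ht)), norm_zero]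
      positivity
  exact h.comp s (differentiableAt_id.neg)

lemma norm_charMellin_le {r : ℕ} [NeZero r] (χ : DirichletCharacter ℂ r) {s : ℂ}
    (hs : 1 / 2 ≤ s.re) : ‖charMellin χ s‖ ≤ 6 * r := by
  have hσ : 0 < s.re := by linarith
  have hint : IntegrableOn (fun t : ℝ => (3 * r : ℝ) * t ^ (-(s.re + 1))) (Ioi 1) :=
    (integrableOn_Ioi_rpow_of_lt (by linarith) zero_lt_one).const_mul _
  rw [charMellin_eq]
  refine (norm_integral_le_of_norm_le hint ?_).trans ?_
  · filter_upwards [ae_restrict_mem measurableSet_Ioi] with t ht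
    have ht0 : 0 < t := lt_trans zero_lt_one ht
    rw [norm_mul, Complex.norm_cpow_eq_rpow_re_of_pos ht0]
    have h1 := norm_charRemainder_le χ t
    rw [charRemainder, indicator_of_mem ht] at h1
    have h2 : (-(s + 1)).re = -(s.re + 1) := by simp
    rw [h2]
    exact mul_le_mul_of_nonneg_right h1 (by positivity)
  · rw [integral_const_mul, integral_Ioi_rpow_of_lt (by linarith) zero_lt_one, Real.one_rpow]
    have : -1 / (-(s.re + 1) + 1) ≤ 2 := by
      rw [show -(s.re + 1) + 1 = -s.re by ring, neg_div_neg_eq, div_le_iff₀ hσ]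
      linarith
    nlinarith [(Nat.cast_nonneg r : (0 : ℝ) ≤ r)]

lemma LFunction_eq_of_one_lt_re {r : ℕ} [NeZero r] (χ : DirichletCharacter ℂ r) {s : ℂ}
    (hs : 1 < s.re) :
    χ.LFunction s = charMean χ * (s / (s - 1)) + s * charMellin χ s := by
  have hs1 : s - 1 ≠ 0 := by
    intro h; rw [sub_eq_zero] at h; rw [h] at hs; simp at hs
  have hO : (fun n : ℕ ↦ ∑ k ∈ Finset.Icc 1 n, χ (k : ZMod r)) =O[atTop]
      fun n ↦ (n : ℝ) ^ (1 : ℝ) := by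
    refine Asymptotics.IsBigO.of_bound 1 (.of_forall fun n => ?_)
    refine (norm_sum_le _ _).trans ((Finset.sum_le_sum fun a _ => χ.norm_le_one _).trans ?_)
    simp
  rw [LFunction_eq_LSeries χ hs, LSeries_eq_mul_integral _ zero_le_one hs
    (LSeriesSummable_of_one_lt_re χ hs) hO, charMellin_eq]
  have hi1 : IntegrableOn (fun t : ℝ => (∑ k ∈ Finset.Icc 1 ⌊t⌋₊, χ (k : ZMod r) - charMean χ * t) *
      (t : ℂ) ^ (-(s + 1))) (Ioi 1) := by
    refine Integrable.mono' ((integrableOn_Ioi_rpow_of_lt (a := -(s.re + 1)) (by linarith)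
      zero_lt_one).const_mul (3 * r : ℝ)) ?_ ?_
    · have hm : Measurable (fun t : ℝ =>
          (∑ k ∈ Finset.Icc 1 ⌊t⌋₊, χ (k : ZMod r) - charMean χ * t)) := by
        refine Measurable.sub ?_ (by fun_prop)
        exact (measurable_from_nat (f := fun N : ℕ => ∑ k ∈ Finset.Icc 1 N, χ (k : ZMod r))).comp
          Nat.measurable_floor
      exact (hm.mul (by fun_prop)).aestronglyMeasurable
    · filter_upwards [ae_restrict_mem measurableSet_Ioi] with t ht
      have ht0 : 0 < t := lt_trans zero_lt_one ht
      rw [norm_mul, Complex.norm_cpow_eq_rpow_re_of_pos ht0]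
      have h1 := norm_charRemainder_le χ t
      rw [charRemainder, indicator_of_mem ht] at h1
      have h2 : (-(s + 1)).re = -(s.re + 1) := by simp
      rw [h2]
      exact mul_le_mul_of_nonneg_right h1 (by positivity)
  have hi2 : IntegrableOn (fun t : ℝ => charMean χ * (t : ℂ) ^ (-s)) (Ioi 1) :=
    (integrableOn_Ioi_cpow_of_lt (by simpa using hs) zero_lt_one).const_mul _
  have hsplit : ∫ t in Ioi (1 : ℝ), (∑ k ∈ Finset.Icc 1 ⌊t⌋₊, χ (k : ZMod r)) * (t : ℂ) ^ (-(s + 1)) =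
      (∫ t in Ioi (1 : ℝ), (∑ k ∈ Finset.Icc 1 ⌊t⌋₊, χ (k : ZMod r) - charMean χ * t) *
      (t : ℂ) ^ (-(s + 1))) + ∫ t in Ioi (1 : ℝ), charMean χ * (t : ℂ) ^ (-s) := by
    rw [← integral_add hi1 hi2]
    refine setIntegral_congr_fun measurableSet_Ioi fun t ht => ?_
    have ht0 : (t : ℂ) ≠ 0 := by exact_mod_cast (lt_trans zero_lt_one ht).ne'
    have : (t : ℂ) ^ (-s) = t * (t : ℂ) ^ (-(s + 1)) := by
      rw [show -s = 1 + -(s + 1) by ring, Complex.cpow_add _ _ ht0, Complex.cpow_one]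
    simp only [this]
    ring
  rw [hsplit, integral_const_mul, integral_Ioi_cpow_of_lt (by simpa using hs) zero_lt_one]
  have : -s + 1 ≠ 0 := by intro h; apply hs1; linear_combination -h
  simp only [ofReal_one, one_cpow]
  have e : (-1 : ℂ) / (-s + 1) = 1 / (s - 1) := by
    rw [div_eq_div_iff this hs1]; ring
  rw [e]
  ring

lemma eqOn_re_pos {F G : ℂ → ℂ} (hF : DifferentiableOn ℂ F {s | 0 < s.re})
    (hG : DifferentiableOn ℂ G {s | 0 < s.re}) (h : ∀ s : ℂ, 1 < s.re → F s = G s) {s : ℂ}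
    (hs : 0 < s.re) : F s = G s := by
  have ho : IsOpen {s : ℂ | 0 < s.re} := isOpen_lt continuous_const Complex.continuous_re
  refine (hF.analyticOnNhd ho).eqOn_of_preconnected_of_eventuallyEq (hG.analyticOnNhd ho)
    (convex_halfSpace_re_gt 0).isPreconnected (z₀ := 2) (by simp) ?_ hs
  filter_upwards [(isOpen_lt continuous_const Complex.continuous_re).mem_nhds
    (show (1 : ℝ) < (2 : ℂ).re by norm_num)] with w hw
  exact h w hw

lemma LFunction_eq_mul_charMellin {r : ℕ} [NeZero r] {χ : DirichletCharacter ℂ r} (hχ : χ ≠ 1)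
    {s : ℂ} (hs : 0 < s.re) : χ.LFunction s = s * charMellin χ s := by
  refine eqOn_re_pos (F := χ.LFunction) (G := fun s => s * charMellin χ s)
    (differentiable_LFunction hχ).differentiableOn
    (fun w hw => ((differentiableAt_id.mul
      (differentiableAt_charMellin χ hw)).differentiableWithinAt)) (fun w hw => ?_) hs
  rw [LFunction_eq_of_one_lt_re χ hw, charMean_of_ne_one hχ]
  ring

lemma LFunctionTrivChar₁_eq {r : ℕ} [NeZero r] {s : ℂ} (hs : 0 < s.re) :
    LFunctionTrivChar₁ r s = s * (charMean (1 : DirichletCharacter ℂ r) +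
      (s - 1) * charMellin (1 : DirichletCharacter ℂ r) s) := by
  refine eqOn_re_pos (F := LFunctionTrivChar₁ r) (G := fun s => s *
    (charMean (1 : DirichletCharacter ℂ r) + (s - 1) * charMellin (1 : DirichletCharacter ℂ r) s))
    (differentiable_LFunctionTrivChar₁ r).differentiableOn
    (fun w hw => (differentiableAt_id.mul (DifferentiableAt.add (by fun_prop)
      (DifferentiableAt.mul (by fun_prop) (differentiableAt_charMellin _ hw)))).differentiableWithinAt)
    (fun w hw => ?_) hs
  have hw1 : w ≠ 1 := by rintro rfl; simp at hw
  have hw2 : w - 1 ≠ 0 := sub_ne_zero.2 hw1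
  rw [LFunctionTrivChar₁, Function.update_of_ne hw1, LFunctionTrivChar, LFunction_eq_of_one_lt_re _ hw]
  field_simp

/-! ### The reciprocal of an `L`-function under the Riemann hypothesis -/

/-- `1 / L(s, χ)`, continued by its value `0` at the pole `s = 1` for principal `χ`. -/
def LInv {r : ℕ} [NeZero r] (χ : DirichletCharacter ℂ r) (s : ℂ) : ℂ :=
  open Classical in if χ = 1 then (s - 1) / LFunctionTrivChar₁ r s else (χ.LFunction s)⁻¹

lemma LInv_of_ne_one {r : ℕ} [NeZero r] {χ : DirichletCharacter ℂ r} (hχ : χ ≠ 1) (s : ℂ) :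
    LInv χ s = (χ.LFunction s)⁻¹ := by rw [LInv, if_neg hχ]

lemma LInv_one {r : ℕ} [NeZero r] (s : ℂ) :
    LInv (1 : DirichletCharacter ℂ r) s = (s - 1) / LFunctionTrivChar₁ r s := by
  rw [LInv, if_pos rfl]

lemma LInv_of_ne {r : ℕ} [NeZero r] (χ : DirichletCharacter ℂ r) {s : ℂ} (hs : s ≠ 1) :
    LInv χ s = (χ.LFunction s)⁻¹ := by
  by_cases hχ : χ = 1
  · subst hχ
    rw [LInv_one, LFunctionTrivChar₁, Function.update_of_ne hs, LFunctionTrivChar,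
      div_mul_cancel_left₀ (sub_ne_zero.2 hs)]
  · exact LInv_of_ne_one hχ s

lemma LFunction_ne_zero_of_GRH {r : ℕ} [NeZero r] (h : GRH r) (χ : DirichletCharacter ℂ r) {s : ℂ}
    (hs : 1 / 2 < s.re) (h1 : χ ≠ 1 ∨ s ≠ 1) : χ.LFunction s ≠ 0 := by
  rcases le_or_gt 1 s.re with h2 | h2
  · exact LFunction_ne_zero_of_one_le_re χ h1 h2
  · intro h0
    have := h χ s (by linarith) h2 h0
    linarith

lemma LFunctionTrivChar₁_ne_zero_of_GRH {r : ℕ} [NeZero r] (h : GRH r) {s : ℂ}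
    (hs : 1 / 2 < s.re) : LFunctionTrivChar₁ r s ≠ 0 := by
  by_cases h1 : s = 1
  · subst h1; exact LFunctionTrivChar₁_apply_one_ne_zero r
  · rw [LFunctionTrivChar₁, Function.update_of_ne h1]
    exact mul_ne_zero (sub_ne_zero.2 h1) (LFunction_ne_zero_of_GRH h 1 hs (Or.inr h1))

lemma differentiableOn_LInv {r : ℕ} [NeZero r] (h : GRH r) (χ : DirichletCharacter ℂ r) :
    DifferentiableOn ℂ (LInv χ) {s | 1 / 2 < s.re} := by
  by_cases hχ : χ = 1
  · subst hχ
    have : LInv (1 : DirichletCharacter ℂ r) = fun s => (s - 1) / LFunctionTrivChar₁ r s :=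
      funext fun s => LInv_one s
    rw [this]
    exact (by fun_prop : Differentiable ℂ fun s : ℂ => s - 1).differentiableOn.div
      (differentiable_LFunctionTrivChar₁ r).differentiableOn
      fun s hs => LFunctionTrivChar₁_ne_zero_of_GRH h hs
  · have : LInv χ = fun s => (χ.LFunction s)⁻¹ := funext fun s => LInv_of_ne_one hχ s
    rw [this]
    exact (differentiable_LFunction hχ).differentiableOn.inv
      fun s hs => LFunction_ne_zero_of_GRH h χ hs (Or.inl hχ)

/-- `∑ n^{-σ}`. -/
def zetaSum (σ : ℝ) : ℝ := ∑' n : ℕ, ((n : ℝ) ^ σ)⁻¹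

lemma summable_zetaSum {σ : ℝ} (hσ : 1 < σ) : Summable fun n : ℕ => ((n : ℝ) ^ σ)⁻¹ :=
  Real.summable_nat_rpow_inv.2 hσ

lemma one_le_zetaSum {σ : ℝ} (hσ : 1 < σ) : 1 ≤ zetaSum σ := by
  have := (summable_zetaSum hσ).le_tsum 1 fun n _ => by positivity
  rw [zetaSum]
  simpa using this

lemma norm_term_le {f : ℕ → ℂ} (hf : ∀ n, ‖f n‖ ≤ 1) {s : ℂ} {σ : ℝ}
    (hσs : σ ≤ s.re) (n : ℕ) : ‖LSeries.term f s n‖ ≤ ((n : ℝ) ^ σ)⁻¹ := by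
  rw [LSeries.term]
  split_ifs with h
  · rw [norm_zero]; positivity
  · have hn : 0 < n := Nat.pos_of_ne_zero h
    rw [norm_div, Complex.norm_natCast_cpow_of_pos hn, div_eq_mul_inv]
    have h1 : (n : ℝ) ^ σ ≤ (n : ℝ) ^ s.re :=
      Real.rpow_le_rpow_of_exponent_le (by exact_mod_cast hn) hσs
    calc ‖f n‖ * ((n : ℝ) ^ s.re)⁻¹ ≤ 1 * ((n : ℝ) ^ σ)⁻¹ := by
          gcongr
          exact hf n
      _ = _ := one_mul _

lemma summable_norm_term {f : ℕ → ℂ} (hf : ∀ n, ‖f n‖ ≤ 1) {s : ℂ} (hs : 1 < s.re) :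
    Summable fun n => ‖LSeries.term f s n‖ :=
  Summable.of_nonneg_of_le (fun _ => norm_nonneg _) (norm_term_le hf le_rfl) (summable_zetaSum hs)

lemma norm_LSeries_le {f : ℕ → ℂ} (hf : ∀ n, ‖f n‖ ≤ 1) {s : ℂ} {σ : ℝ} (hσ : 1 < σ)
    (hσs : σ ≤ s.re) : ‖LSeries f s‖ ≤ zetaSum σ := by
  have hs : Summable fun n => ‖LSeries.term f s n‖ := summable_norm_term hf (hσ.trans_le hσs)
  exact (norm_tsum_le_tsum_norm hs).trans
    (hs.tsum_le_tsum (norm_term_le hf hσs) (summable_zetaSum hσ))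

lemma norm_LFunction_le {r : ℕ} [NeZero r] (χ : DirichletCharacter ℂ r) {s : ℂ} {σ : ℝ}
    (hσ : 1 < σ) (hσs : σ ≤ s.re) : ‖χ.LFunction s‖ ≤ zetaSum σ := by
  rw [LFunction_eq_LSeries χ (hσ.trans_le hσs)]
  exact norm_LSeries_le (fun n => χ.norm_le_one _) hσ hσs

lemma norm_char_mul_moebius_le {r : ℕ} (χ : DirichletCharacter ℂ r) (n : ℕ) :
    ‖(ArithmeticFunction.moebius n : ℂ) * χ (n : ZMod r)‖ ≤ 1 := by
  rw [norm_mul]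
  have h1 : ‖(ArithmeticFunction.moebius n : ℂ)‖ ≤ 1 := by
    rw [Complex.norm_intCast]
    exact_mod_cast ArithmeticFunction.abs_moebius_le_one
  calc _ ≤ (1 : ℝ) * 1 := mul_le_mul h1 (χ.norm_le_one _) (norm_nonneg _) zero_le_one
    _ = 1 := one_mul 1

lemma LInv_eq_LSeries {r : ℕ} [NeZero r] (χ : DirichletCharacter ℂ r) {s : ℂ} (hs : 1 < s.re) :
    LInv χ s = LSeries (fun n => (ArithmeticFunction.moebius n : ℂ) * χ (n : ZMod r)) s := by
  have h1 : s ≠ 1 := by rintro rfl; simp at hs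
  rw [LInv_of_ne χ h1, LFunction_eq_LSeries χ hs]
  have := LSeries.mul_mu_eq_one χ hs
  rw [inv_eq_of_mul_eq_one_right this]
  refine LSeries_congr (fun {n} _ => ?_) s
  simp [mul_comm]

lemma norm_LInv_le_zetaSum {r : ℕ} [NeZero r] (χ : DirichletCharacter ℂ r) {s : ℂ} {σ : ℝ}
    (hσ : 1 < σ) (hσs : σ ≤ s.re) : ‖LInv χ s‖ ≤ zetaSum σ := by
  rw [LInv_eq_LSeries χ (hσ.trans_le hσs)]
  exact norm_LSeries_le (norm_char_mul_moebius_le χ) hσ hσs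

lemma norm_sub_one_div_le {s : ℂ} (hs : 1 / 2 ≤ s.re) : ‖(s - 1) / s‖ ≤ 1 := by
  have h0 : s ≠ 0 := by rintro rfl; norm_num at hs
  rw [norm_div, div_le_one (norm_pos_iff.2 h0)]
  rw [← sq_le_sq₀ (norm_nonneg _) (norm_nonneg _), ← Complex.normSq_eq_norm_sq,
    ← Complex.normSq_eq_norm_sq, Complex.normSq_apply, Complex.normSq_apply]
  simp only [sub_re, one_re, sub_im, one_im, sub_zero]
  nlinarith

/-- Under the Riemann hypothesis for the characters modulo `r`, `1 / L(s, χ)` is `O((r (1 + |t|))^κ)`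
on every half-plane `Re s ≥ 1/2 + ε`. -/
theorem exists_norm_LInv_le {ε κ : ℝ} (hε : 0 < ε) (hε' : ε ≤ 1 / 2) (hκ : 0 < κ) :
    ∃ C : ℝ, 0 < C ∧ ∀ (r : ℕ) [NeZero r], GRH r → ∀ (χ : DirichletCharacter ℂ r) (s : ℂ),
      1 / 2 + ε ≤ s.re → ‖LInv χ s‖ ≤ C * ((r : ℝ) * (1 + |s.im|)) ^ κ := by
  set Z := zetaSum (3 / 2) with hZ
  have hZ1 : 1 ≤ Z := one_le_zetaSum (by norm_num)
  set K := Real.log (3 * Z) with hK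
  have hK0 : 0 ≤ K := Real.log_nonneg (by linarith)
  have hKe : Real.exp K = 3 * Z := Real.exp_log (by linarith)
  obtain ⟨C, hC, hmain⟩ := exists_norm_inv_le_rpow hε hε' hκ hK0
  refine ⟨max Z (C * 24 ^ κ), lt_max_of_lt_left (by linarith), fun r _ hG χ s hs => ?_⟩
  have hr1 : (1 : ℝ) ≤ r := by exact_mod_cast Nat.one_le_iff_ne_zero.2 (NeZero.ne r)
  have hbase : 1 ≤ (r : ℝ) * (1 + |s.im|) := by nlinarith [abs_nonneg s.im]
  have hpow : 1 ≤ ((r : ℝ) * (1 + |s.im|)) ^ κ := Real.one_le_rpow hbase hκ.le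
  rcases le_or_gt 2 s.re with h2 | h2
  · calc ‖LInv χ s‖ ≤ Z := norm_LInv_le_zetaSum χ (by norm_num) (by linarith)
      _ ≤ max Z (C * 24 ^ κ) * 1 := by rw [mul_one]; exact le_max_left _ _
      _ ≤ _ := by gcongr
  -- the disc of radius `3 / 2` about `2 + i Im s` lies in `Re > 1/2` and contains `s`
  set s₀ : ℂ := 2 + s.im * I with hs₀
  set B : ℝ := 6 * r * (4 + |s.im|) with hB
  have hB1 : 1 ≤ B := by rw [hB]; nlinarith [abs_nonneg s.im]
  have hre : ∀ {ρ : ℝ} {z : ℂ}, z ∈ ball (0 : ℂ) ρ → 2 - ρ < (s₀ + z).re := by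
    intro ρ z hz
    rw [mem_ball_zero_iff] at hz
    have := (abs_le.1 (Complex.abs_re_le_norm z)).1
    have e : (s₀ + z).re = 2 + z.re := by simp [hs₀]
    rw [e]; linarith
  have hnorm : ∀ z ∈ ball (0 : ℂ) (3 / 2), ‖s₀ + z‖ ≤ 4 + |s.im| := by
    intro z hz
    rw [mem_ball_zero_iff] at hz
    calc ‖s₀ + z‖ ≤ ‖s₀‖ + ‖z‖ := norm_add_le _ _
      _ ≤ (2 + |s.im|) + 3 / 2 := by
          refine add_le_add ?_ hz.le
          refine (norm_add_le _ _).trans ?_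
          simp
      _ ≤ _ := by linarith
  have hnorm1 : ∀ z ∈ ball (0 : ℂ) (3 / 2), ‖s₀ + z - 1‖ ≤ 3 + |s.im| := by
    intro z hz
    rw [mem_ball_zero_iff] at hz
    have e : s₀ + z - 1 = (1 + s.im * I) + z := by rw [hs₀]; ring
    rw [e]
    calc ‖(1 + s.im * I) + z‖ ≤ ‖(1 + s.im * I)‖ + ‖z‖ := norm_add_le _ _
      _ ≤ (1 + |s.im|) + 3 / 2 := by
          refine add_le_add ?_ hz.le
          refine (norm_add_le _ _).trans ?_
          simp
      _ ≤ _ := by linarith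
  have hzz : s₀ + ((s.re - 2 : ℝ) : ℂ) = s := by
    rw [hs₀]
    apply Complex.ext <;> simp
  have hzn : ‖((s.re - 2 : ℝ) : ℂ)‖ ≤ 3 / 2 - ε := by
    rw [Complex.norm_real, Real.norm_eq_abs, abs_le]
    constructor <;> linarith
  have hfin : C * B ^ κ ≤ max Z (C * 24 ^ κ) * ((r : ℝ) * (1 + |s.im|)) ^ κ := by
    have : B ≤ 24 * ((r : ℝ) * (1 + |s.im|)) := by
      rw [hB]; nlinarith [abs_nonneg s.im, mul_nonneg (zero_le_one.trans hr1) (abs_nonneg s.im)]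
    calc C * B ^ κ ≤ C * (24 * ((r : ℝ) * (1 + |s.im|))) ^ κ := by gcongr
      _ = (C * 24 ^ κ) * ((r : ℝ) * (1 + |s.im|)) ^ κ := by
          rw [Real.mul_rpow (by norm_num) (by linarith)]; ring
      _ ≤ _ := by gcongr; exact le_max_right _ _
  refine le_trans ?_ hfin
  by_cases hχ : χ = 1
  · subst hχ
    have hne0 : ∀ z ∈ ball (0 : ℂ) (3 / 2), s₀ + z ≠ 0 := by
      intro z hz h
      have := hre hz
      rw [h] at this; norm_num at this
    -- the factor `s - 1` removes the pole, and division by `s` bounds the size near `2 + i Im s`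
    have h := hmain (fun z => LFunctionTrivChar₁ r (s₀ + z) / (s₀ + z)) B hB1 ?_ ?_ ?_ ?_ _ hzn
    · simp only [hzz] at h
      rw [LInv_one]
      have hs0 : s ≠ 0 := by rintro rfl; norm_num at hs; linarith
      have e : (s - 1) / LFunctionTrivChar₁ r s = ((s - 1) / s) *
          (LFunctionTrivChar₁ r s / s)⁻¹ := by
        rw [inv_div]; field_simp
      rw [e, norm_mul]
      calc _ ≤ 1 * ‖(LFunctionTrivChar₁ r s / s)⁻¹‖ := by
            gcongr; exact norm_sub_one_div_le (by linarith)
        _ ≤ _ := by rw [one_mul]; exact h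
    · refine DifferentiableOn.div ?_ (by fun_prop) hne0
      exact ((differentiable_LFunctionTrivChar₁ r).comp
        (by fun_prop : Differentiable ℂ fun z : ℂ => s₀ + z)).differentiableOn
    · intro z hz
      refine div_ne_zero (LFunctionTrivChar₁_ne_zero_of_GRH hG ?_) (hne0 z hz)
      have := hre hz; linarith
    · intro z hz
      have h1 := hre hz
      rw [LFunctionTrivChar₁_eq (by linarith), mul_div_cancel_left₀ _ (hne0 z hz)]
      calc _ ≤ ‖charMean (1 : DirichletCharacter ℂ r)‖ +
            ‖(s₀ + z - 1)‖ * ‖charMellin (1 : DirichletCharacter ℂ r) (s₀ + z)‖ := by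
            rw [← norm_mul]; exact norm_add_le _ _
        _ ≤ 1 + (3 + |s.im|) * (6 * r) := by
            gcongr
            · exact norm_charMean_le _
            · exact hnorm1 z hz
            · exact norm_charMellin_le _ (by linarith)
        _ ≤ B := by rw [hB]; nlinarith
    · intro z hz
      have h1 := hre hz
      set w := s₀ + z with hw
      have hw32 : 3 / 2 ≤ w.re := by linarith
      have hw1 : w ≠ 1 := by intro h; rw [h] at hw32; norm_num at hw32
      have hw0 : w ≠ 0 := by intro h; rw [h] at hw32; norm_num at hw32
      have e : LFunctionTrivChar₁ r w / w =
          ((w - 1) / w) * (1 : DirichletCharacter ℂ r).LFunction w := by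
        rw [LFunctionTrivChar₁, Function.update_of_ne hw1, LFunctionTrivChar]; ring
      rw [e, norm_mul]
      have hL := norm_LFunction_le (1 : DirichletCharacter ℂ r) (s := w) (σ := 3 / 2)
        (by norm_num) hw32
      have hLi := norm_LInv_le_zetaSum (1 : DirichletCharacter ℂ r) (s := w) (σ := 3 / 2)
        (by norm_num) hw32
      rw [LInv_of_ne _ hw1, norm_inv] at hLi
      have hLpos : 0 < ‖(1 : DirichletCharacter ℂ r).LFunction w‖ :=
        norm_pos_iff.2 (LFunction_ne_zero_of_one_le_re _ (Or.inr hw1) (by linarith))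
      have hlow : 1 / 3 ≤ ‖(w - 1) / w‖ := by
        rw [norm_div, div_le_div_iff₀ (by norm_num) (norm_pos_iff.2 hw0)]
        have h5 : ‖w‖ ≤ ‖w - 1‖ + 1 := by
          have := norm_add_le (w - 1) 1
          simpa using this
        have h6 : 1 / 2 ≤ ‖w - 1‖ := by
          have := (le_abs_self _).trans (Complex.abs_re_le_norm (w - 1))
          simp only [sub_re, one_re] at this
          linarith
        linarith
      constructor
      · rw [Real.exp_neg, hKe, mul_inv]
        refine mul_le_mul (by linarith) ?_ (by positivity) (norm_nonneg _)
        exact inv_le_of_inv_le₀ hLpos hLi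
      · rw [hKe]
        calc _ ≤ 1 * Z := mul_le_mul (norm_sub_one_div_le (by linarith)) hL (norm_nonneg _)
              zero_le_one
          _ ≤ _ := by linarith
  · have h := hmain (fun z => χ.LFunction (s₀ + z)) B hB1 ?_ ?_ ?_ ?_ _ hzn
    · simp only [hzz] at h
      rw [LInv_of_ne_one hχ]
      exact h
    · exact ((differentiable_LFunction hχ).comp
        (by fun_prop : Differentiable ℂ fun z : ℂ => s₀ + z)).differentiableOn
    · intro z hz
      refine LFunction_ne_zero_of_GRH hG χ ?_ (Or.inl hχ)
      have := hre hz; linarith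
    · intro z hz
      have h1 := hre hz
      rw [LFunction_eq_mul_charMellin hχ (by linarith), norm_mul]
      calc _ ≤ (4 + |s.im|) * (6 * r) := by
            gcongr
            · exact hnorm z hz
            · exact norm_charMellin_le _ (by linarith)
        _ = B := by rw [hB]; ring
    · intro z hz
      have h1 := hre hz
      have hw32 : 3 / 2 ≤ (s₀ + z).re := by linarith
      have hL := norm_LFunction_le χ (s := s₀ + z) (σ := 3 / 2) (by norm_num) hw32
      have hLi := norm_LInv_le_zetaSum χ (s := s₀ + z) (σ := 3 / 2) (by norm_num) hw32
      rw [LInv_of_ne_one hχ, norm_inv] at hLi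
      have hLpos : 0 < ‖χ.LFunction (s₀ + z)‖ :=
        norm_pos_iff.2 (LFunction_ne_zero_of_one_le_re _ (Or.inl hχ) (by linarith))
      constructor
      · rw [Real.exp_neg, hKe]
        refine le_trans ?_ (inv_le_of_inv_le₀ hLpos hLi)
        gcongr
        linarith
      · rw [hKe]; linarith

end

section

open Complex Set Filter MeasureTheory

/-! ### A sharp cutoff with absolutely convergent Perron integral -/

lemma integrable_one_add_abs_rpow {p : ℝ} (hp : 1 < p) :
    Integrable fun t : ℝ => (1 + |t|) ^ (-p) := by
  have := integrable_one_add_norm (E := ℝ) (μ := volume) (r := p) (by simpa using hp)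
  simpa using this

lemma le_norm_line (σ t : ℝ) :
    min σ 1 / 2 * (1 + |t|) ≤ ‖(σ : ℂ) + t * I‖ := by
  have h1 : σ ≤ ‖(σ : ℂ) + t * I‖ := by
    have := (le_abs_self _).trans (Complex.abs_re_le_norm ((σ : ℂ) + t * I))
    simpa using this
  have h2 : |t| ≤ ‖(σ : ℂ) + t * I‖ := by
    have := Complex.abs_im_le_norm ((σ : ℂ) + t * I)
    simpa using this
  have h3 := min_le_left σ 1
  have h4 := min_le_right σ 1
  nlinarith [abs_nonneg t]

lemma norm_le_norm_add_one {s : ℂ} (hs : 0 ≤ s.re) : ‖s‖ ≤ ‖s + 1‖ := by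
  rw [← sq_le_sq₀ (norm_nonneg _) (norm_nonneg _), ← Complex.normSq_eq_norm_sq,
    ← Complex.normSq_eq_norm_sq, Complex.normSq_apply, Complex.normSq_apply]
  simp only [add_re, one_re, add_im, one_im, add_zero]
  nlinarith

lemma ne_zero_and_of_re_pos {s : ℂ} (hs : 0 < s.re) : s ≠ 0 ∧ s + 1 ≠ 0 := by
  constructor
  · rintro rfl; simp at hs
  · intro h
    have := congrArg Complex.re h
    simp at this
    linarith

lemma integrable_inv_mul_line {σ : ℝ} (hσ : 0 < σ) :
    Integrable fun t : ℝ => (((σ : ℂ) + t * I) * ((σ : ℂ) + t * I + 1))⁻¹ := by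
  set c := min σ 1 / 2 with hc
  have hcpos : 0 < c := by positivity
  refine Integrable.mono' ((integrable_one_add_abs_rpow (p := 2) (by norm_num)).const_mul (c⁻¹ ^ 2))
    ?_ (.of_forall fun t => ?_)
  · refine Continuous.aestronglyMeasurable (Continuous.inv₀ (by fun_prop) fun t => ?_)
    have := ne_zero_and_of_re_pos (s := (σ : ℂ) + t * I) (by simpa using hσ)
    exact mul_ne_zero this.1 this.2
  · have h1 := le_norm_line σ t
    have h2 := norm_le_norm_add_one (s := (σ : ℂ) + t * I) (by simpa using hσ.le)
    have ht : 0 < 1 + |t| := by positivity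
    have hcp : 0 < c * (1 + |t|) := by positivity
    rw [norm_inv, norm_mul]
    calc (‖(σ : ℂ) + t * I‖ * ‖(σ : ℂ) + t * I + 1‖)⁻¹
        ≤ ((c * (1 + |t|)) * (c * (1 + |t|)))⁻¹ := by
          gcongr
          exact h1.trans h2
      _ = c⁻¹ ^ 2 * (1 + |t|) ^ (-2 : ℝ) := by
          rw [Real.rpow_neg ht.le, Real.rpow_two]
          field_simp

/-- Mellin inversion for `(1 - u)₊`. -/
lemma integral_cpow_div_line {σ X : ℝ} (hσ : 0 < σ) (hX : 0 < X) :
    ∫ t : ℝ, (X : ℂ) ^ (-((σ : ℂ) + t * I)) * (((σ : ℂ) + t * I) * ((σ : ℂ) + t * I + 1))⁻¹ =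
      2 * Real.pi * (max 0 (1 - X) : ℝ) := by
  set f : ℝ → ℂ := fun t => indicator (Ioc 0 1) (fun _ => (1 : ℂ)) t -
    indicator (Ioc 0 1) (fun t : ℝ => (t : ℂ) ^ (1 : ℂ)) t with hf
  have hmel : ∀ s : ℂ, 0 < s.re → HasMellin f s ((s * (s + 1))⁻¹) := by
    intro s hs
    have h1 := hasMellin_one_Ioc hs
    have h2 := hasMellin_cpow_Ioc 1 (s := s) (by simp; linarith)
    have h3 := hasMellin_sub h1.1 h2.1
    refine ⟨h3.1, ?_⟩
    rw [hf, h3.2, h1.2, h2.2]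
    obtain ⟨h4, h5⟩ := ne_zero_and_of_re_pos hs
    field_simp
    ring
  have hfmax : ∀ t : ℝ, 0 < t → f t = ((max 0 (1 - t) : ℝ) : ℂ) := by
    intro t ht
    by_cases h : t ≤ 1
    · have hm : t ∈ Ioc (0 : ℝ) 1 := ⟨ht, h⟩
      simp only [hf, indicator_of_mem hm, cpow_one]
      rw [max_eq_right (by linarith)]
      push_cast; ring
    · have hm : t ∉ Ioc (0 : ℝ) 1 := fun h' => h h'.2
      simp only [hf, indicator_of_notMem hm]
      rw [max_eq_left (by linarith)]
      simp
  have hcont : ContinuousAt f X := by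
    have : Continuous fun t : ℝ => ((max 0 (1 - t) : ℝ) : ℂ) := by fun_prop
    refine this.continuousAt.congr ?_
    filter_upwards [lt_mem_nhds hX] with t ht
    exact (hfmax t ht).symm
  have hline : ∀ t : ℝ, mellin f ((σ : ℂ) + t * I) =
      (((σ : ℂ) + t * I) * ((σ : ℂ) + t * I + 1))⁻¹ := fun t =>
    (hmel _ (by simpa using hσ)).2
  have hvert : VerticalIntegrable (mellin f) σ := by
    unfold VerticalIntegrable
    simp_rw [hline]
    exact integrable_inv_mul_line hσ
  have key := mellinInv_mellin_eq σ f hX (hmel _ (by simpa using hσ)).1 hvert hcont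
  rw [mellinInv, hfmax X hX] at key
  simp_rw [hline, smul_eq_mul] at key
  have hpi : (Real.pi : ℂ) ≠ 0 := by exact_mod_cast Real.pi_ne_zero
  have h2 : 2 * (Real.pi : ℂ) * ((1 / (2 * Real.pi) : ℝ) : ℂ) = 1 := by push_cast; field_simp
  rw [← key, Complex.real_smul, ← mul_assoc, h2, one_mul]

/-- The Mellin transform of the continuous cutoff that equals `1` on `[0, N]`, vanishes on
`[N + 1, ∞)` and is affine in between. It detects `n ≤ N` exactly for integers `n`, and it decays
quadratically on vertical lines. -/
def perronKernel (N : ℕ) (s : ℂ) : ℂ :=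
  (((N : ℂ) + 1) ^ (s + 1) - (N : ℂ) ^ (s + 1)) / (s * (s + 1))

lemma natCast_cpow_add_one_mul {N n : ℕ} (hN : 1 ≤ N) (s : ℂ) :
    (N : ℂ) ^ (s + 1) * (n : ℂ) ^ (-s) = N * (((n : ℝ) / N : ℝ) : ℂ) ^ (-s) := by
  have hN0 : (N : ℂ) ≠ 0 := by exact_mod_cast (by lia : N ≠ 0)
  have hN0' : (N : ℝ) ≠ 0 := by exact_mod_cast (by lia : N ≠ 0)
  have : (n : ℂ) ^ (-s) = (((n : ℝ) / N : ℝ) : ℂ) ^ (-s) * (N : ℂ) ^ (-s) := by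
    have h := Complex.mul_cpow_ofReal_nonneg (a := (n : ℝ) / N) (b := N) (by positivity)
      (by positivity) (-s)
    rw [← Complex.ofReal_mul, div_mul_cancel₀ _ hN0'] at h
    simpa using h
  rw [this, Complex.cpow_add _ _ hN0, cpow_one]
  have h2 : (N : ℂ) ^ s * (N : ℂ) ^ (-s) = 1 := by
    rw [← Complex.cpow_add _ _ hN0, add_neg_cancel, cpow_zero]
  linear_combination (N * (((n : ℝ) / N : ℝ) : ℂ) ^ (-s)) * h2

lemma perronKernel_mul_eq {N n : ℕ} (hN : 1 ≤ N) (s : ℂ) :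
    perronKernel N s * (n : ℂ) ^ (-s) =
      ((N + 1 : ℕ) : ℂ) * ((((n : ℝ) / (N + 1 : ℕ) : ℝ) : ℂ) ^ (-s) * (s * (s + 1))⁻¹) -
        (N : ℂ) * ((((n : ℝ) / N : ℝ) : ℂ) ^ (-s) * (s * (s + 1))⁻¹) := by
  have h1 := natCast_cpow_add_one_mul (N := N + 1) (n := n) (by lia) s
  have h2 := natCast_cpow_add_one_mul (N := N) (n := n) hN s
  rw [perronKernel, div_eq_mul_inv]
  have e : ((N : ℂ) + 1) = ((N + 1 : ℕ) : ℂ) := by push_cast; ring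
  rw [e]
  linear_combination (s * (s + 1))⁻¹ * h1 - (s * (s + 1))⁻¹ * h2

lemma integrable_cpow_div_line {σ X : ℝ} (hσ : 0 < σ) (hX : 0 < X) :
    Integrable fun t : ℝ => (X : ℂ) ^ (-((σ : ℂ) + t * I)) *
      (((σ : ℂ) + t * I) * ((σ : ℂ) + t * I + 1))⁻¹ := by
  have hX0 : (X : ℂ) ≠ 0 := by exact_mod_cast hX.ne'
  refine (integrable_inv_mul_line hσ).bdd_mul (c := X ^ (-σ)) ?_ (.of_forall fun t => ?_)
  · refine Continuous.aestronglyMeasurable ?_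
    exact Continuous.const_cpow (by fun_prop) (Or.inl hX0)
  · rw [Complex.norm_cpow_eq_rpow_re_of_pos hX]; simp

lemma integral_perronKernel_mul {N n : ℕ} (hN : 1 ≤ N) (hn : 1 ≤ n) {σ : ℝ} (hσ : 0 < σ) :
    ∫ t : ℝ, perronKernel N ((σ : ℂ) + t * I) * (n : ℂ) ^ (-((σ : ℂ) + t * I)) =
      2 * Real.pi * if n ≤ N then 1 else 0 := by
  have hn0 : (0 : ℝ) < n := by exact_mod_cast hn
  have hN0 : (0 : ℝ) < N := by exact_mod_cast hN
  have hX1 : (0 : ℝ) < (n : ℝ) / (N + 1 : ℕ) := by positivity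
  have hX2 : (0 : ℝ) < (n : ℝ) / N := by positivity
  simp_rw [perronKernel_mul_eq hN]
  rw [integral_sub ((integrable_cpow_div_line hσ hX1).const_mul _)
    ((integrable_cpow_div_line hσ hX2).const_mul _), integral_const_mul, integral_const_mul,
    integral_cpow_div_line hσ hX1, integral_cpow_div_line hσ hX2]
  have key : ((N + 1 : ℕ) : ℝ) * max 0 (1 - (n : ℝ) / (N + 1 : ℕ)) - N * max 0 (1 - (n : ℝ) / N) =
      if n ≤ N then 1 else 0 := by
    rw [mul_max_of_nonneg _ _ (by positivity), mul_max_of_nonneg _ _ hN0.le, mul_zero, mul_zero,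
      mul_sub, mul_sub, mul_div_cancel₀ _ (by positivity), mul_div_cancel₀ _ hN0.ne', mul_one, mul_one]
    split_ifs with h
    · have h' : (n : ℝ) ≤ N := by exact_mod_cast h
      rw [max_eq_right (by push_cast; linarith), max_eq_right (by linarith)]
      push_cast; ring
    · have h' : (N : ℝ) + 1 ≤ n := by exact_mod_cast (by lia : N + 1 ≤ n)
      rw [max_eq_left (by push_cast; linarith), max_eq_left (by linarith)]
      ring
  have key' := congrArg (fun x : ℝ => (x : ℂ)) key
  rw [apply_ite (fun x : ℝ => (x : ℂ))] at key'
  push_cast at key'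
  push_cast
  linear_combination (2 * (Real.pi : ℂ)) * key'

lemma norm_perronKernel_le {N : ℕ} (hN : 1 ≤ N) {s : ℂ} (hs : 1 / 2 ≤ s.re) {κ : ℝ}
    (hκ0 : 0 ≤ κ) (hκ1 : κ ≤ 1) :
    ‖perronKernel N s‖ ≤ 32 * ((N : ℝ) + 1) ^ (s.re + κ) * (1 + |s.im|) ^ (-(1 + κ)) := by
  obtain ⟨hs0, hs1⟩ := ne_zero_and_of_re_pos (s := s) (by linarith)
  set A : ℝ := (N : ℝ) + 1 with hA
  have hA1 : 1 ≤ A := by rw [hA]; linarith [(Nat.cast_nonneg N : (0 : ℝ) ≤ N)]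
  have hA0 : 0 < A := by linarith
  have hN0 : (0 : ℝ) < N := by exact_mod_cast hN
  have hsn : 0 < ‖s‖ := norm_pos_iff.2 hs0
  set D : ℂ := ((N : ℂ) + 1) ^ (s + 1) - (N : ℂ) ^ (s + 1) with hD
  have hb1 : ‖D / (s + 1)‖ ≤ A ^ s.re := by
    have hne : ∀ u ∈ Icc (N : ℝ) A, u ≠ 0 := fun u hu => (hN0.trans_le hu.1).ne'
    have hd : ∀ u ∈ Icc (N : ℝ) A, HasDerivWithinAt (fun y : ℝ => (y : ℂ) ^ (s + 1) / (s + 1))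
        ((u : ℂ) ^ s) (Icc (N : ℝ) A) u := fun u hu =>
      (hasDerivAt_ofReal_cpow_const' (r := s) (hne u hu) (fun h => hs1 (by rw [h]; ring))).hasDerivWithinAt
    have := norm_image_sub_le_of_norm_deriv_le_segment' hd (C := A ^ s.re) (fun u hu => by
      rw [Complex.norm_cpow_eq_rpow_re_of_pos (hN0.trans_le hu.1)]
      exact Real.rpow_le_rpow (hN0.le.trans hu.1) hu.2.le (by linarith)) A ⟨by rw [hA]; linarith, le_rfl⟩
    have e : (A : ℂ) ^ (s + 1) / (s + 1) - ((N : ℝ) : ℂ) ^ (s + 1) / (s + 1) = D / (s + 1) := by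
      rw [hD, hA]; push_cast; ring
    rw [e] at this
    have e2 : A - N = 1 := by rw [hA]; ring
    rwa [e2, mul_one] at this
  have hb2 : ‖D‖ ≤ 2 * A ^ (s.re + 1) := by
    have e : ((N : ℂ) + 1) = ((A : ℝ) : ℂ) := by rw [hA]; push_cast; ring
    rw [hD]
    refine (norm_sub_le _ _).trans ?_
    rw [e, show (N : ℂ) = ((N : ℝ) : ℂ) by simp, Complex.norm_cpow_eq_rpow_re_of_pos hA0,
      Complex.norm_cpow_eq_rpow_re_of_pos hN0]
    have h1 : (N : ℝ) ^ (s + 1).re ≤ A ^ (s + 1).re :=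
      Real.rpow_le_rpow hN0.le (by rw [hA]; linarith) (by simp; linarith)
    have e3 : (s + 1).re = s.re + 1 := by simp
    rw [e3] at h1 ⊢
    linarith
  have hK1 : ‖perronKernel N s‖ ≤ A ^ s.re / ‖s‖ := by
    have e : perronKernel N s = (D / (s + 1)) / s := by
      rw [perronKernel, div_div, mul_comm]
    rw [e, norm_div]
    gcongr
  have hK2 : ‖perronKernel N s‖ ≤ 2 * A ^ (s.re + 1) / ‖s‖ ^ 2 := by
    rw [perronKernel, norm_div, norm_mul, sq]
    gcongr
    exact norm_le_norm_add_one (by linarith)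
  have hK : ‖perronKernel N s‖ ≤ 2 * A ^ (s.re + κ) * ‖s‖ ^ (-(1 + κ)) := by
    rcases eq_or_lt_of_le (norm_nonneg (perronKernel N s)) with h0 | h0
    · rw [← h0]; positivity
    calc ‖perronKernel N s‖ = ‖perronKernel N s‖ ^ (1 - κ) * ‖perronKernel N s‖ ^ κ := by
          rw [← Real.rpow_add h0]; simp
      _ ≤ (A ^ s.re / ‖s‖) ^ (1 - κ) * (2 * A ^ (s.re + 1) / ‖s‖ ^ 2) ^ κ := by
          gcongr
      _ = 2 ^ κ * (A ^ (s.re + κ) * ‖s‖ ^ (-(1 + κ))) := by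
          rw [← Real.rpow_natCast ‖s‖ 2, Real.div_rpow (by positivity) hsn.le,
            Real.div_rpow (by positivity) (by positivity), Real.mul_rpow (by norm_num) (by positivity),
            ← Real.rpow_mul hA0.le, ← Real.rpow_mul hA0.le, ← Real.rpow_mul hsn.le]
          rw [show s.re + κ = s.re * (1 - κ) + (s.re + 1) * κ by ring, Real.rpow_add hA0,
            show -(1 + κ) = -(1 - κ) + -((2 : ℕ) * κ) by push_cast; ring, Real.rpow_add hsn,
            Real.rpow_neg hsn.le, Real.rpow_neg hsn.le]
          ring
      _ ≤ 2 ^ (1 : ℝ) * (A ^ (s.re + κ) * ‖s‖ ^ (-(1 + κ))) := by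
          gcongr
          norm_num
      _ = _ := by rw [Real.rpow_one]; ring
  have hs4 : (1 + |s.im|) / 4 ≤ ‖s‖ := by
    have h1 := (le_abs_self _).trans (Complex.abs_re_le_norm s)
    have h2 := Complex.abs_im_le_norm s
    linarith
  have ht : 0 < 1 + |s.im| := by positivity
  calc ‖perronKernel N s‖ ≤ 2 * A ^ (s.re + κ) * ‖s‖ ^ (-(1 + κ)) := hK
    _ ≤ 2 * A ^ (s.re + κ) * ((1 + |s.im|) / 4) ^ (-(1 + κ)) := by
        gcongr 2 * A ^ (s.re + κ) * ?_
        exact Real.rpow_le_rpow_of_nonpos (by positivity) hs4 (by linarith)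
    _ = 2 * 4 ^ (1 + κ) * A ^ (s.re + κ) * (1 + |s.im|) ^ (-(1 + κ)) := by
        rw [Real.div_rpow ht.le (by norm_num), Real.rpow_neg (by norm_num : (0 : ℝ) ≤ 4)]
        field_simp
    _ ≤ 2 * 4 ^ (2 : ℝ) * A ^ (s.re + κ) * (1 + |s.im|) ^ (-(1 + κ)) := by
        gcongr
        · norm_num
        · linarith
    _ = _ := by norm_num

lemma differentiableOn_perronKernel {N : ℕ} (hN : 1 ≤ N) :
    DifferentiableOn ℂ (perronKernel N) {s | 0 < s.re} := by
  have hN0 : (N : ℂ) ≠ 0 := by exact_mod_cast (by lia : N ≠ 0)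
  have hN1 : (N : ℂ) + 1 ≠ 0 := by exact_mod_cast (by lia : N + 1 ≠ 0)
  refine DifferentiableOn.div ?_ (by fun_prop) fun s hs => ?_
  · refine Differentiable.differentiableOn (Differentiable.sub ?_ ?_)
    · exact Differentiable.const_cpow (by fun_prop) (Or.inl hN1)
    · exact Differentiable.const_cpow (by fun_prop) (Or.inl hN0)
  · exact mul_ne_zero (ne_zero_and_of_re_pos hs).1 (ne_zero_and_of_re_pos hs).2

lemma continuous_perronKernel_line {N : ℕ} (hN : 1 ≤ N) {σ : ℝ} (hσ : 0 < σ) :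
    Continuous fun t : ℝ => perronKernel N ((σ : ℂ) + t * I) := by
  have ho : IsOpen {s : ℂ | 0 < s.re} := isOpen_lt continuous_const Complex.continuous_re
  refine continuous_iff_continuousAt.2 fun t => ?_
  have h : ContinuousAt (perronKernel N) ((σ : ℂ) + t * I) :=
    ((differentiableOn_perronKernel hN).differentiableAt
      (ho.mem_nhds (by simpa using hσ))).continuousAt
  exact ContinuousAt.comp (f := fun t : ℝ => (σ : ℂ) + t * I) h (by fun_prop)

lemma integrable_perronKernel_line {N : ℕ} (hN : 1 ≤ N) {σ : ℝ} (hσ : 1 / 2 ≤ σ) :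
    Integrable fun t : ℝ => perronKernel N ((σ : ℂ) + t * I) := by
  refine Integrable.mono' ((integrable_one_add_abs_rpow (p := 1 + 1) (by norm_num)).const_mul
    (32 * ((N : ℝ) + 1) ^ (σ + 1))) (continuous_perronKernel_line hN (by linarith)).aestronglyMeasurable
    (.of_forall fun t => ?_)
  have := norm_perronKernel_le hN (s := (σ : ℂ) + t * I) (by simpa using hσ) zero_le_one le_rfl
  simpa using this

/-! ### Contour shift -/

/-- Shifting a vertical line of integration across a strip. -/
lemma integral_line_eq_of_strip {f : ℂ → ℂ} {a b C p : ℝ} (hab : a ≤ b) (hp : 1 < p)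
    (hf : DifferentiableOn ℂ f {s | a ≤ s.re ∧ s.re ≤ b})
    (hC : ∀ s : ℂ, a ≤ s.re → s.re ≤ b → ‖f s‖ ≤ C * (1 + |s.im|) ^ (-p)) :
    ∫ t : ℝ, f ((a : ℂ) + t * I) = ∫ t : ℝ, f ((b : ℂ) + t * I) := by
  have hline : ∀ σ : ℝ, a ≤ σ → σ ≤ b → Integrable fun t : ℝ => f ((σ : ℂ) + t * I) := by
    intro σ h1 h2
    have hmem : ∀ t : ℝ, (σ : ℂ) + t * I ∈ {s : ℂ | a ≤ s.re ∧ s.re ≤ b} := fun t => by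
      simpa using ⟨h1, h2⟩
    have hcont : Continuous fun t : ℝ => f ((σ : ℂ) + t * I) :=
      hf.continuousOn.comp_continuous (by fun_prop) hmem
    refine Integrable.mono' ((integrable_one_add_abs_rpow hp).const_mul C)
      hcont.aestronglyMeasurable (.of_forall fun t => ?_)
    have := hC ((σ : ℂ) + t * I) (hmem t).1 (hmem t).2
    simpa using this
  have hlim : ∀ σ : ℝ, a ≤ σ → σ ≤ b → Tendsto (fun T : ℝ => ∫ t in (-T)..T, f ((σ : ℂ) + t * I))
      atTop (nhds (∫ t : ℝ, f ((σ : ℂ) + t * I))) := fun σ h1 h2 =>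
    intervalIntegral_tendsto_integral (hline σ h1 h2) tendsto_neg_atTop_atBot tendsto_id
  have hrect : ∀ T : ℝ, (∫ x in a..b, f (x + (-T : ℝ) * I)) - (∫ x in a..b, f (x + (T : ℝ) * I)) +
      I • (∫ y in (-T)..T, f ((b : ℂ) + y * I)) - I • (∫ y in (-T)..T, f ((a : ℂ) + y * I)) = 0 := by
    intro T
    have := Complex.integral_boundary_rect_eq_zero_of_differentiableOn f
      ((a : ℂ) + (-T : ℝ) * I) ((b : ℂ) + (T : ℝ) * I) (hf.mono ?_)
    · simpa using this
    · intro s hs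
      rw [mem_reProdIm] at hs
      have h1 := hs.1
      simp only [add_re, ofReal_re, mul_re, I_re, mul_zero, ofReal_im, I_im, mul_one, sub_self,
        add_zero] at h1
      rw [uIcc_of_le hab] at h1
      exact h1
  have hhor : ∀ T : ℝ, ‖∫ x in a..b, f (x + (T : ℝ) * I)‖ ≤ C * (1 + |T|) ^ (-p) * |b - a| := by
    intro T
    refine intervalIntegral.norm_integral_le_of_norm_le_const fun x hx => ?_
    rw [uIoc_of_le hab] at hx
    have := hC ((x : ℂ) + T * I) (by simpa using hx.1.le) (by simpa using hx.2)
    simpa using this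
  have hdecay : Tendsto (fun T : ℝ => C * (1 + |T|) ^ (-p) * |b - a|) atTop (nhds 0) := by
    have h1 : Tendsto (fun T : ℝ => (1 + |T|)) atTop atTop :=
      tendsto_atTop_add_const_left _ _ tendsto_abs_atTop_atTop
    have h2 := ((tendsto_rpow_neg_atTop (by linarith : 0 < p)).comp h1).const_mul C |>.mul_const |b - a|
    simpa using h2
  have hh1 : Tendsto (fun T : ℝ => ∫ x in a..b, f (x + (T : ℝ) * I)) atTop (nhds 0) :=
    squeeze_zero_norm hhor hdecay
  have hh2 : Tendsto (fun T : ℝ => ∫ x in a..b, f (x + (-T : ℝ) * I)) atTop (nhds 0) :=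
    squeeze_zero_norm (fun T => by simpa using hhor (-T)) hdecay
  have htot := ((hh2.sub hh1).add ((hlim b hab le_rfl).const_smul I)).sub
    ((hlim a le_rfl hab).const_smul I)
  have hzero := tendsto_nhds_unique htot (by simp_rw [hrect]; exact tendsto_const_nhds)
  simp only [sub_zero, zero_add, smul_eq_mul, ← mul_sub] at hzero
  have := (mul_eq_zero.1 hzero).resolve_left I_ne_zero
  exact (sub_eq_zero.1 this).symm

/-! ### Perron's formula -/

lemma term_eq_mul_cpow_neg (a : ℕ → ℂ) (s : ℂ) {n : ℕ} (hn : n ≠ 0) :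
    LSeries.term a s n = a n * (n : ℂ) ^ (-s) := by
  rw [LSeries.term_of_ne_zero hn, Complex.cpow_neg, div_eq_mul_inv]

lemma integral_LSeries_mul_perronKernel {a : ℕ → ℂ} (ha : ∀ n, ‖a n‖ ≤ 1) {N : ℕ} (hN : 1 ≤ N)
    {σ : ℝ} (hσ : 1 < σ) :
    ∫ t : ℝ, LSeries a ((σ : ℂ) + t * I) * perronKernel N ((σ : ℂ) + t * I) =
      2 * Real.pi * ∑ n ∈ Finset.Icc 1 N, a n := by
  have hKi := integrable_perronKernel_line hN (σ := σ) (by linarith)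
  set F : ℕ → ℝ → ℂ := fun n t =>
    LSeries.term a ((σ : ℂ) + t * I) n * perronKernel N ((σ : ℂ) + t * I) with hF
  have hre : ∀ t : ℝ, σ ≤ ((σ : ℂ) + t * I).re := fun t => by simp
  have hFn : ∀ n t, ‖F n t‖ ≤ ((n : ℝ) ^ σ)⁻¹ * ‖perronKernel N ((σ : ℂ) + t * I)‖ := fun n t => by
    rw [hF, norm_mul]
    exact mul_le_mul_of_nonneg_right (norm_term_le ha (hre t) n) (norm_nonneg _)
  have hFc : ∀ n, AEStronglyMeasurable (F n) volume := fun n => by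
    refine Continuous.aestronglyMeasurable (Continuous.mul ?_
      (continuous_perronKernel_line hN (by linarith)))
    rcases eq_or_ne n 0 with rfl | hn
    · simp only [LSeries.term_zero]; exact continuous_const
    · have hn0 : (n : ℂ) ≠ 0 := by exact_mod_cast hn
      simp_rw [term_eq_mul_cpow_neg a _ hn]
      exact continuous_const.mul (Continuous.const_cpow (by fun_prop) (Or.inl hn0))
  have hFi : ∀ n, Integrable (F n) := fun n =>
    Integrable.mono' (hKi.norm.const_mul _) (hFc n) (.of_forall (hFn n))
  have hsum : Summable fun n => ∫ t, ‖F n t‖ := by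
    refine Summable.of_nonneg_of_le (fun n => integral_nonneg fun t => norm_nonneg _) (fun n => ?_)
      ((summable_zetaSum hσ).mul_right (∫ t : ℝ, ‖perronKernel N ((σ : ℂ) + t * I)‖))
    rw [← integral_const_mul]
    exact integral_mono (hFi n).norm (hKi.norm.const_mul _) (hFn n)
  have key := (hasSum_integral_of_summable_integral_norm hFi hsum).tsum_eq
  have e1 : ∀ t : ℝ, ∑' n, F n t =
      LSeries a ((σ : ℂ) + t * I) * perronKernel N ((σ : ℂ) + t * I) := fun t => by
    rw [hF]; simp only; rw [tsum_mul_right, LSeries]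
  simp_rw [e1] at key
  rw [← key, tsum_eq_sum (s := Finset.Icc 1 N), Finset.mul_sum]
  · refine Finset.sum_congr rfl fun n hn => ?_
    obtain ⟨h1, h2⟩ := Finset.mem_Icc.1 hn
    have e2 : ∀ t, F n t = a n *
        (perronKernel N ((σ : ℂ) + t * I) * (n : ℂ) ^ (-((σ : ℂ) + t * I))) := fun t => by
      rw [hF]; simp only; rw [term_eq_mul_cpow_neg a _ (by lia)]; ring
    simp_rw [e2]
    rw [integral_const_mul, integral_perronKernel_mul hN h1 (by linarith), if_pos h2]
    ring
  · intro n hn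
    rcases Nat.eq_zero_or_pos n with rfl | h1
    · simp [hF]
    have h2 : ¬ n ≤ N := fun h => hn (Finset.mem_Icc.2 ⟨h1, h⟩)
    have e2 : ∀ t, F n t = a n *
        (perronKernel N ((σ : ℂ) + t * I) * (n : ℂ) ^ (-((σ : ℂ) + t * I))) := fun t => by
      rw [hF]; simp only; rw [term_eq_mul_cpow_neg a _ (by lia)]; ring
    simp_rw [e2]
    rw [integral_const_mul, integral_perronKernel_mul hN h1 (by linarith), if_neg h2]
    ring

/-- Perron's formula on a line to the left of the region of absolute convergence, for a Dirichlet
series with a continuation `M` of moderate growth. -/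
theorem integral_mul_perronKernel_eq_sum {a : ℕ → ℂ} (ha : ∀ n, ‖a n‖ ≤ 1) {N : ℕ} (hN : 1 ≤ N)
    {M : ℂ → ℂ} {σ B κ : ℝ} (hσ : 1 / 2 < σ) (hσ2 : σ ≤ 2) (hκ : κ ≤ 1 / 2)
    (hM : DifferentiableOn ℂ M {s | 1 / 2 < s.re})
    (hMa : ∀ s : ℂ, 1 < s.re → M s = LSeries a s)
    (hB : ∀ s : ℂ, σ ≤ s.re → ‖M s‖ ≤ B * (1 + |s.im|) ^ κ) :
    ∫ t : ℝ, M ((σ : ℂ) + t * I) * perronKernel N ((σ : ℂ) + t * I) =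
      2 * Real.pi * ∑ n ∈ Finset.Icc 1 N, a n := by
  have hB0 : 0 ≤ B := by
    have := (norm_nonneg _).trans (hB 2 (by simpa using hσ2))
    simpa using this
  rw [← integral_LSeries_mul_perronKernel ha hN (σ := 2) (by norm_num)]
  have h2 : ∀ t : ℝ, LSeries a (((2 : ℝ) : ℂ) + t * I) = M (((2 : ℝ) : ℂ) + t * I) := fun t =>
    (hMa _ (by simp)).symm
  simp_rw [h2]
  refine integral_line_eq_of_strip (f := fun s => M s * perronKernel N s)
    (C := B * (32 * ((N : ℝ) + 1) ^ (3 : ℝ))) (p := 3 / 2) hσ2 (by norm_num) ?_ ?_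
  · refine DifferentiableOn.mul (hM.mono fun s hs => ?_) ((differentiableOn_perronKernel hN).mono
      fun s hs => ?_)
    · exact hσ.trans_le hs.1
    · exact lt_trans (by norm_num) (hσ.trans_le hs.1)
  · intro s hs1 hs2
    have ht : 1 ≤ 1 + |s.im| := by linarith [abs_nonneg s.im]
    have hA : (1 : ℝ) ≤ (N : ℝ) + 1 := by linarith [(Nat.cast_nonneg N : (0 : ℝ) ≤ N)]
    rw [norm_mul]
    calc ‖M s‖ * ‖perronKernel N s‖
        ≤ (B * (1 + |s.im|) ^ (1 / 2 : ℝ)) *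
          (32 * ((N : ℝ) + 1) ^ (3 : ℝ) * (1 + |s.im|) ^ (-(1 + 1) : ℝ)) := by
          gcongr
          · refine (hB s hs1).trans ?_
            gcongr
          · refine (norm_perronKernel_le hN (by linarith) zero_le_one le_rfl).trans ?_
            gcongr
            linarith
      _ = B * (32 * ((N : ℝ) + 1) ^ (3 : ℝ)) *
          ((1 + |s.im|) ^ (1 / 2 : ℝ) * (1 + |s.im|) ^ (-(1 + 1) : ℝ)) := by ring
      _ = _ := by
          rw [← Real.rpow_add (by linarith)]
          norm_num

end

section

open Complex

/-! ### The Steinhaus double series -/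

/-- The average `𝔼_f f^*(m₁) conj(f^*(m₂)) f^*(n₁) conj(f^*(n₂))`: the indicator of
`m₁ n₁ = m₂ n₂` with all four integers coprime to `r`. -/
def diagCoeff (r m₁ m₂ : ℕ) (n : ℕ × ℕ) : ℂ :=
  if m₁ * n.1 = m₂ * n.2 ∧ m₁.Coprime r ∧ m₂.Coprime r ∧ n.1.Coprime r ∧ n.2.Coprime r
    then 1 else 0

lemma diagCoeff_eq_zero {r m₁ m₂ : ℕ} {n : ℕ × ℕ} (h : m₁ * n.1 ≠ m₂ * n.2) :
    diagCoeff r m₁ m₂ n = 0 := if_neg fun h' => h h'.1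

lemma norm_diagCoeff_le (r m₁ m₂ : ℕ) (n : ℕ × ℕ) : ‖diagCoeff r m₁ m₂ n‖ ≤ 1 := by
  rw [diagCoeff]; split_ifs <;> simp

lemma starFun_eq_mul (r : ℕ) (f : ℕ → ℂ) (n : ℕ) :
    starFun r f n = (if n.Coprime r then 1 else 0) * f n := by
  rw [starFun]; split_ifs <;> simp

lemma steinhausAvg_starFun {r m₁ m₂ : ℕ} (h₁ : m₁ ≠ 0) (h₂ : m₂ ≠ 0)
    (c : ArithmeticFunction ℤ) (n : ℕ × ℕ) :
    steinhausAvg (fun f => starFun r f m₁ * star (starFun r f m₂) *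
        ((c n.1 : ℂ) * starFun r f n.1) * ((c n.2 : ℂ) * star (starFun r f n.2))) =
      c n.1 * c n.2 * diagCoeff r m₁ m₂ n := by
  by_cases hn1 : n.1 = 0
  · simp [hn1, steinhausAvg]
  by_cases hn2 : n.2 = 0
  · simp [hn2, steinhausAvg]
  have key := steinhausAvg_mul_star (a := m₁ * n.1) (b := m₂ * n.2) (mul_ne_zero h₁ hn1)
    (mul_ne_zero h₂ hn2)
  set i : ℕ → ℂ := fun n => if n.Coprime r then 1 else 0 with hi
  have hstar : ∀ n, star (i n) = i n := by intro n; simp only [hi]; split_ifs <;> simp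
  have : ∀ θ, (starFun r (steinhausFun θ) m₁ * star (starFun r (steinhausFun θ) m₂) *
        ((c n.1 : ℂ) * starFun r (steinhausFun θ) n.1) *
          ((c n.2 : ℂ) * star (starFun r (steinhausFun θ) n.2))) =
      (c n.1 * c n.2 * (i m₁ * i m₂ * i n.1 * i n.2)) *
        (steinhausFun θ (m₁ * n.1) * star (steinhausFun θ (m₂ * n.2))) := by
    intro θ
    simp only [starFun_eq_mul]
    rw [steinhausFun_mul θ h₁ hn1, steinhausFun_mul θ h₂ hn2]
    simp only [star_mul']
    change _ * (star (i m₂) * _) * _ * (_ * (star (i n.2) * _)) = _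
    rw [hstar, hstar]
    simp only [hi]
    ring
  simp only [steinhausAvg] at key ⊢
  simp only [this]
  rw [MeasureTheory.integral_const_mul, key, mul_assoc]
  congr 1
  simp only [hi, diagCoeff]
  simp only [ite_and]
  split_ifs <;> simp

lemma steinhausTwistedSeries_eq (c : ArithmeticFunction ℤ) {r m₁ m₂ : ℕ} (h₁ : m₁ ≠ 0)
    (h₂ : m₂ ≠ 0) (s₁ s₂ : ℂ) :
    steinhausTwistedSeries c r m₁ m₂ s₁ s₂ =
      ∑' n : ℕ × ℕ, c n.1 * c n.2 * diagCoeff r m₁ m₂ n / ((n.1 : ℂ) ^ s₁ * (n.2 : ℂ) ^ s₂) := by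
  simp only [steinhausTwistedSeries, steinhausAvg_starFun h₁ h₂]

/-- The solutions of `m₁ n₁ = m₂ n₂` are the multiples of
`(m₂ / gcd(m₁, m₂), m₁ / gcd(m₁, m₂))`. -/
lemma hasSum_diag_rpow {m₁ m₂ : ℕ} (h₁ : m₁ ≠ 0) (h₂ : m₂ ≠ 0) {σ : ℝ} (hσ : 1 / 2 < σ) :
    HasSum (fun n : ℕ × ℕ => if m₁ * n.1 = m₂ * n.2 then (((n.1 * n.2 : ℕ) : ℝ) ^ σ)⁻¹ else 0)
      (zetaSum (2 * σ) * ((((m₁ / m₁.gcd m₂) * (m₂ / m₁.gcd m₂) : ℕ) : ℝ) ^ σ)⁻¹) := by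
  set g := m₁.gcd m₂ with hg
  have hgpos : 0 < g := Nat.gcd_pos_of_pos_left _ (Nat.pos_of_ne_zero h₁)
  set a := m₁ / g with ha
  set b := m₂ / g with hb
  have e1 : m₁ = g * a := (Nat.mul_div_cancel' (Nat.gcd_dvd_left _ _)).symm
  have e2 : m₂ = g * b := (Nat.mul_div_cancel' (Nat.gcd_dvd_right _ _)).symm
  have hcop : Nat.Coprime a b := Nat.coprime_div_gcd_div_gcd hgpos
  have ha0 : 0 < a := Nat.pos_of_ne_zero fun h => h₁ (by rw [e1, h, mul_zero])
  have hb0 : 0 < b := Nat.pos_of_ne_zero fun h => h₂ (by rw [e2, h, mul_zero])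
  have hiff : ∀ n : ℕ × ℕ, m₁ * n.1 = m₂ * n.2 ↔ a * n.1 = b * n.2 := by
    intro n
    rw [e1, e2, mul_assoc, mul_assoc]
    exact Nat.mul_right_inj hgpos.ne'
  have hinj : Function.Injective fun t : ℕ => ((t * b, t * a) : ℕ × ℕ) := by
    intro t u h
    exact Nat.eq_of_mul_eq_mul_right hb0 (Prod.ext_iff.1 h).1
  set F : ℕ × ℕ → ℝ := fun n =>
    if m₁ * n.1 = m₂ * n.2 then (((n.1 * n.2 : ℕ) : ℝ) ^ σ)⁻¹ else 0 with hF
  have hcomp : (F ∘ fun t : ℕ => ((t * b, t * a) : ℕ × ℕ)) = fun t : ℕ =>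
      ((t : ℝ) ^ (2 * σ))⁻¹ * (((a * b : ℕ) : ℝ) ^ σ)⁻¹ := by
    funext t
    have h : a * (t * b) = b * (t * a) := by ring
    simp only [Function.comp, hF, hiff, h, if_true]
    rw [show t * b * (t * a) = t ^ 2 * (a * b) by ring, Nat.cast_mul,
      Real.mul_rpow (by positivity) (by positivity), mul_inv, Nat.cast_pow, ← Real.rpow_natCast,
      ← Real.rpow_mul (by positivity)]
    norm_num
  rw [← hinj.hasSum_iff, hcomp]
  · exact (summable_zetaSum (σ := 2 * σ) (by linarith)).hasSum.mul_right _
  · rintro n hn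
    rw [hF]
    refine if_neg ?_
    intro h
    rw [hiff] at h
    apply hn
    obtain ⟨t, ht⟩ : b ∣ n.1 := hcop.symm.dvd_of_dvd_mul_left ⟨n.2, h⟩
    refine ⟨t, ?_⟩
    ext
    · simp [ht, mul_comm]
    · rw [ht] at h
      have : b * (t * a) = b * n.2 := by rw [← h]; ring
      exact Nat.eq_of_mul_eq_mul_left hb0 this


lemma norm_diag_term_le {c : ArithmeticFunction ℤ} (hc : ∀ n, |c n| ≤ 1) (r m₁ m₂ : ℕ)
    {s₁ s₂ : ℂ} {σ : ℝ} (hs₁ : s₁.re = σ) (hs₂ : s₂.re = σ) (n : ℕ × ℕ) :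
    ‖c n.1 * c n.2 * diagCoeff r m₁ m₂ n / ((n.1 : ℂ) ^ s₁ * (n.2 : ℂ) ^ s₂)‖ ≤
      if m₁ * n.1 = m₂ * n.2 then (((n.1 * n.2 : ℕ) : ℝ) ^ σ)⁻¹ else 0 := by
  have hc' : ∀ n, ‖(c n : ℂ)‖ ≤ 1 := by
    intro n; rw [Complex.norm_intCast]; exact_mod_cast hc n
  by_cases h : m₁ * n.1 = m₂ * n.2
  · rw [if_pos h]
    by_cases hn1 : n.1 = 0
    · simp only [hn1, ArithmeticFunction.map_zero, Int.cast_zero, zero_mul, zero_div, norm_zero]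
      positivity
    by_cases hn2 : n.2 = 0
    · simp only [hn2, ArithmeticFunction.map_zero, Int.cast_zero, mul_zero, zero_mul, zero_div,
        norm_zero]
      positivity
    rw [norm_div, norm_mul, norm_mul, norm_mul,
      Complex.norm_natCast_cpow_of_pos (Nat.pos_of_ne_zero hn1),
      Complex.norm_natCast_cpow_of_pos (Nat.pos_of_ne_zero hn2), hs₁, hs₂, Nat.cast_mul,
      Real.mul_rpow (by positivity) (by positivity), div_eq_mul_inv]
    refine mul_le_of_le_one_left (by positivity) ?_
    exact mul_le_one₀ (mul_le_one₀ (hc' _) (norm_nonneg _) (hc' _)) (norm_nonneg _)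
      (norm_diagCoeff_le _ _ _ _)
  · rw [if_neg h, diagCoeff_eq_zero h]
    simp

lemma summable_norm_diag_term {c : ArithmeticFunction ℤ} (hc : ∀ n, |c n| ≤ 1) (r : ℕ) {m₁ m₂ : ℕ}
    (h₁ : m₁ ≠ 0) (h₂ : m₂ ≠ 0) {s₁ s₂ : ℂ} {σ : ℝ} (hσ : 1 / 2 < σ) (hs₁ : s₁.re = σ)
    (hs₂ : s₂.re = σ) :
    Summable fun n : ℕ × ℕ =>
      ‖c n.1 * c n.2 * diagCoeff r m₁ m₂ n / ((n.1 : ℂ) ^ s₁ * (n.2 : ℂ) ^ s₂)‖ :=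
  Summable.of_nonneg_of_le (fun _ => norm_nonneg _) (norm_diag_term_le hc r m₁ m₂ hs₁ hs₂)
    (hasSum_diag_rpow h₁ h₂ hσ).summable

lemma norm_steinhausTwistedSeries_le {c : ArithmeticFunction ℤ} (hc : ∀ n, |c n| ≤ 1) (r : ℕ)
    {m₁ m₂ : ℕ} (h₁ : m₁ ≠ 0) (h₂ : m₂ ≠ 0) {s₁ s₂ : ℂ} {σ : ℝ} (hσ : 1 / 2 < σ)
    (hs₁ : s₁.re = σ) (hs₂ : s₂.re = σ) :
    ‖steinhausTwistedSeries c r m₁ m₂ s₁ s₂‖ ≤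
      zetaSum (2 * σ) * ((((m₁ / m₁.gcd m₂) * (m₂ / m₁.gcd m₂) : ℕ) : ℝ) ^ σ)⁻¹ := by
  rw [steinhausTwistedSeries_eq c h₁ h₂]
  have hs := summable_norm_diag_term hc r h₁ h₂ hσ hs₁ hs₂
  refine (norm_tsum_le_tsum_norm hs).trans ?_
  rw [← (hasSum_diag_rpow h₁ h₂ hσ).tsum_eq]
  exact hs.tsum_le_tsum (norm_diag_term_le hc r m₁ m₂ hs₁ hs₂) (hasSum_diag_rpow h₁ h₂ hσ).summable

/-! ### The Liouville function as a convolution over squares -/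

lemma liouville_sq_mul {d e : ℕ} (hd : d ≠ 0) (he : Squarefree e) :
    ArithmeticFunction.liouville (d ^ 2 * e) = ArithmeticFunction.moebius e := by
  have he0 : e ≠ 0 := he.ne_zero
  rw [ArithmeticFunction.liouville_apply (by positivity),
    ArithmeticFunction.moebius_apply_of_squarefree he,
    ArithmeticFunction.cardFactors_mul (by positivity) he0, ArithmeticFunction.cardFactors_pow,
    pow_add, pow_mul]
  norm_num

/-- The pairs `(d, e)` with `d ≥ 1` and `e` squarefree; `(d, e) ↦ d² e` is a bijection from them
onto the positive integers. -/
abbrev SqPair : Type := {p : ℕ × ℕ // p.1 ≠ 0 ∧ Squarefree p.2}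

/-- The map `(d, e) ↦ d² e`. -/
def SqPair.toNat (p : SqPair) : ℕ := p.1.1 ^ 2 * p.1.2

lemma SqPair.toNat_injective : Function.Injective SqPair.toNat := by
  rintro ⟨⟨d, e⟩, hd, he⟩ ⟨⟨d', e'⟩, hd', he'⟩ h
  simp only [SqPair.toNat] at h hd he hd' he' ⊢
  have key : ∀ {d e : ℕ}, d ≠ 0 → Squarefree e → ∀ p,
      (d ^ 2 * e).factorization p = 2 * d.factorization p + e.factorization p := by
    intro d e hd he p
    rw [Nat.factorization_mul (by positivity) he.ne_zero, Nat.factorization_pow]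
    simp
  have hdd : d = d' := by
    refine Nat.eq_of_factorization_eq hd hd' fun p => ?_
    have h1 := key hd he p
    have h2 := key hd' he' p
    have h3 := he.natFactorization_le_one p
    have h4 := he'.natFactorization_le_one p
    rw [h] at h1
    lia
  subst hdd
  have : e = e' := Nat.eq_of_mul_eq_mul_left (by positivity) h
  subst this
  rfl

lemma SqPair.mem_range_toNat {n : ℕ} (hn : n ≠ 0) : n ∈ Set.range SqPair.toNat := by
  obtain ⟨e, d, h, he⟩ := Nat.sq_mul_squarefree n
  refine ⟨⟨(d, e), ?_, he⟩, h⟩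
  rintro hd
  simp only at hd
  rw [hd] at h
  apply hn
  rw [← h]; ring

lemma SqPair.liouville_toNat (p : SqPair) :
    ArithmeticFunction.liouville p.toNat = ArithmeticFunction.moebius p.1.2 :=
  liouville_sq_mul p.2.1 p.2.2

lemma SqPair.coprime_toNat (p : SqPair) (r : ℕ) :
    p.toNat.Coprime r ↔ p.1.1.Coprime r ∧ p.1.2.Coprime r := by
  rw [SqPair.toNat, Nat.coprime_mul_iff_left, Nat.coprime_pow_left_iff (by norm_num)]

lemma natCast_sq_cpow (d : ℕ) (s : ℂ) : ((d ^ 2 : ℕ) : ℂ) ^ s = (d : ℂ) ^ (2 * s) := by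
  rw [pow_two, Nat.cast_mul, Complex.natCast_mul_natCast_cpow]
  by_cases hd : d = 0
  · subst hd
    by_cases hs : s = 0
    · simp [hs]
    · simp [hs]
  · rw [two_mul, Complex.cpow_add _ _ (by exact_mod_cast hd)]

lemma SqPair.toNat_cpow (p : SqPair) (s : ℂ) :
    (p.toNat : ℂ) ^ s = (p.1.1 : ℂ) ^ (2 * s) * (p.1.2 : ℂ) ^ s := by
  rw [SqPair.toNat, Nat.cast_mul, Complex.natCast_mul_natCast_cpow, natCast_sq_cpow]

/-- `∑ λ(n) χ(n) n^{-s} = L(2s, χ²) ∑ μ(n) χ(n) n^{-s}`. -/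
lemma LSeries_liouville_eq {r : ℕ} [NeZero r] (χ : DirichletCharacter ℂ r) {s : ℂ}
    (hs : 1 < s.re) :
    LSeries (fun n => (ArithmeticFunction.liouville n : ℂ) * χ (n : ZMod r)) s =
      (χ ^ 2).LFunction (2 * s) *
        LSeries (fun n => (ArithmeticFunction.moebius n : ℂ) * χ (n : ZMod r)) s := by
  have h2s : 1 < (2 * s).re := by simp; linarith
  have hs0 : s ≠ 0 := by rintro rfl; norm_num at hs
  rw [DirichletCharacter.LFunction_eq_LSeries _ h2s, LSeries, LSeries, LSeries]
  rw [tsum_mul_tsum_of_summable_norm (summable_norm_term (fun n => (χ ^ 2).norm_le_one _) h2s)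
    (summable_norm_term (norm_char_mul_moebius_le χ) hs)]
  have hinj : Function.Injective (Subtype.val : SqPair → ℕ × ℕ) := Subtype.val_injective
  rw [← SqPair.toNat_injective.tsum_eq, ← hinj.tsum_eq]
  · refine tsum_congr fun p => ?_
    have hd := p.2.1
    have he := p.2.2.ne_zero
    have hp : p.toNat ≠ 0 := by rw [SqPair.toNat]; positivity
    rw [LSeries.term_of_ne_zero hp, LSeries.term_of_ne_zero hd, LSeries.term_of_ne_zero he,
      SqPair.liouville_toNat, SqPair.toNat_cpow, div_mul_div_comm]
    congr 1
    rw [SqPair.toNat]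
    push_cast
    rw [map_mul, map_pow, MulChar.pow_apply' _ (by norm_num)]
    ring
  · intro p hp
    rw [Function.mem_support] at hp
    refine ⟨⟨p, ?_, ?_⟩, rfl⟩
    · intro h; apply hp; simp [h]
    · by_contra h
      apply hp
      simp [LSeries.term_def, ArithmeticFunction.moebius_eq_zero_of_not_squarefree h]
  · intro n hn
    apply SqPair.mem_range_toNat
    rintro rfl
    simp at hn


/-! ### Truncating the convolution over squares -/

/-- `∑_{d₁, d₂} lcm(d₁, d₂)^{-3/2}` converges: with `g = gcd(d₁, d₂)` the least common multiple is
`g (d₁ / g) (d₂ / g)`. -/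
lemma summable_lcm_rpow :
    Summable fun d : ℕ × ℕ => (((d.1.lcm d.2 : ℕ) : ℝ) ^ (3 / 2 : ℝ))⁻¹ := by
  have hz := summable_zetaSum (σ := 3 / 2) (by norm_num)
  have h3 : Summable fun t : ℕ × ℕ × ℕ => ((t.1 : ℝ) ^ (3 / 2 : ℝ))⁻¹ *
      (((t.2.1 : ℝ) ^ (3 / 2 : ℝ))⁻¹ * ((t.2.2 : ℝ) ^ (3 / 2 : ℝ))⁻¹) :=
    hz.mul_of_nonneg (hz.mul_of_nonneg hz (fun _ => by positivity) fun _ => by positivity)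
      (fun _ => by positivity) fun _ => by positivity
  have hinj : Function.Injective fun d : ℕ × ℕ =>
      ((d.1.gcd d.2, d.1 / d.1.gcd d.2, d.2 / d.1.gcd d.2) : ℕ × ℕ × ℕ) := by
    rintro ⟨a, b⟩ ⟨a', b'⟩ h
    simp only [Prod.mk.injEq] at h ⊢
    obtain ⟨h1, h2, h3⟩ := h
    rw [← Nat.mul_div_cancel' (Nat.gcd_dvd_left a b), ← Nat.mul_div_cancel' (Nat.gcd_dvd_left a' b'),
      h2, h1]
    refine ⟨rfl, ?_⟩
    rw [← Nat.mul_div_cancel' (Nat.gcd_dvd_right a b),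
      ← Nat.mul_div_cancel' (Nat.gcd_dvd_right a' b'), h3, h1]
  refine (h3.comp_injective hinj).congr fun d => ?_
  simp only [Function.comp]
  rw [← mul_inv, ← mul_inv, ← Real.mul_rpow (by positivity) (by positivity),
    ← Real.mul_rpow (by positivity) (by positivity)]
  congr 2
  norm_cast
  rcases Nat.eq_zero_or_pos (d.1.gcd d.2) with h | h
  · obtain ⟨h1, h2⟩ := Nat.gcd_eq_zero_iff.1 h
    simp [h1]
  · rw [Nat.lcm, Nat.mul_div_assoc _ (Nat.gcd_dvd_right _ _), ← mul_assoc,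
      Nat.mul_div_cancel' (Nat.gcd_dvd_left _ _)]

lemma gcd_mul_sq_le {m₁ m₂ d₁ d₂ : ℕ} (h₁ : m₁ ≠ 0) (h₂ : m₂ ≠ 0) (hd₁ : d₁ ≠ 0) :
    (m₁ * d₁ ^ 2).gcd (m₂ * d₂ ^ 2) ≤ m₁ * m₂ * (d₁.gcd d₂) ^ 2 := by
  have hg : 0 < d₁.gcd d₂ := Nat.gcd_pos_of_pos_left _ (Nat.pos_of_ne_zero hd₁)
  refine Nat.le_of_dvd (by positivity) ?_
  have h : (m₁ * d₁ ^ 2).gcd (m₂ * d₂ ^ 2) ∣ (m₁ * m₂ * d₁ ^ 2).gcd (m₁ * m₂ * d₂ ^ 2) :=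
    Nat.dvd_gcd ((Nat.gcd_dvd_left _ _).trans ⟨m₂, by ring⟩)
      ((Nat.gcd_dvd_right _ _).trans ⟨m₁, by ring⟩)
  rwa [Nat.gcd_mul_left, Nat.pow_gcd_pow] at h

/-- The size of the Steinhaus series attached to `(m₁ d₁², m₂ d₂²)`, weighted by `(d₁ d₂)^{-2σ}`. -/
lemma gcd_weight_le {m₁ m₂ d₁ d₂ : ℕ} (h₁ : m₁ ≠ 0) (h₂ : m₂ ≠ 0) (hd₁ : d₁ ≠ 0) (hd₂ : d₂ ≠ 0)
    {σ : ℝ} (hσ : 1 / 2 < σ) (hσ1 : σ ≤ 1) :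
    ((d₁ : ℝ) ^ (2 * σ))⁻¹ * ((d₂ : ℝ) ^ (2 * σ))⁻¹ *
      (((((m₁ * d₁ ^ 2) / (m₁ * d₁ ^ 2).gcd (m₂ * d₂ ^ 2)) *
        ((m₂ * d₂ ^ 2) / (m₁ * d₁ ^ 2).gcd (m₂ * d₂ ^ 2)) : ℕ) : ℝ) ^ σ)⁻¹ ≤
    (m₁ * m₂ : ℝ) * (((d₁.lcm d₂ : ℕ) : ℝ) ^ (2 : ℝ))⁻¹ := by
  set G := (m₁ * d₁ ^ 2).gcd (m₂ * d₂ ^ 2) with hG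
  set a := m₁ * d₁ ^ 2 / G with ha
  set b := m₂ * d₂ ^ 2 / G with hb
  set g := d₁.gcd d₂ with hg
  set l := d₁.lcm d₂ with hl
  have hgl : g * l = d₁ * d₂ := Nat.gcd_mul_lcm _ _
  have ea : G * a = m₁ * d₁ ^ 2 := Nat.mul_div_cancel' (Nat.gcd_dvd_left _ _)
  have eb : G * b = m₂ * d₂ ^ 2 := Nat.mul_div_cancel' (Nat.gcd_dvd_right _ _)
  have hGle : G ≤ m₁ * m₂ * g ^ 2 := gcd_mul_sq_le h₁ h₂ hd₁
  have hlpos : 0 < l := Nat.lcm_pos (Nat.pos_of_ne_zero hd₁) (Nat.pos_of_ne_zero hd₂)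
  have hgpos : 0 < g := Nat.gcd_pos_of_pos_left _ (Nat.pos_of_ne_zero hd₁)
  have hab : 0 < a * b := by
    refine Nat.pos_of_ne_zero fun h => ?_
    have : (G * a) * (G * b) = 0 := by
      rw [show (G * a) * (G * b) = G * G * (a * b) by ring, h, mul_zero]
    rw [ea, eb] at this
    have : m₁ * d₁ ^ 2 * (m₂ * d₂ ^ 2) ≠ 0 := by positivity
    contradiction
  -- the integer inequality `lcm⁴ ≤ m₁ m₂ (d₁ d₂)² a b`
  have key : l ^ 4 ≤ m₁ * m₂ * ((d₁ * d₂) ^ 2 * (a * b)) := by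
    have hG2 : G ^ 2 * (a * b) = m₁ * m₂ * (d₁ * d₂) ^ 2 := by
      rw [show G ^ 2 * (a * b) = (G * a) * (G * b) by ring, ea, eb]; ring
    have h2 : m₁ * m₂ * (d₁ * d₂) ^ 2 ≤ (m₁ * m₂ * g ^ 2) ^ 2 * (a * b) := by
      rw [← hG2]; gcongr
    have hm : 0 < m₁ * m₂ := by positivity
    have h3 : (d₁ * d₂) ^ 2 ≤ m₁ * m₂ * (g ^ 4 * (a * b)) := by
      refine Nat.le_of_mul_le_mul_left (h2.trans_eq ?_) hm
      ring
    have hgp : 0 < g ^ 4 := by positivity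
    refine Nat.le_of_mul_le_mul_left ?_ hgp
    calc g ^ 4 * l ^ 4 = (d₁ * d₂) ^ 2 * (d₁ * d₂) ^ 2 := by
          rw [← mul_pow, hgl]; ring
      _ ≤ (d₁ * d₂) ^ 2 * (m₁ * m₂ * (g ^ 4 * (a * b))) := by gcongr
      _ = _ := by ring
  have hkey : (l : ℝ) ^ 4 ≤ (m₁ * m₂ : ℝ) * (((d₁ : ℝ) * d₂) ^ 2 * ((a * b : ℕ) : ℝ)) := by
    exact_mod_cast key
  have hl1 : (1 : ℝ) ≤ l := by exact_mod_cast hlpos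
  have hm1 : (1 : ℝ) ≤ (m₁ * m₂ : ℝ) := by
    have : 1 ≤ m₁ * m₂ := by
      have : 0 < m₁ * m₂ := by positivity
      lia
    exact_mod_cast this
  have hd1 : (0 : ℝ) < d₁ := by exact_mod_cast Nat.pos_of_ne_zero hd₁
  have hd2 : (0 : ℝ) < d₂ := by exact_mod_cast Nat.pos_of_ne_zero hd₂
  have habR : (0 : ℝ) < ((a * b : ℕ) : ℝ) := by exact_mod_cast hab
  have e1 : ((d₁ : ℝ) ^ (2 * σ))⁻¹ * ((d₂ : ℝ) ^ (2 * σ))⁻¹ * (((a * b : ℕ) : ℝ) ^ σ)⁻¹ =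
      ((((d₁ : ℝ) * d₂) ^ 2 * ((a * b : ℕ) : ℝ)) ^ σ)⁻¹ := by
    rw [Real.mul_rpow (by positivity) (by positivity), ← Real.rpow_natCast,
      ← Real.rpow_mul (by positivity), Real.mul_rpow (by positivity) (by positivity), mul_inv,
      mul_inv]
    norm_num
  rw [e1, ← div_eq_mul_inv, le_div_iff₀ (by positivity), inv_mul_le_iff₀ (by positivity)]
  calc (l : ℝ) ^ (2 : ℝ) ≤ (l : ℝ) ^ (4 * σ) :=
        Real.rpow_le_rpow_of_exponent_le hl1 (by linarith)
    _ = ((l : ℝ) ^ 4) ^ σ := by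
        rw [Real.rpow_mul (by positivity)]; norm_num
    _ ≤ ((m₁ * m₂ : ℝ) * (((d₁ : ℝ) * d₂) ^ 2 * ((a * b : ℕ) : ℝ))) ^ σ :=
        Real.rpow_le_rpow (by positivity) hkey (by linarith)
    _ = (m₁ * m₂ : ℝ) ^ σ * (((d₁ : ℝ) * d₂) ^ 2 * ((a * b : ℕ) : ℝ)) ^ σ :=
        Real.mul_rpow (by positivity) (by positivity)
    _ ≤ (m₁ * m₂ : ℝ) ^ (1 : ℝ) * (((d₁ : ℝ) * d₂) ^ 2 * ((a * b : ℕ) : ℝ)) ^ σ := by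
        gcongr
    _ = (((d₁ : ℝ) * d₂) ^ 2 * ((a * b : ℕ) : ℝ)) ^ σ * (m₁ * m₂ : ℝ) := by
        rw [Real.rpow_one, mul_comm]

lemma abs_moebius_le (n : ℕ) : |ArithmeticFunction.moebius n| ≤ 1 :=
  ArithmeticFunction.abs_moebius_le_one

lemma abs_liouville_le (n : ℕ) : |ArithmeticFunction.liouville n| ≤ 1 := by
  by_cases hn : n = 0
  · simp [hn]
  · rw [ArithmeticFunction.liouville_apply hn, abs_pow]; simp

lemma diagCoeff_toNat (r m₁ m₂ : ℕ) (p q : SqPair) :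
    diagCoeff r m₁ m₂ (p.toNat, q.toNat) =
      diagCoeff r (m₁ * p.1.1 ^ 2) (m₂ * q.1.1 ^ 2) (p.1.2, q.1.2) := by
  simp only [diagCoeff, SqPair.coprime_toNat, Nat.coprime_mul_iff_left,
    Nat.coprime_pow_left_iff (show 0 < 2 by norm_num)]
  simp only [SqPair.toNat, mul_assoc]
  congr 1
  rw [eq_iff_iff]
  tauto

/-- Reindexing a double sum over the positive integers by `n₁ = d₁² e₁`, `n₂ = d₂² e₂`. -/
lemma hasSum_sqPair {G : ℕ × ℕ → ℂ} {H : (ℕ × ℕ) × (ℕ × ℕ) → ℂ} {a : ℂ} (hG : HasSum G a)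
    (hG0 : ∀ n : ℕ × ℕ, n.1 = 0 ∨ n.2 = 0 → G n = 0)
    (hH0 : ∀ t : (ℕ × ℕ) × (ℕ × ℕ),
      t.1.1 = 0 ∨ t.1.2 = 0 ∨ ¬ Squarefree t.2.1 ∨ ¬ Squarefree t.2.2 → H t = 0)
    (hGH : ∀ p q : SqPair, H ((p.1.1, q.1.1), (p.1.2, q.1.2)) = G (p.toNat, q.toNat)) :
    HasSum H a := by
  have hιinj : Function.Injective fun p : SqPair × SqPair =>
      (((p.1.1.1, p.2.1.1), (p.1.1.2, p.2.1.2)) : (ℕ × ℕ) × (ℕ × ℕ)) := by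
    rintro ⟨⟨⟨d, e⟩, h⟩, ⟨⟨d', e'⟩, h'⟩⟩ ⟨⟨⟨a, b⟩, k⟩, ⟨⟨a', b'⟩, k'⟩⟩ hh
    simp only [Prod.mk.injEq] at hh
    obtain ⟨⟨rfl, rfl⟩, rfl, rfl⟩ := hh
    rfl
  have hφinj : Function.Injective (Prod.map SqPair.toNat SqPair.toNat) :=
    SqPair.toNat_injective.prodMap SqPair.toNat_injective
  refine (hιinj.hasSum_iff ?_).1 ?_
  · rintro t ht
    apply hH0
    by_contra hcon
    push Not at hcon
    obtain ⟨h1, h2, h3, h4⟩ := hcon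
    exact ht ⟨(⟨(t.1.1, t.2.1), h1, h3⟩, ⟨(t.1.2, t.2.2), h2, h4⟩), rfl⟩
  · have := (hφinj.hasSum_iff (f := G) (a := a) ?_).2 hG
    · refine (congrArg (fun F => HasSum F a) (funext fun p => ?_)).mpr this
      exact hGH p.1 p.2
    · rintro ⟨n₁, n₂⟩ hn
      apply hG0
      by_contra hcon
      push Not at hcon
      obtain ⟨p, hp⟩ := SqPair.mem_range_toNat hcon.1
      obtain ⟨q, hq⟩ := SqPair.mem_range_toNat hcon.2
      exact hn ⟨(p, q), by simp [hp, hq]⟩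

/-- The Steinhaus series for `λ` is a sum over squares of those for `μ`. -/
lemma hasSum_steinhausTwistedSeries_liouville (r : ℕ) {m₁ m₂ : ℕ} (h₁ : m₁ ≠ 0) (h₂ : m₂ ≠ 0)
    {s₁ s₂ : ℂ} {σ : ℝ} (hσ : 1 / 2 < σ) (hs₁ : s₁.re = σ) (hs₂ : s₂.re = σ) :
    HasSum (fun d : ℕ × ℕ => ((d.1 : ℂ) ^ (2 * s₁))⁻¹ * ((d.2 : ℂ) ^ (2 * s₂))⁻¹ *
        steinhausTwistedSeries ArithmeticFunction.moebius r (m₁ * d.1 ^ 2) (m₂ * d.2 ^ 2) s₁ s₂)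
      (steinhausTwistedSeries ArithmeticFunction.liouville r m₁ m₂ s₁ s₂) := by
  have hs₁0 : 2 * s₁ ≠ 0 := by
    intro h; have := congrArg Complex.re h; simp [hs₁] at this; linarith
  have hs₂0 : 2 * s₂ ≠ 0 := by
    intro h; have := congrArg Complex.re h; simp [hs₂] at this; linarith
  have hGsum := (summable_norm_diag_term abs_liouville_le r h₁ h₂ hσ hs₁ hs₂).of_norm.hasSum
  rw [← steinhausTwistedSeries_eq _ h₁ h₂] at hGsum
  have hHsum := hasSum_sqPair (H := fun t =>
    ((t.1.1 : ℂ) ^ (2 * s₁))⁻¹ * ((t.1.2 : ℂ) ^ (2 * s₂))⁻¹ *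
      (ArithmeticFunction.moebius t.2.1 * ArithmeticFunction.moebius t.2.2 *
        diagCoeff r (m₁ * t.1.1 ^ 2) (m₂ * t.1.2 ^ 2) t.2 /
          ((t.2.1 : ℂ) ^ s₁ * (t.2.2 : ℂ) ^ s₂))) hGsum ?_ ?_ ?_
  · refine hHsum.prod_fiberwise fun d => ?_
    by_cases hd1 : d.1 = 0
    · simp only [hd1, Nat.cast_zero, Complex.zero_cpow hs₁0, inv_zero, zero_mul]
      exact hasSum_zero
    by_cases hd2 : d.2 = 0
    · simp only [hd2, Nat.cast_zero, Complex.zero_cpow hs₂0, inv_zero, zero_mul, mul_zero]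
      exact hasSum_zero
    have hM1 : m₁ * d.1 ^ 2 ≠ 0 := by positivity
    have hM2 : m₂ * d.2 ^ 2 ≠ 0 := by positivity
    rw [steinhausTwistedSeries_eq _ hM1 hM2]
    have hsum := (summable_norm_diag_term abs_moebius_le r hM1 hM2 hσ hs₁ hs₂).of_norm.hasSum
    dsimp only
    exact hsum.mul_left _
  · rintro n (h | h) <;> simp [h]
  · rintro t (h | h | h | h)
    · simp [h, hs₁0]
    · simp [h, hs₂0]
    · simp [ArithmeticFunction.moebius_eq_zero_of_not_squarefree h]
    · simp [ArithmeticFunction.moebius_eq_zero_of_not_squarefree h]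
  · intro p q
    simp only [SqPair.liouville_toNat, SqPair.toNat_cpow, diagCoeff_toNat, div_eq_mul_inv, mul_inv]
    ring

/-- `∑_{d₁, d₂} lcm(d₁, d₂)^{-3/2}`. -/
def lcmSum : ℝ := ∑' d : ℕ × ℕ, (((d.1.lcm d.2 : ℕ) : ℝ) ^ (3 / 2 : ℝ))⁻¹

lemma lcmSum_nonneg : 0 ≤ lcmSum := tsum_nonneg fun _ => by positivity

lemma norm_steinhausTwistedSeries_liouville_sub_le (r : ℕ) {m₁ m₂ : ℕ} (h₁ : m₁ ≠ 0) (h₂ : m₂ ≠ 0)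
    {s₁ s₂ : ℂ} {σ : ℝ} (hσ : 1 / 2 < σ) (hσ1 : σ ≤ 1) (hs₁ : s₁.re = σ) (hs₂ : s₂.re = σ)
    {D : ℕ} (hD : 1 ≤ D) :
    ‖steinhausTwistedSeries ArithmeticFunction.liouville r m₁ m₂ s₁ s₂ -
      ∑ d ∈ Finset.Icc 1 D ×ˢ Finset.Icc 1 D,
        ((d.1 : ℂ) ^ (2 * s₁))⁻¹ * ((d.2 : ℂ) ^ (2 * s₂))⁻¹ *
        steinhausTwistedSeries ArithmeticFunction.moebius r (m₁ * d.1 ^ 2) (m₂ * d.2 ^ 2) s₁ s₂‖ ≤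
      zetaSum (2 * σ) * (m₁ * m₂) * lcmSum * (D : ℝ) ^ (-(1 / 2) : ℝ) := by
  have hsum := hasSum_steinhausTwistedSeries_liouville r h₁ h₂ hσ hs₁ hs₂
  set F : ℕ × ℕ → ℂ := fun d => ((d.1 : ℂ) ^ (2 * s₁))⁻¹ * ((d.2 : ℂ) ^ (2 * s₂))⁻¹ *
        steinhausTwistedSeries ArithmeticFunction.moebius r (m₁ * d.1 ^ 2) (m₂ * d.2 ^ 2) s₁ s₂
    with hF
  set S := Finset.Icc 1 D ×ˢ Finset.Icc 1 D with hS
  have hZ : 1 ≤ zetaSum (2 * σ) := one_le_zetaSum (by linarith)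
  have hs₁0 : 2 * s₁ ≠ 0 := by
    intro h; have := congrArg Complex.re h; simp [hs₁] at this; linarith
  have hs₂0 : 2 * s₂ ≠ 0 := by
    intro h; have := congrArg Complex.re h; simp [hs₂] at this; linarith
  have hfin : HasSum (fun d => if d ∈ S then F d else 0) (∑ d ∈ S, F d) := by
    have := hasSum_sum_of_ne_finset_zero (f := fun d => if d ∈ S then F d else 0) (s := S)
      (L := .unconditional _) fun d hd => if_neg hd
    rwa [Finset.sum_congr rfl fun d hd => if_pos hd] at this
  have hdiff := hsum.sub hfin
  rw [← hdiff.tsum_eq]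
  refine (tsum_of_norm_bounded ((summable_lcm_rpow.hasSum).mul_left
    (zetaSum (2 * σ) * (m₁ * m₂) * (D : ℝ) ^ (-(1 / 2) : ℝ))) fun d => ?_).trans_eq ?_
  swap
  · rw [lcmSum]; ring
  by_cases hd : d ∈ S
  · rw [if_pos hd, sub_self, norm_zero]
    positivity
  rw [if_neg hd, sub_zero]
  by_cases hd1 : d.1 = 0
  · simp only [hF, hd1, Nat.cast_zero, Complex.zero_cpow hs₁0, inv_zero, zero_mul, norm_zero]
    positivity
  by_cases hd2 : d.2 = 0
  · simp only [hF, hd2, Nat.cast_zero, Complex.zero_cpow hs₂0, inv_zero, zero_mul, mul_zero,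
      norm_zero]
    positivity
  have hM1 : m₁ * d.1 ^ 2 ≠ 0 := by positivity
  have hM2 : m₂ * d.2 ^ 2 ≠ 0 := by positivity
  have hDl : D ≤ d.1.lcm d.2 := by
    have hl : 0 < d.1.lcm d.2 := Nat.lcm_pos (Nat.pos_of_ne_zero hd1) (Nat.pos_of_ne_zero hd2)
    have l1 := Nat.le_of_dvd hl (Nat.dvd_lcm_left d.1 d.2)
    have l2 := Nat.le_of_dvd hl (Nat.dvd_lcm_right d.1 d.2)
    simp only [hS, Finset.mem_product, Finset.mem_Icc] at hd
    lia
  have hst := norm_steinhausTwistedSeries_le abs_moebius_le r hM1 hM2 hσ hs₁ hs₂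
  have hw := gcd_weight_le h₁ h₂ hd1 hd2 hσ hσ1
  have hre : ∀ s : ℂ, s.re = σ → (2 * s).re = 2 * σ := by intro s hs; simp [hs]
  rw [hF]
  simp only [norm_mul, norm_inv]
  rw [Complex.norm_natCast_cpow_of_pos (Nat.pos_of_ne_zero hd1),
    Complex.norm_natCast_cpow_of_pos (Nat.pos_of_ne_zero hd2), hre s₁ hs₁, hre s₂ hs₂]
  set l := d.1.lcm d.2 with hl
  have hDpos : (0 : ℝ) < D := by exact_mod_cast hD
  have hlR : (D : ℝ) ≤ l := by exact_mod_cast hDl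
  have hlpos : (0 : ℝ) < l := hDpos.trans_le hlR
  have hlcm : ((l : ℝ) ^ (2 : ℝ))⁻¹ ≤ (D : ℝ) ^ (-(1 / 2) : ℝ) * ((l : ℝ) ^ (3 / 2 : ℝ))⁻¹ := by
    have hsplit : (l : ℝ) ^ (2 : ℝ) = (l : ℝ) ^ (1 / 2 : ℝ) * (l : ℝ) ^ (3 / 2 : ℝ) := by
      rw [← Real.rpow_add hlpos]; norm_num
    rw [hsplit, mul_inv, Real.rpow_neg hDpos.le]
    have : (D : ℝ) ^ (1 / 2 : ℝ) ≤ (l : ℝ) ^ (1 / 2 : ℝ) :=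
      Real.rpow_le_rpow hDpos.le hlR (by norm_num)
    exact mul_le_mul_of_nonneg_right (inv_anti₀ (by positivity) this) (by positivity)
  have hZ0 : 0 ≤ zetaSum (2 * σ) := by linarith
  refine (mul_le_mul_of_nonneg_left hst (by positivity)).trans ?_
  rw [mul_left_comm]
  refine (mul_le_mul_of_nonneg_left (hw.trans
    (mul_le_mul_of_nonneg_left hlcm (by positivity))) hZ0).trans_eq ?_
  ring

end

section

open Complex DirichletCharacter

/-! ### Mean squares of tails of `L(2s, χ²)` -/

lemma sum_char_mul_star {r : ℕ} [Fact r.Prime] (a b : ZMod r) :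
    ∑ χ : DirichletCharacter ℂ r, χ a * star (χ b) =
      if a = b ∧ b ≠ 0 then (r : ℂ) - 1 else 0 := by
  by_cases hb : b = 0
  · subst hb
    rw [if_neg (by simp)]
    refine Finset.sum_eq_zero fun χ _ => ?_
    rw [MulChar.map_zero]; simp
  · have h := sum_char_inv_mul_char_eq ℂ (isUnit_iff_ne_zero.2 hb) a
    have e : ∀ χ : DirichletCharacter ℂ r, χ b⁻¹ * χ a = χ a * star (χ b) := by
      intro χ
      rw [MulChar.star_apply', MulChar.inv_apply', mul_comm]
    rw [← Finset.sum_congr rfl fun χ _ => e χ, h, Nat.totient_prime Fact.out,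
      Nat.cast_sub (Fact.out : r.Prime).one_le]
    simp [hb, eq_comm]

lemma card_char {r : ℕ} [Fact r.Prime] : Fintype.card (DirichletCharacter ℂ r) = r - 1 := by
  rw [← Nat.card_eq_fintype_card, card_eq_totient_of_hasEnoughRootsOfUnity,
    Nat.totient_prime Fact.out]

/-- The tail `∑_{d > D} d^{-α}`, termwise. -/
def tailWeight (D : ℕ) (α : ℝ) (d : ℕ) : ℝ := if D < d then ((d : ℝ) ^ α)⁻¹ else 0

lemma tailWeight_nonneg (D : ℕ) (α : ℝ) (d : ℕ) : 0 ≤ tailWeight D α d := by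
  rw [tailWeight]; split_ifs <;> positivity

lemma tailWeight_le (D : ℕ) (α : ℝ) (d : ℕ) : tailWeight D α d ≤ ((d : ℝ) ^ α)⁻¹ := by
  rw [tailWeight]; split_ifs
  · rfl
  · positivity

lemma summable_tailWeight (D : ℕ) {α : ℝ} (hα : 1 < α) : Summable (tailWeight D α) :=
  Summable.of_nonneg_of_le (tailWeight_nonneg D α) (tailWeight_le D α) (summable_zetaSum hα)

lemma tsum_tailWeight_le (D : ℕ) {α : ℝ} (hα : 1 < α) : ∑' d, tailWeight D α d ≤ zetaSum α :=
  (summable_tailWeight D hα).tsum_le_tsum (tailWeight_le D α) (summable_zetaSum hα)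

/-- The tail of `ζ(α)` over one residue class: only the first term of the class can be larger than
the corresponding term of `r^{-α} ζ(α)`. -/
lemma tsum_tailWeight_class_le {r D : ℕ} [NeZero r] (hD : 1 ≤ D) {α : ℝ} (hα : 1 < α) (a : ZMod r) :
    ∑' d : ℕ, (if (d : ZMod r) = a then tailWeight D α d else 0) ≤
      (D : ℝ)⁻¹ + (r : ℝ)⁻¹ * zetaSum α := by
  have hr1 : (1 : ℝ) ≤ r := by exact_mod_cast Nat.one_le_iff_ne_zero.2 (NeZero.ne r)
  have hD1 : (1 : ℝ) ≤ D := by exact_mod_cast hD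
  have hinj : Function.Injective fun j : ℕ => a.val + r * j := by
    intro j k h
    exact Nat.eq_of_mul_eq_mul_left (Nat.pos_of_ne_zero (NeZero.ne r)) (Nat.add_left_cancel h)
  rw [← hinj.tsum_eq]
  · have h1 : HasSum (fun j : ℕ => (if j = 0 then (D : ℝ)⁻¹ else 0) +
        (r : ℝ)⁻¹ * ((j : ℝ) ^ α)⁻¹) ((D : ℝ)⁻¹ + (r : ℝ)⁻¹ * zetaSum α) :=
      (hasSum_ite_eq 0 _).add ((summable_zetaSum hα).hasSum.mul_left _)
    have hZ : 1 ≤ zetaSum α := one_le_zetaSum hα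
    refine tsum_le_of_sum_le' (by positivity) fun s => ?_
    refine (Finset.sum_le_sum fun j _ => ?_).trans
      (sum_le_hasSum s (fun j _ => by positivity) h1)
    rw [if_pos (by simp)]
    by_cases hj : j = 0
    · subst hj
      simp only [mul_zero, add_zero, if_true, tailWeight]
      refine le_add_of_le_of_nonneg ?_ (by positivity)
      split_ifs with h
      · refine inv_anti₀ (by positivity) ?_
        have h' : (D : ℝ) ≤ a.val := by exact_mod_cast h.le
        calc (D : ℝ) ≤ (a.val : ℝ) ^ (1 : ℝ) := by rwa [Real.rpow_one]
          _ ≤ (a.val : ℝ) ^ α := Real.rpow_le_rpow_of_exponent_le (hD1.trans h') hα.le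
      · positivity
    · rw [if_neg hj, zero_add]
      refine (tailWeight_le _ _ _).trans ?_
      have hj1 : (1 : ℝ) ≤ j := by exact_mod_cast Nat.one_le_iff_ne_zero.2 hj
      rw [← mul_inv]
      refine inv_anti₀ (by positivity) ?_
      calc (r : ℝ) * (j : ℝ) ^ α ≤ (r : ℝ) ^ α * (j : ℝ) ^ α := by
            gcongr
            calc (r : ℝ) = (r : ℝ) ^ (1 : ℝ) := (Real.rpow_one _).symm
              _ ≤ _ := Real.rpow_le_rpow_of_exponent_le hr1 hα.le
        _ = ((r : ℝ) * j) ^ α := (Real.mul_rpow (by positivity) (by positivity)).symm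
        _ ≤ _ := by
            refine Real.rpow_le_rpow (by positivity) ?_ (by linarith)
            push_cast
            linarith [(Nat.cast_nonneg a.val : (0 : ℝ) ≤ a.val)]
  · intro d hd
    rw [Function.mem_support] at hd
    have h : (d : ZMod r) = a := by
      by_contra h
      exact hd (if_neg h)
    refine ⟨d / r, ?_⟩
    simp only
    rw [← h, ZMod.val_natCast]
    exact Nat.mod_add_div d r

/-- The terms `d > D` of the Dirichlet series of `L(2s, χ²)`. -/
def sqTail {r : ℕ} (D : ℕ) (χ : DirichletCharacter ℂ r) (s : ℂ) : ℂ :=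
  ∑' d : ℕ, (if D < d then ((d : ℂ) ^ (2 * s))⁻¹ else 0) * χ (d : ZMod r) ^ 2

lemma norm_tail_coeff (D : ℕ) (s : ℂ) (d : ℕ) :
    ‖(if D < d then ((d : ℂ) ^ (2 * s))⁻¹ else 0 : ℂ)‖ = tailWeight D (2 * s.re) d := by
  rw [tailWeight]
  split_ifs with h
  · rw [norm_inv, Complex.norm_natCast_cpow_of_pos (by lia)]; simp
  · simp

lemma norm_sqTail_term_le {r : ℕ} (D : ℕ) (χ : DirichletCharacter ℂ r) (s : ℂ) (d : ℕ) :
    ‖(if D < d then ((d : ℂ) ^ (2 * s))⁻¹ else 0) * χ (d : ZMod r) ^ 2‖ ≤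
      tailWeight D (2 * s.re) d := by
  rw [norm_mul, norm_tail_coeff, norm_pow]
  exact mul_le_of_le_one_right (tailWeight_nonneg _ _ _)
    (pow_le_one₀ (norm_nonneg _) (χ.norm_le_one _))

lemma summable_norm_sqTail {r : ℕ} (D : ℕ) (χ : DirichletCharacter ℂ r) {s : ℂ}
    (hs : 1 / 2 < s.re) :
    Summable fun d : ℕ => ‖(if D < d then ((d : ℂ) ^ (2 * s))⁻¹ else 0) * χ (d : ZMod r) ^ 2‖ :=
  Summable.of_nonneg_of_le (fun _ => norm_nonneg _) (norm_sqTail_term_le D χ s)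
    (summable_tailWeight D (by linarith))

lemma LFunction_sq_eq_add_sqTail {r : ℕ} [NeZero r] (D : ℕ) (χ : DirichletCharacter ℂ r) {s : ℂ}
    (hs : 1 / 2 < s.re) :
    (χ ^ 2).LFunction (2 * s) =
      ∑ d ∈ Finset.Icc 1 D, ((d : ℂ) ^ (2 * s))⁻¹ * χ (d : ZMod r) ^ 2 + sqTail D χ s := by
  have h2s : 1 < (2 * s).re := by simp; linarith
  have hs0 : 2 * s ≠ 0 := by intro h; rw [h] at h2s; norm_num at h2s
  have hterm : ∀ d : ℕ, LSeries.term (fun n => (χ ^ 2) (n : ZMod r)) (2 * s) d =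
      ((d : ℂ) ^ (2 * s))⁻¹ * χ (d : ZMod r) ^ 2 := by
    intro d
    by_cases hd : d = 0
    · subst hd; simp [hs0]
    · rw [LSeries.term_of_ne_zero hd, MulChar.pow_apply' _ (by norm_num), div_eq_inv_mul]
  rw [LFunction_eq_LSeries _ h2s, LSeries]
  simp only [hterm]
  have hfin : HasSum (fun d : ℕ => if d ∈ Finset.Icc 1 D then
      ((d : ℂ) ^ (2 * s))⁻¹ * χ (d : ZMod r) ^ 2 else 0)
      (∑ d ∈ Finset.Icc 1 D, ((d : ℂ) ^ (2 * s))⁻¹ * χ (d : ZMod r) ^ 2) := by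
    have := hasSum_sum_of_ne_finset_zero (L := .unconditional _) (s := Finset.Icc 1 D)
      (f := fun d : ℕ => if d ∈ Finset.Icc 1 D then
      ((d : ℂ) ^ (2 * s))⁻¹ * χ (d : ZMod r) ^ 2 else 0) fun d hd => if_neg hd
    rwa [Finset.sum_congr rfl fun d hd => if_pos hd] at this
  refine (hfin.add (summable_norm_sqTail D χ hs).of_norm.hasSum).tsum_eq.symm ▸ ?_
  refine tsum_congr fun d => ?_
  by_cases hd : d = 0
  · subst hd; simp [hs0]
  by_cases hdD : D < d
  · rw [if_neg (by simp; lia), if_pos hdD, zero_add]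
  · rw [if_pos (by simp; lia), if_neg hdD, zero_mul, add_zero]

lemma norm_sum_char_sq_mul_star_le {r : ℕ} [Fact r.Prime] (a b : ZMod r) :
    ‖∑ χ : DirichletCharacter ℂ r, χ a ^ 2 * star (χ b ^ 2)‖ ≤
      (r : ℝ) * ((if b = a then 1 else 0) + if b = -a then 1 else 0) := by
  have hr : (1 : ℝ) ≤ r := by exact_mod_cast (Fact.out : r.Prime).one_le
  simp only [← map_pow, sum_char_mul_star]
  by_cases h : a ^ 2 = b ^ 2
  · have h2 : (1 : ℝ) ≤ (if b = a then 1 else 0) + if b = -a then 1 else 0 := by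
      rcases sq_eq_sq_iff_eq_or_eq_neg.1 h.symm with h | h
      · rw [if_pos h]
        have : (0 : ℝ) ≤ if b = -a then 1 else 0 := by split_ifs <;> norm_num
        linarith
      · rw [if_pos h]
        have : (0 : ℝ) ≤ if b = a then 1 else 0 := by split_ifs <;> norm_num
        linarith
    refine le_trans ?_ (le_mul_of_one_le_right (by linarith) h2)
    split_ifs
    · rw [show (r : ℂ) - 1 = ((r - 1 : ℝ) : ℂ) by push_cast; ring, Complex.norm_real,
        Real.norm_eq_abs, abs_of_nonneg (by linarith)]
      linarith
    · rw [norm_zero]; linarith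
  · rw [if_neg (fun h' => h h'.1), norm_zero]
    refine mul_nonneg (by linarith) (add_nonneg ?_ ?_) <;> split_ifs <;> norm_num

lemma hasSum_mul_star {f : ℕ → ℂ} (hf : Summable fun d => ‖f d‖) :
    HasSum (fun d : ℕ × ℕ => f d.1 * star (f d.2)) ((‖∑' d, f d‖ ^ 2 : ℝ) : ℂ) := by
  have hf2 : Summable fun d => ‖star (f d)‖ := by simpa only [norm_star] using hf
  have e : (∑' d, f d) * ∑' d, star (f d) = ((‖∑' d, f d‖ ^ 2 : ℝ) : ℂ) := by
    rw [← tsum_star, Complex.ofReal_pow]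
    exact Complex.mul_conj' _
  rw [← e, tsum_mul_tsum_of_summable_norm hf hf2]
  exact (summable_mul_of_summable_norm hf hf2).hasSum

/-- The mean square of the tails: by orthogonality only the pairs `d₁ ≡ ± d₂ (mod r)` contribute. -/
lemma sum_norm_sq_sqTail_le {r D : ℕ} [Fact r.Prime] (hD : 1 ≤ D) {s : ℂ} (hs : 1 / 2 < s.re) :
    ∑ χ : DirichletCharacter ℂ r, ‖sqTail D χ s‖ ^ 2 ≤
      (r : ℝ) * (zetaSum (2 * s.re) * (2 * ((D : ℝ)⁻¹ + (r : ℝ)⁻¹ * zetaSum (2 * s.re)))) := by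
  have hα : 1 < 2 * s.re := by linarith
  set α := 2 * s.re with hαdef
  set g : ℕ → ℂ := fun d => if D < d then ((d : ℂ) ^ (2 * s))⁻¹ else 0 with hg
  set v := tailWeight D α with hv
  have hgv : ∀ d, ‖g d‖ = v d := norm_tail_coeff D s
  have hv0 : ∀ d, 0 ≤ v d := tailWeight_nonneg D α
  have hvs : Summable v := summable_tailWeight D hα
  set W : ℕ × ℕ → ℝ := fun d => v d.1 * ((r : ℝ) * ((if (d.2 : ZMod r) = d.1 then v d.2 else 0) +
    if (d.2 : ZMod r) = -(d.1 : ZMod r) then v d.2 else 0)) with hW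
  have hvi : ∀ (P : ℕ → Prop) [DecidablePred P], Summable fun d => if P d then v d else 0 := by
    intro P _
    refine Summable.of_nonneg_of_le (fun d => ?_) (fun d => ?_) hvs
    · split_ifs
      · exact hv0 d
      · exact le_rfl
    · split_ifs
      · exact le_rfl
      · exact hv0 d
  have hWsum : Summable W := by
    have h := (hvs.mul_of_nonneg hvs hv0 hv0).mul_left ((r : ℝ) * 2)
    refine Summable.of_nonneg_of_le (fun d => ?_) (fun d => ?_) h
    · refine mul_nonneg (hv0 _) (mul_nonneg (by positivity) (add_nonneg ?_ ?_)) <;> split_ifs <;>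
        first | exact hv0 _ | exact le_rfl
    · have h1 : ∀ (P : Prop) [Decidable P], (if P then v d.2 else 0) ≤ v d.2 := by
        intro P _; split_ifs
        · exact le_rfl
        · exact hv0 _
      calc W d ≤ v d.1 * ((r : ℝ) * (v d.2 + v d.2)) := by
            refine mul_le_mul_of_nonneg_left (mul_le_mul_of_nonneg_left
              (add_le_add (h1 _) (h1 _)) (by positivity)) (hv0 _)
        _ = _ := by ring
  have hWtsum : ∑' d, W d ≤
      (r : ℝ) * (zetaSum α * (2 * ((D : ℝ)⁻¹ + (r : ℝ)⁻¹ * zetaSum α))) := by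
    rw [hWsum.tsum_prod]
    have hin : ∀ d₁ : ℕ, ∑' d₂ : ℕ, W (d₁, d₂) ≤
        v d₁ * ((r : ℝ) * (2 * ((D : ℝ)⁻¹ + (r : ℝ)⁻¹ * zetaSum α))) := by
      intro d₁
      simp only [hW]
      rw [tsum_mul_left, tsum_mul_left, (hvi _).tsum_add (hvi _), two_mul]
      have hDr := hv0 d₁
      gcongr
      · exact tsum_tailWeight_class_le hD hα _
      · exact tsum_tailWeight_class_le hD hα _
    have hZ : 1 ≤ zetaSum α := one_le_zetaSum hα
    refine (hWsum.prod.tsum_le_tsum hin (hvs.mul_right _)).trans ?_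
    rw [tsum_mul_right]
    have := tsum_tailWeight_le D hα
    calc _ ≤ zetaSum α * ((r : ℝ) * (2 * ((D : ℝ)⁻¹ + (r : ℝ)⁻¹ * zetaSum α))) := by gcongr
      _ = _ := by ring
  have hsq : ∀ χ : DirichletCharacter ℂ r, HasSum (fun d : ℕ × ℕ =>
      g d.1 * χ (d.1 : ZMod r) ^ 2 * star (g d.2 * χ (d.2 : ZMod r) ^ 2))
      ((‖sqTail D χ s‖ ^ 2 : ℝ) : ℂ) := by
    intro χ
    have h := summable_norm_sqTail D χ hs
    rw [sqTail]
    exact hasSum_mul_star (f := fun d : ℕ => g d * χ (d : ZMod r) ^ 2) h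
  have htot : HasSum (fun d : ℕ × ℕ => ∑ χ : DirichletCharacter ℂ r,
      g d.1 * χ (d.1 : ZMod r) ^ 2 * star (g d.2 * χ (d.2 : ZMod r) ^ 2))
      (∑ χ : DirichletCharacter ℂ r, ((‖sqTail D χ s‖ ^ 2 : ℝ) : ℂ)) :=
    hasSum_sum fun χ _ => hsq χ
  have hbound : ∀ d : ℕ × ℕ, ‖∑ χ : DirichletCharacter ℂ r,
      g d.1 * χ (d.1 : ZMod r) ^ 2 * star (g d.2 * χ (d.2 : ZMod r) ^ 2)‖ ≤ W d := by
    intro d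
    have e : ∑ χ : DirichletCharacter ℂ r,
      g d.1 * χ (d.1 : ZMod r) ^ 2 * star (g d.2 * χ (d.2 : ZMod r) ^ 2) =
        g d.1 * star (g d.2) * ∑ χ : DirichletCharacter ℂ r,
          χ (d.1 : ZMod r) ^ 2 * star (χ (d.2 : ZMod r) ^ 2) := by
      rw [Finset.mul_sum]
      refine Finset.sum_congr rfl fun χ _ => ?_
      rw [star_mul']
      ring
    rw [e, norm_mul, norm_mul, norm_star, hgv, hgv]
    refine (mul_le_mul_of_nonneg_left (norm_sum_char_sq_mul_star_le _ _)
      (mul_nonneg (hv0 _) (hv0 _))).trans_eq ?_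
    simp only [hW]
    split_ifs <;> ring
  have := (tsum_of_norm_bounded hWsum.hasSum hbound).trans hWtsum
  rw [htot.tsum_eq, ← Complex.ofReal_sum, Complex.norm_real] at this
  exact (le_abs_self _).trans this

lemma sum_norm_sqTail_le {r D : ℕ} [Fact r.Prime] (hD : 1 ≤ D) {s : ℂ} (hs : 1 / 2 < s.re) :
    ∑ χ : DirichletCharacter ℂ r, ‖sqTail D χ s‖ ≤
      (r : ℝ) * (2 * zetaSum (2 * s.re) * √((D : ℝ)⁻¹ + (r : ℝ)⁻¹)) := by
  have hZ : 1 ≤ zetaSum (2 * s.re) := one_le_zetaSum (by linarith)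
  set Z := zetaSum (2 * s.re) with hZdef
  have hr : (1 : ℝ) ≤ r := by exact_mod_cast (Fact.out : r.Prime).one_le
  have hcs := sq_sum_le_card_mul_sum_sq (s := Finset.univ)
    (f := fun χ : DirichletCharacter ℂ r => ‖sqTail D χ s‖)
  rw [Finset.card_univ, card_char] at hcs
  have hcard : ((r - 1 : ℕ) : ℝ) ≤ r := by exact_mod_cast Nat.sub_le r 1
  have h2 := sum_norm_sq_sqTail_le (r := r) hD hs
  refine le_of_sq_le_sq ?_ (by positivity)
  refine hcs.trans ?_
  rw [mul_pow, mul_pow, Real.sq_sqrt (by positivity), pow_two (r : ℝ), mul_assoc]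
  refine mul_le_mul hcard (h2.trans ?_) (by positivity) (by positivity)
  refine mul_le_mul_of_nonneg_left ?_ (by positivity)
  have h3 : (D : ℝ)⁻¹ + (r : ℝ)⁻¹ * Z ≤ ((D : ℝ)⁻¹ + (r : ℝ)⁻¹) * Z := by
    have : (0 : ℝ) ≤ (D : ℝ)⁻¹ := by positivity
    nlinarith
  calc Z * (2 * ((D : ℝ)⁻¹ + (r : ℝ)⁻¹ * Z)) ≤ Z * (2 * (((D : ℝ)⁻¹ + (r : ℝ)⁻¹) * Z)) := by gcongr
    _ = 2 * Z ^ 2 * ((D : ℝ)⁻¹ + (r : ℝ)⁻¹) := by ring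
    _ ≤ (2 * Z) ^ 2 * ((D : ℝ)⁻¹ + (r : ℝ)⁻¹) := by
        refine mul_le_mul_of_nonneg_right ?_ (by positivity)
        nlinarith

end

section

open Complex DirichletCharacter

/-! ### From the Möbius to the Liouville twisted estimate -/

lemma norm_charAvgNonprincipal_le {r : ℕ} [NeZero r] (hr : 2 < r)
    (F : DirichletCharacter ℂ r → ℂ) {b : DirichletCharacter ℂ r → ℝ}
    (hb : ∀ χ, χ ≠ 1 → ‖F χ‖ ≤ b χ) (hb0 : ∀ χ, 0 ≤ b χ) :
    ‖charAvgNonprincipal r F‖ ≤ (∑ χ : DirichletCharacter ℂ r, b χ) / ((r : ℝ) - 2) := by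
  classical
  have hr2 : (0 : ℝ) < (r : ℝ) - 2 := by
    have : (2 : ℝ) < r := by exact_mod_cast hr
    linarith
  rw [charAvgNonprincipal, norm_div, show (r : ℂ) - 2 = ((r - 2 : ℝ) : ℂ) by push_cast; ring,
    Complex.norm_real, Real.norm_eq_abs, abs_of_pos hr2]
  gcongr
  refine (norm_sum_le _ _).trans ?_
  refine (Finset.sum_le_sum fun χ hχ => hb χ (Finset.mem_filter.1 hχ).2).trans ?_
  convert Finset.sum_le_sum_of_subset_of_nonneg (Finset.filter_subset _ _) fun χ _ _ => hb0 χ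

lemma charAvgNonprincipal_add (r : ℕ) [NeZero r] (F G : DirichletCharacter ℂ r → ℂ) :
    charAvgNonprincipal r (fun χ => F χ + G χ) =
      charAvgNonprincipal r F + charAvgNonprincipal r G := by
  simp only [charAvgNonprincipal, Finset.sum_add_distrib, add_div]

lemma charAvgNonprincipal_sum (r : ℕ) [NeZero r] {ι : Type*} (S : Finset ι)
    (w : ι → ℂ) (F : ι → DirichletCharacter ℂ r → ℂ) :
    charAvgNonprincipal r (fun χ => ∑ i ∈ S, w i * F i χ) =
      ∑ i ∈ S, w i * charAvgNonprincipal r (F i) := by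
  simp only [charAvgNonprincipal]
  rw [Finset.sum_comm, Finset.sum_div]
  refine Finset.sum_congr rfl fun i _ => ?_
  rw [← Finset.mul_sum, mul_div_assoc]

lemma sum_star_char {r : ℕ} [NeZero r] (F : DirichletCharacter ℂ r → ℝ) :
    ∑ χ : DirichletCharacter ℂ r, F (star χ) = ∑ χ, F χ :=
  Equiv.sum_comp (Function.Involutive.toPerm star star_involutive) F

lemma sum_Icc_rpow_le_zetaSum {α : ℝ} (hα : 1 < α) (D : ℕ) :
    ∑ d ∈ Finset.Icc 1 D, ((d : ℝ) ^ α)⁻¹ ≤ zetaSum α :=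
  (summable_zetaSum hα).sum_le_tsum _ fun _ _ => by positivity

lemma norm_inv_natCast_cpow {d : ℕ} (hd : d ≠ 0) (s : ℂ) :
    ‖((d : ℂ) ^ (2 * s))⁻¹‖ = ((d : ℝ) ^ (2 * s.re))⁻¹ := by
  rw [norm_inv, Complex.norm_natCast_cpow_of_pos (Nat.pos_of_ne_zero hd)]
  simp

lemma norm_trunc_le {r : ℕ} (χ : DirichletCharacter ℂ r) (D : ℕ) {s : ℂ} (hs : 1 / 2 < s.re) :
    ‖∑ d ∈ Finset.Icc 1 D, ((d : ℂ) ^ (2 * s))⁻¹ * χ (d : ZMod r) ^ 2‖ ≤ zetaSum (2 * s.re) := by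
  refine (norm_sum_le _ _).trans ((Finset.sum_le_sum fun d hd => ?_).trans
    (sum_Icc_rpow_le_zetaSum (by linarith) D))
  have hd0 : d ≠ 0 := by have := (Finset.mem_Icc.1 hd).1; lia
  rw [norm_mul, norm_inv_natCast_cpow hd0, norm_pow]
  exact mul_le_of_le_one_right (by positivity) (pow_le_one₀ (norm_nonneg _) (χ.norm_le_one _))

/-- Replacing `L(2s, χ²)` by its Dirichlet polynomial of length `D` turns the average for `1 / L^♭`
into a combination of the averages for `1 / L` with twists `m₁ d₁²`, `m₂ d₂²`. -/
lemma norm_liouville_twisted_sub_le {r : ℕ} [Fact r.Prime] (hr : 2 < r) {s₁ s₂ : ℂ} {σ : ℝ}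
    (hσ : 1 / 2 < σ) (hσ1 : σ ≤ 1) (hs₁ : s₁.re = σ) (hs₂ : s₂.re = σ) {m₁ m₂ : ℕ} (h₁ : m₁ ≠ 0)
    (h₂ : m₂ ≠ 0) {D : ℕ} (hD : 1 ≤ D) {B₁ B₂ E : ℝ}
    (hB₁ : ∀ χ : DirichletCharacter ℂ r, χ ≠ 1 → ‖(χ.LFunction s₁)⁻¹‖ ≤ B₁)
    (hB₂ : ∀ χ : DirichletCharacter ℂ r, χ ≠ 1 → ‖(χ.LFunction s₂)⁻¹‖ ≤ B₂)
    (hB₁0 : 0 ≤ B₁) (hB₂0 : 0 ≤ B₂)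
    (hE : ∀ d₁ ∈ Finset.Icc 1 D, ∀ d₂ ∈ Finset.Icc 1 D,
      ‖charAvgNonprincipal r (fun χ => χ ((m₁ * d₁ ^ 2 : ℕ) : ZMod r) *
          (star χ) ((m₂ * d₂ ^ 2 : ℕ) : ZMod r) / (χ.LFunction s₁ * (star χ).LFunction s₂)) -
        steinhausTwistedSeries ArithmeticFunction.moebius r (m₁ * d₁ ^ 2) (m₂ * d₂ ^ 2) s₁ s₂‖
        ≤ E) :
    ‖charAvgNonprincipal r (fun χ => χ (m₁ : ZMod r) * (star χ) (m₂ : ZMod r) /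
        (LFlat χ s₁ * LFlat (star χ) s₂)) -
      steinhausTwistedSeries ArithmeticFunction.liouville r m₁ m₂ s₁ s₂‖ ≤
      zetaSum (2 * σ) ^ 2 * E +
      12 * zetaSum (2 * σ) ^ 2 * (B₁ * B₂) * √((D : ℝ)⁻¹ + (r : ℝ)⁻¹) +
      zetaSum (2 * σ) * (m₁ * m₂) * lcmSum * (D : ℝ) ^ (-(1 / 2) : ℝ) := by
  set Z := zetaSum (2 * σ) with hZdef
  have hZ : 1 ≤ Z := one_le_zetaSum (by linarith)
  have hE0 : 0 ≤ E := (norm_nonneg _).trans (hE 1 (by simp [hD]) 1 (by simp [hD]))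
  have hr3 : (3 : ℝ) ≤ r := by exact_mod_cast hr
  set a : DirichletCharacter ℂ r → ℂ := fun χ => χ (m₁ : ZMod r) * (star χ) (m₂ : ZMod r) /
    (χ.LFunction s₁ * (star χ).LFunction s₂) with ha
  set A : DirichletCharacter ℂ r → ℂ → ℂ := fun χ s =>
    ∑ d ∈ Finset.Icc 1 D, ((d : ℂ) ^ (2 * s))⁻¹ * χ (d : ZMod r) ^ 2 with hA
  set S := Finset.Icc 1 D ×ˢ Finset.Icc 1 D with hS
  set w : ℕ × ℕ → ℂ := fun d => ((d.1 : ℂ) ^ (2 * s₁))⁻¹ * ((d.2 : ℂ) ^ (2 * s₂))⁻¹ with hw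
  set F : ℕ × ℕ → DirichletCharacter ℂ r → ℂ := fun d χ =>
    χ ((m₁ * d.1 ^ 2 : ℕ) : ZMod r) * (star χ) ((m₂ * d.2 ^ 2 : ℕ) : ZMod r) /
      (χ.LFunction s₁ * (star χ).LFunction s₂) with hF
  set rest : DirichletCharacter ℂ r → ℂ := fun χ =>
    a χ * (sqTail D χ s₁ * (((star χ) ^ 2).LFunction (2 * s₂)) + A χ s₁ * sqTail D (star χ) s₂)
    with hrest
  have hsplit : ∀ χ : DirichletCharacter ℂ r, χ (m₁ : ZMod r) * (star χ) (m₂ : ZMod r) /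
      (LFlat χ s₁ * LFlat (star χ) s₂) = ∑ d ∈ S, w d * F d χ + rest χ := by
    intro χ
    have e1 : χ (m₁ : ZMod r) * (star χ) (m₂ : ZMod r) / (LFlat χ s₁ * LFlat (star χ) s₂) =
        a χ * ((χ ^ 2).LFunction (2 * s₁) * ((star χ) ^ 2).LFunction (2 * s₂)) := by
      rw [ha, LFlat, LFlat, div_mul_div_comm, div_div_eq_mul_div]
      ring
    have e2 : ∑ d ∈ S, w d * F d χ = a χ * (A χ s₁ * A (star χ) s₂) := by
      simp only [hA]
      rw [Finset.sum_mul_sum, ← Finset.sum_product', Finset.mul_sum]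
      refine Finset.sum_congr rfl fun d _ => ?_
      simp only [hw, hF, ha, Nat.cast_mul, Nat.cast_pow, map_mul, map_pow]
      ring
    rw [e1, e2, LFunction_sq_eq_add_sqTail D χ (by rw [hs₁]; exact hσ), hrest]
    simp only
    rw [LFunction_sq_eq_add_sqTail D (star χ) (by rw [hs₂]; exact hσ)]
    simp only [hA]
    ring
  have havg : charAvgNonprincipal r (fun χ => χ (m₁ : ZMod r) * (star χ) (m₂ : ZMod r) /
        (LFlat χ s₁ * LFlat (star χ) s₂)) =
      ∑ d ∈ S, w d * charAvgNonprincipal r (F d) + charAvgNonprincipal r rest := by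
    simp only [hsplit]
    rw [charAvgNonprincipal_add, charAvgNonprincipal_sum]
  have hmain : ‖∑ d ∈ S, w d * charAvgNonprincipal r (F d) -
      ∑ d ∈ S, w d * steinhausTwistedSeries ArithmeticFunction.moebius r (m₁ * d.1 ^ 2)
        (m₂ * d.2 ^ 2) s₁ s₂‖ ≤ Z ^ 2 * E := by
    rw [← Finset.sum_sub_distrib]
    refine (norm_sum_le _ _).trans ?_
    calc _ ≤ ∑ d ∈ S, (((d.1 : ℝ) ^ (2 * σ))⁻¹ * ((d.2 : ℝ) ^ (2 * σ))⁻¹) * E := by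
          refine Finset.sum_le_sum fun d hd => ?_
          have hd' := Finset.mem_product.1 hd
          have hd1 : d.1 ≠ 0 := by have := (Finset.mem_Icc.1 hd'.1).1; lia
          have hd2 : d.2 ≠ 0 := by have := (Finset.mem_Icc.1 hd'.2).1; lia
          rw [← mul_sub, norm_mul, hw, norm_mul, norm_inv_natCast_cpow hd1,
            norm_inv_natCast_cpow hd2, hs₁, hs₂]
          exact mul_le_mul_of_nonneg_left (hE _ hd'.1 _ hd'.2) (by positivity)
      _ = (∑ d ∈ Finset.Icc 1 D, ((d : ℝ) ^ (2 * σ))⁻¹) ^ 2 * E := by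
          rw [← Finset.sum_mul, pow_two, Finset.sum_mul_sum, ← Finset.sum_product']
      _ ≤ Z ^ 2 * E := by
          have := sum_Icc_rpow_le_zetaSum (α := 2 * σ) (by linarith) D
          gcongr
  have hstar1 : ∀ χ : DirichletCharacter ℂ r, χ ≠ 1 → star χ ≠ 1 := by
    intro χ hχ h
    apply hχ
    rw [MulChar.star_eq_inv] at h
    exact inv_eq_one.1 h
  have hresb : ‖charAvgNonprincipal r rest‖ ≤
      12 * Z ^ 2 * (B₁ * B₂) * √((D : ℝ)⁻¹ + (r : ℝ)⁻¹) := by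
    refine (norm_charAvgNonprincipal_le hr rest (b := fun χ => B₁ * B₂ * Z *
      (‖sqTail D χ s₁‖ + ‖sqTail D (star χ) s₂‖)) (fun χ hχ => ?_)
      (fun χ => by positivity)).trans ?_
    · have hab : ‖a χ‖ ≤ B₁ * B₂ := by
        simp only [ha]
        rw [div_eq_mul_inv, norm_mul, mul_inv, norm_mul, norm_mul]
        have h1 := hB₁ χ hχ
        have h2 := hB₂ (star χ) (hstar1 χ hχ)
        calc _ ≤ 1 * 1 * (B₁ * B₂) := by
              gcongr
              · exact χ.norm_le_one _
              · exact (star χ).norm_le_one _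
          _ = _ := by ring
      have hL : ‖((star χ) ^ 2).LFunction (2 * s₂)‖ ≤ Z :=
        norm_LFunction_le _ (by linarith) (by simp [hs₂])
      have hAb : ‖A χ s₁‖ ≤ Z := by
        have := norm_trunc_le χ D (s := s₁) (by rw [hs₁]; exact hσ)
        rwa [hs₁] at this
      rw [hrest, norm_mul, mul_assoc (B₁ * B₂)]
      refine mul_le_mul hab ?_ (norm_nonneg _) (by positivity)
      refine (norm_add_le _ _).trans ?_
      rw [norm_mul, norm_mul, mul_add]
      refine add_le_add ?_ ?_
      · rw [mul_comm]; gcongr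
      · gcongr
    · have hr2 : (0 : ℝ) < (r : ℝ) - 2 := by linarith
      rw [← Finset.mul_sum, Finset.sum_add_distrib, sum_star_char (fun χ => ‖sqTail D χ s₂‖),
        div_le_iff₀ hr2]
      have t1 := sum_norm_sqTail_le (r := r) hD (s := s₁) (by rw [hs₁]; exact hσ)
      have t2 := sum_norm_sqTail_le (r := r) hD (s := s₂) (by rw [hs₂]; exact hσ)
      rw [hs₁] at t1
      rw [hs₂] at t2
      set q := √((D : ℝ)⁻¹ + (r : ℝ)⁻¹) with hq
      have hq0 : 0 ≤ q := Real.sqrt_nonneg _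
      have hBB : 0 ≤ B₁ * B₂ * Z := by positivity
      calc _ ≤ B₁ * B₂ * Z * (r * (2 * Z * q) + r * (2 * Z * q)) := by gcongr
        _ = (4 * Z ^ 2 * (B₁ * B₂) * q) * r := by ring
        _ ≤ (4 * Z ^ 2 * (B₁ * B₂) * q) * (3 * (r - 2)) := by
            refine mul_le_mul_of_nonneg_left (by linarith) (by positivity)
        _ = _ := by ring
  have htail := norm_steinhausTwistedSeries_liouville_sub_le r h₁ h₂ hσ hσ1 hs₁ hs₂ hD
  rw [havg]
  set X := ∑ d ∈ S, w d * charAvgNonprincipal r (F d)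
  set Y := ∑ d ∈ S, w d * steinhausTwistedSeries ArithmeticFunction.moebius r (m₁ * d.1 ^ 2)
        (m₂ * d.2 ^ 2) s₁ s₂
  set V := steinhausTwistedSeries ArithmeticFunction.liouville r m₁ m₂ s₁ s₂
  calc ‖X + charAvgNonprincipal r rest - V‖ = ‖(X - Y) + charAvgNonprincipal r rest - (V - Y)‖ := by
        congr 1; ring
    _ ≤ ‖X - Y‖ + ‖charAvgNonprincipal r rest‖ + ‖V - Y‖ :=
        (norm_sub_le _ _).trans (add_le_add_left (norm_add_le _ _) _)
    _ ≤ _ := by gcongr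


lemma half_le_floor {y : ℝ} (hy : 1 ≤ y) : y / 2 ≤ ⌊y⌋₊ := by
  have h1 : (1 : ℝ) ≤ ⌊y⌋₊ := by exact_mod_cast Nat.le_floor (by simpa using hy)
  have h2 := Nat.lt_floor_add_one y
  linarith

/-- The Liouville twisted estimate, with some power saving, follows from the twisted Ratios
Conjecture and GRH. With `TwistedRatiosConjecture` valid for `ε, ħ < δ ≤ 1`, squares are truncated at
`D = r^{δ/4}`, which leaves room for the twists `m₁ d₁², m₂ d₂² ≤ r^{3δ/4}`. -/
theorem exists_liouvilleTwistedEstimate {R : Set ℕ} {ω : ℝ} (hω : 0 < ω)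
    (hGRH : ∀ (r : ℕ) [Fact r.Prime], r ∈ R → GRH r) (hTRC : TwistedRatiosConjecture R ω) :
    ∃ η : ℝ, 0 < η ∧ η ≤ ω ∧ LiouvilleTwistedEstimate R η := by
  obtain ⟨δ₀, hδ₀, htrc⟩ := hTRC
  set δ := min δ₀ 1 with hδdef
  have hδ : 0 < δ := lt_min hδ₀ one_pos
  have hδ1 : δ ≤ 1 := min_le_right _ _
  have hδδ₀ : δ ≤ δ₀ := min_le_left _ _
  set θ := δ / 4 with hθ
  have hθ0 : 0 < θ := by positivity
  refine ⟨min ω (θ / 4), lt_min hω (by positivity), min_le_left _ _, θ / 16, by positivity, ?_⟩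
  set η := min ω (θ / 4) with hη
  have hηω : η ≤ ω := min_le_left _ _
  have hηθ : η ≤ θ / 4 := min_le_right _ _
  intro ε hε hεδ
  obtain ⟨C₁, hC₁⟩ := htrc ε hε (by linarith)
  -- exponent for the two factors `1 / L`: their product costs `r^{θ/8} (1 + T)^ε`,
  -- while the mean square of the tails saves `r^{-θ/2}`
  set κ := min (ε / 2) (θ / 16) with hκ
  have hκ0 : 0 < κ := lt_min (by positivity) (by positivity)
  have hκε : κ ≤ ε / 2 := min_le_left _ _
  have hκθ : κ ≤ θ / 16 := min_le_right _ _
  obtain ⟨C₂, hC₂0, hC₂⟩ := exists_norm_LInv_le hε (by linarith) hκ0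
  set Z := zetaSum (2 * (1 / 2 + ε)) with hZdef
  have hZ : 1 ≤ Z := one_le_zetaSum (by linarith)
  refine ⟨Z ^ 2 * |C₁| + 12 * Z ^ 2 * C₂ ^ 2 * 2 + Z * lcmSum * 2, ?_⟩
  intro ħ hħ hħδ r _ hrR hr2 s₁ s₂ hs₁ hs₂ m₁ m₂ hm₁ hm₂ hm₁r hm₂r
  have hr1 : (1 : ℝ) ≤ r := by exact_mod_cast (by lia : 1 ≤ r)
  have hr0 : (0 : ℝ) < r := by linarith
  set T := max |s₁.im| |s₂.im| with hT
  have hT0 : 0 ≤ T := le_max_of_le_left (abs_nonneg _)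
  set D := ⌊(r : ℝ) ^ θ⌋₊ with hDdef
  have hrθ : 1 ≤ (r : ℝ) ^ θ := Real.one_le_rpow hr1 hθ0.le
  have hD : 1 ≤ D := Nat.le_floor (by simpa using hrθ)
  have hDle : (D : ℝ) ≤ (r : ℝ) ^ θ := Nat.floor_le (by positivity)
  have hDge : (r : ℝ) ^ θ / 2 ≤ D := half_le_floor hrθ
  have hTε : 1 ≤ (1 + T) ^ ε := Real.one_le_rpow (by linarith) hε.le
  have hG := hGRH r hrR
  have hLb : ∀ s : ℂ, s.re = 1 / 2 + ε → |s.im| ≤ T → ∀ χ : DirichletCharacter ℂ r, χ ≠ 1 →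
      ‖(χ.LFunction s)⁻¹‖ ≤ C₂ * ((r : ℝ) * (1 + T)) ^ κ := by
    intro s hs hsT χ hχ
    rw [← LInv_of_ne_one hχ]
    refine (hC₂ r hG χ s hs.ge).trans ?_
    gcongr
  have htwist : ∀ m : ℕ, (m : ℝ) ≤ (r : ℝ) ^ ħ → ∀ d ∈ Finset.Icc 1 D,
      ((m * d ^ 2 : ℕ) : ℝ) ≤ (r : ℝ) ^ (3 * δ / 4) := by
    intro m hm d hd
    have hd' : (d : ℝ) ≤ (r : ℝ) ^ θ := le_trans (by exact_mod_cast (Finset.mem_Icc.1 hd).2) hDle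
    calc ((m * d ^ 2 : ℕ) : ℝ) = (m : ℝ) * (d : ℝ) ^ 2 := by push_cast; ring
      _ ≤ (r : ℝ) ^ ħ * ((r : ℝ) ^ θ) ^ 2 := by gcongr
      _ = (r : ℝ) ^ (ħ + 2 * θ) := by
          rw [← Real.rpow_natCast, ← Real.rpow_mul hr0.le, ← Real.rpow_add hr0]
          congr 1
          push_cast
          ring
      _ ≤ _ := Real.rpow_le_rpow_of_exponent_le hr1 (by linarith)
  have key := norm_liouville_twisted_sub_le hr2 (by linarith : (1 : ℝ) / 2 < 1 / 2 + ε)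
    (by linarith) hs₁ hs₂ (by lia : m₁ ≠ 0) (by lia : m₂ ≠ 0) hD
    (hLb s₁ hs₁ (le_max_left _ _)) (hLb s₂ hs₂ (le_max_right _ _)) (by positivity) (by positivity)
    (E := |C₁| * (1 + T) ^ ε * (r : ℝ) ^ (-ω)) (fun d₁ hd₁ d₂ hd₂ => by
      refine (hC₁ (3 * δ / 4) (by linarith) (by linarith) r hrR hr2 s₁ s₂ hs₁ hs₂ (m₁ * d₁ ^ 2)
        (m₂ * d₂ ^ 2) ?_ ?_ (htwist m₁ hm₁r d₁ hd₁) (htwist m₂ hm₂r d₂ hd₂)).trans ?_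
      · have := (Finset.mem_Icc.1 hd₁).1
        exact Nat.one_le_iff_ne_zero.2 (by positivity)
      · have := (Finset.mem_Icc.1 hd₂).1
        exact Nat.one_le_iff_ne_zero.2 (by positivity)
      · gcongr
        exact le_abs_self _)
  refine key.trans ?_
  have hDinv : (D : ℝ)⁻¹ ≤ 2 * (r : ℝ) ^ (-θ) := by
    rw [Real.rpow_neg hr0.le]
    calc (D : ℝ)⁻¹ ≤ ((r : ℝ) ^ θ / 2)⁻¹ := inv_anti₀ (by positivity) hDge
      _ = _ := by rw [inv_div, div_eq_mul_inv]
  have hrinv : (r : ℝ)⁻¹ ≤ (r : ℝ) ^ (-θ) := by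
    rw [← Real.rpow_neg_one]
    exact Real.rpow_le_rpow_of_exponent_le hr1 (by linarith)
  have hsq4 : √(4 * (r : ℝ) ^ (-θ)) = 2 * (r : ℝ) ^ (-(θ / 2)) := by
    rw [show 4 * (r : ℝ) ^ (-θ) = (2 * (r : ℝ) ^ (-(θ / 2))) ^ 2 by
      rw [mul_pow, ← Real.rpow_natCast, ← Real.rpow_natCast, ← Real.rpow_mul hr0.le]
      norm_num]
    exact Real.sqrt_sq (by positivity)
  have hrθ0 : 0 ≤ (r : ℝ) ^ (-θ) := by positivity
  have hsq : √((D : ℝ)⁻¹ + (r : ℝ)⁻¹) ≤ 2 * (r : ℝ) ^ (-(θ / 2)) := by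
    rw [← hsq4]
    exact Real.sqrt_le_sqrt (by linarith)
  have hDhalf : (D : ℝ) ^ (-(1 / 2) : ℝ) ≤ 2 * (r : ℝ) ^ (-(θ / 2)) := by
    rw [← hsq4, Real.rpow_neg (by positivity), ← Real.sqrt_eq_rpow, ← Real.sqrt_inv]
    exact Real.sqrt_le_sqrt (by linarith)
  have hcomb : (r : ℝ) ^ (θ / 8) * (r : ℝ) ^ (-(θ / 2)) ≤ (r : ℝ) ^ (-η) := by
    rw [← Real.rpow_add hr0]
    exact Real.rpow_le_rpow_of_exponent_le hr1 (by linarith)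
  have hω' : (r : ℝ) ^ (-ω) ≤ (r : ℝ) ^ (-η) :=
    Real.rpow_le_rpow_of_exponent_le hr1 (by linarith)
  have hBB : C₂ * ((r : ℝ) * (1 + T)) ^ κ * (C₂ * ((r : ℝ) * (1 + T)) ^ κ) ≤
      C₂ ^ 2 * ((r : ℝ) ^ (θ / 8) * (1 + T) ^ ε) := by
    have e : C₂ * ((r : ℝ) * (1 + T)) ^ κ * (C₂ * ((r : ℝ) * (1 + T)) ^ κ) =
        C₂ ^ 2 * ((r : ℝ) ^ (2 * κ) * (1 + T) ^ (2 * κ)) := by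
      rw [← Real.mul_rpow hr0.le (by linarith), two_mul, Real.rpow_add (by positivity)]
      ring
    rw [e]
    gcongr <;> linarith
  have hmm : (m₁ * m₂ : ℝ) ≤ (r : ℝ) ^ (θ / 8) := by
    calc (m₁ * m₂ : ℝ) ≤ (r : ℝ) ^ ħ * (r : ℝ) ^ ħ := by gcongr
      _ = (r : ℝ) ^ (ħ + ħ) := (Real.rpow_add hr0 _ _).symm
      _ ≤ _ := Real.rpow_le_rpow_of_exponent_le hr1 (by linarith)
  have hl := lcmSum_nonneg
  have hrη : 0 ≤ (r : ℝ) ^ (-η) := by positivity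
  have t1 : Z ^ 2 * (|C₁| * (1 + T) ^ ε * (r : ℝ) ^ (-ω)) ≤
      Z ^ 2 * |C₁| * ((1 + T) ^ ε * (r : ℝ) ^ (-η)) := by
    calc _ ≤ Z ^ 2 * (|C₁| * (1 + T) ^ ε * (r : ℝ) ^ (-η)) := by gcongr
      _ = _ := by ring
  have t2 : 12 * Z ^ 2 * (C₂ * ((r : ℝ) * (1 + T)) ^ κ * (C₂ * ((r : ℝ) * (1 + T)) ^ κ)) *
      √((D : ℝ)⁻¹ + (r : ℝ)⁻¹) ≤
      12 * Z ^ 2 * C₂ ^ 2 * 2 * ((1 + T) ^ ε * (r : ℝ) ^ (-η)) := by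
    calc _ ≤ 12 * Z ^ 2 * (C₂ ^ 2 * ((r : ℝ) ^ (θ / 8) * (1 + T) ^ ε)) *
          (2 * (r : ℝ) ^ (-(θ / 2))) := by gcongr
      _ = 12 * Z ^ 2 * C₂ ^ 2 * 2 * ((1 + T) ^ ε *
          ((r : ℝ) ^ (θ / 8) * (r : ℝ) ^ (-(θ / 2)))) := by ring
      _ ≤ _ := by gcongr
  have t3 : Z * (m₁ * m₂) * lcmSum * (D : ℝ) ^ (-(1 / 2) : ℝ) ≤
      Z * lcmSum * 2 * ((1 + T) ^ ε * (r : ℝ) ^ (-η)) := by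
    calc _ ≤ Z * (r : ℝ) ^ (θ / 8) * lcmSum * (2 * (r : ℝ) ^ (-(θ / 2))) := by gcongr
      _ = Z * lcmSum * 2 * (1 * ((r : ℝ) ^ (θ / 8) * (r : ℝ) ^ (-(θ / 2)))) := by ring
      _ ≤ _ := by gcongr
  linarith

end

section

open Complex MeasureTheory

/-! ### Double Perron integrals -/

/-- The constant `32 ∫ (1 + |t|)^{-1-e} dt` in the bounds for Perron integrals. -/
def perronConst (e : ℝ) : ℝ := 32 * ∫ t : ℝ, (1 + |t|) ^ (-(1 + e))

lemma perronConst_nonneg (e : ℝ) : 0 ≤ perronConst e :=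
  mul_nonneg (by norm_num) (integral_nonneg fun t => by positivity)

lemma norm_perronKernel_mul_rpow_le {N : ℕ} (hN : 1 ≤ N) {σ e : ℝ} (hσ : 1 / 2 ≤ σ) (he : 0 ≤ e)
    (he' : e ≤ 1 / 2) (t : ℝ) :
    ‖perronKernel N ((σ : ℂ) + t * I)‖ * (1 + |t|) ^ e ≤
      32 * ((N : ℝ) + 1) ^ (σ + 2 * e) * (1 + |t|) ^ (-(1 + e)) := by
  have h := norm_perronKernel_le hN (s := (σ : ℂ) + t * I) (by simpa using hσ)
    (κ := 2 * e) (by linarith) (by linarith)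
  simp only [add_re, ofReal_re, mul_re, I_re, mul_zero, ofReal_im, I_im, mul_one, sub_self,
    add_zero, add_im, mul_im, zero_add] at h
  have ht : 0 < 1 + |t| := by positivity
  calc _ ≤ 32 * ((N : ℝ) + 1) ^ (σ + 2 * e) * (1 + |t|) ^ (-(1 + 2 * e)) * (1 + |t|) ^ e := by
        gcongr
    _ = _ := by
        rw [mul_assoc, ← Real.rpow_add ht]
        congr 2
        ring

lemma integral_bound_eq (N : ℕ) (σ e : ℝ) :
    ∫ t : ℝ, 32 * ((N : ℝ) + 1) ^ (σ + 2 * e) * (1 + |t|) ^ (-(1 + e)) =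
      perronConst e * ((N : ℝ) + 1) ^ (σ + 2 * e) := by
  rw [integral_const_mul, perronConst]
  ring

/-- Partial sums through Perron's formula, for a Dirichlet series with `M ≪ (1 + |t|)^e`. -/
lemma norm_sum_Icc_le {a : ℕ → ℂ} (ha : ∀ n, ‖a n‖ ≤ 1) {N : ℕ} (hN : 1 ≤ N)
    {M : ℂ → ℂ} {σ B e : ℝ} (hσ : 1 / 2 < σ) (hσ2 : σ ≤ 2) (he : 0 < e) (he' : e ≤ 1 / 2)
    (hM : DifferentiableOn ℂ M {s | 1 / 2 < s.re})
    (hMa : ∀ s : ℂ, 1 < s.re → M s = LSeries a s)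
    (hB : ∀ s : ℂ, σ ≤ s.re → ‖M s‖ ≤ B * (1 + |s.im|) ^ e) :
    ‖∑ n ∈ Finset.Icc 1 N, a n‖ ≤ B * (perronConst e * ((N : ℝ) + 1) ^ (σ + 2 * e)) := by
  have hB0 : 0 ≤ B := by
    have := (norm_nonneg _).trans (hB 2 (by simpa using hσ2))
    simpa using this
  have key := integral_mul_perronKernel_eq_sum ha hN hσ hσ2 he' hM hMa hB
  have h1 : ‖∫ t : ℝ, M ((σ : ℂ) + t * I) * perronKernel N ((σ : ℂ) + t * I)‖ ≤
      ∫ t : ℝ, B * (32 * ((N : ℝ) + 1) ^ (σ + 2 * e) * (1 + |t|) ^ (-(1 + e))) := by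
    refine norm_integral_le_of_norm_le
      (((integrable_one_add_abs_rpow (by linarith)).const_mul _).const_mul _)
      (.of_forall fun t => ?_)
    rw [norm_mul]
    have hb := hB ((σ : ℂ) + t * I) (by simp)
    simp only [add_im, ofReal_im, mul_im, ofReal_re, I_im, mul_one, I_re, mul_zero, add_zero,
      zero_add] at hb
    calc _ ≤ B * (1 + |t|) ^ e * ‖perronKernel N ((σ : ℂ) + t * I)‖ := by gcongr
      _ = B * (‖perronKernel N ((σ : ℂ) + t * I)‖ * (1 + |t|) ^ e) := by ring
      _ ≤ _ := mul_le_mul_of_nonneg_left (norm_perronKernel_mul_rpow_le hN hσ.le he.le he' t) hB0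
  rw [integral_const_mul, integral_bound_eq, key, norm_mul] at h1
  refine le_trans (le_mul_of_one_le_left (norm_nonneg _) ?_) h1
  rw [norm_mul, Complex.norm_real, Real.norm_eq_abs, abs_of_pos Real.pi_pos]
  norm_num
  linarith [Real.pi_gt_three]

lemma integrable_mul_perronKernel {N : ℕ} (hN : 1 ≤ N) {M : ℂ → ℂ} {σ B e : ℝ} (hσ : 1 / 2 < σ)
    (he : 0 < e) (he' : e ≤ 1 / 2) (hM : DifferentiableOn ℂ M {s | 1 / 2 < s.re})
    (hB : ∀ s : ℂ, σ ≤ s.re → ‖M s‖ ≤ B * (1 + |s.im|) ^ e) :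
    Integrable fun t : ℝ => M ((σ : ℂ) + t * I) * perronKernel N ((σ : ℂ) + t * I) := by
  have hB0 : 0 ≤ B := by
    have := (norm_nonneg _).trans (hB σ (by simp))
    simpa using this
  have hc : Continuous fun t : ℝ => M ((σ : ℂ) + t * I) :=
    hM.continuousOn.comp_continuous (by fun_prop) fun t => by simpa using hσ
  refine Integrable.mono' (((integrable_one_add_abs_rpow (p := 1 + e) (by linarith)).const_mul
    (32 * ((N : ℝ) + 1) ^ (σ + 2 * e))).const_mul B)
    (hc.mul (continuous_perronKernel_line hN (by linarith))).aestronglyMeasurable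
    (.of_forall fun t => ?_)
  rw [norm_mul]
  have hb := hB ((σ : ℂ) + t * I) (by simp)
  simp only [add_im, ofReal_im, mul_im, ofReal_re, I_im, mul_one, I_re, mul_zero, add_zero,
    zero_add] at hb
  calc _ ≤ B * (1 + |t|) ^ e * ‖perronKernel N ((σ : ℂ) + t * I)‖ := by gcongr
    _ = B * (‖perronKernel N ((σ : ℂ) + t * I)‖ * (1 + |t|) ^ e) := by ring
    _ ≤ _ := mul_le_mul_of_nonneg_left (norm_perronKernel_mul_rpow_le hN hσ.le he.le he' t) hB0

/-- Perron's formula in both variables of the Steinhaus series. -/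
lemma integral_steinhausTwistedSeries {c : ArithmeticFunction ℤ} (hc : ∀ n, |c n| ≤ 1) (r : ℕ)
    {m₁ m₂ : ℕ} (h₁ : m₁ ≠ 0) (h₂ : m₂ ≠ 0) {N : ℕ} (hN : 1 ≤ N) {σ : ℝ} (hσ : 1 / 2 < σ) :
    Integrable (fun p : ℝ × ℝ => steinhausTwistedSeries c r m₁ m₂ ((σ : ℂ) + p.1 * I)
      ((σ : ℂ) + p.2 * I) *
        (perronKernel N ((σ : ℂ) + p.1 * I) * perronKernel N ((σ : ℂ) + p.2 * I))) ∧
    ∫ p : ℝ × ℝ, steinhausTwistedSeries c r m₁ m₂ ((σ : ℂ) + p.1 * I) ((σ : ℂ) + p.2 * I) *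
        (perronKernel N ((σ : ℂ) + p.1 * I) * perronKernel N ((σ : ℂ) + p.2 * I)) =
      (2 * Real.pi) ^ 2 * ∑ n ∈ Finset.Icc 1 N ×ˢ Finset.Icc 1 N,
        c n.1 * c n.2 * diagCoeff r m₁ m₂ n := by
  set K : ℝ → ℂ := fun t => perronKernel N ((σ : ℂ) + t * I) with hK
  have hKc : Continuous K := continuous_perronKernel_line hN (by linarith)
  have hKi : Integrable K := integrable_perronKernel_line hN hσ.le
  have hKK : Integrable (fun p : ℝ × ℝ => K p.1 * K p.2) := hKi.mul_prod hKi
  set coef : ℕ × ℕ → ℂ := fun n => c n.1 * c n.2 * diagCoeff r m₁ m₂ n with hcoef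
  set b : ℕ × ℕ → ℝ := fun n =>
    if m₁ * n.1 = m₂ * n.2 then (((n.1 * n.2 : ℕ) : ℝ) ^ σ)⁻¹ else 0 with hb
  have hbs : Summable b := (hasSum_diag_rpow h₁ h₂ hσ).summable
  set F : ℕ × ℕ → ℝ × ℝ → ℂ := fun n p =>
    coef n / ((n.1 : ℂ) ^ ((σ : ℂ) + p.1 * I) * (n.2 : ℂ) ^ ((σ : ℂ) + p.2 * I)) *
      (K p.1 * K p.2) with hF
  have hFn : ∀ n p, ‖F n p‖ ≤ b n * ‖K p.1 * K p.2‖ := by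
    intro n p
    rw [hF, norm_mul]
    exact mul_le_mul_of_nonneg_right
      (norm_diag_term_le hc r m₁ m₂ (by simp) (by simp) n) (norm_nonneg _)
  have hFm : ∀ n, AEStronglyMeasurable (F n) volume := by
    intro n
    refine Measurable.aestronglyMeasurable ?_
    refine Measurable.mul ?_ ?_
    · refine Measurable.div measurable_const (Measurable.mul ?_ ?_)
      · exact Measurable.pow measurable_const (by fun_prop)
      · exact Measurable.pow measurable_const (by fun_prop)
    · exact (hKc.measurable.comp measurable_fst).mul (hKc.measurable.comp measurable_snd)
  have hFi : ∀ n, Integrable (F n) := fun n =>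
    Integrable.mono' (hKK.norm.const_mul (b n)) (hFm n) (.of_forall (hFn n))
  have hsum : Summable fun n => ∫ p, ‖F n p‖ := by
    refine Summable.of_nonneg_of_le (fun n => integral_nonneg fun t => norm_nonneg _) (fun n => ?_)
      (hbs.mul_right (∫ p : ℝ × ℝ, ‖K p.1 * K p.2‖))
    rw [← integral_const_mul]
    exact integral_mono (hFi n).norm (hKK.norm.const_mul _) (hFn n)
  have htsum : ∀ p : ℝ × ℝ, ∑' n, F n p = steinhausTwistedSeries c r m₁ m₂ ((σ : ℂ) + p.1 * I)
      ((σ : ℂ) + p.2 * I) * (K p.1 * K p.2) := by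
    intro p
    rw [steinhausTwistedSeries_eq c h₁ h₂, ← tsum_mul_right]
  have key := (hasSum_integral_of_summable_integral_norm hFi hsum).tsum_eq
  simp only [htsum] at key
  refine ⟨?_, ?_⟩
  · refine Integrable.mono' (hKK.norm.const_mul (∑' n, b n)) ?_ (.of_forall fun p => ?_)
    · have : AEMeasurable (fun p => ∑' n, F n p) volume :=
        AEMeasurable.tsum fun n => (hFm n).aemeasurable
      simp only [htsum] at this
      exact this.aestronglyMeasurable
    · rw [← htsum]
      exact tsum_of_norm_bounded (hbs.hasSum.mul_right _) fun n => hFn n p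
  rw [← key]
  have hFint : ∀ n : ℕ × ℕ, n.1 ≠ 0 → n.2 ≠ 0 → ∫ p, F n p =
      coef n * ((2 * Real.pi * if n.1 ≤ N then 1 else 0) *
        (2 * Real.pi * if n.2 ≤ N then 1 else 0)) := by
    intro n hn1 hn2
    rw [← integral_perronKernel_mul hN (Nat.one_le_iff_ne_zero.2 hn1) (by linarith : 0 < σ),
      ← integral_perronKernel_mul hN (Nat.one_le_iff_ne_zero.2 hn2) (by linarith : 0 < σ),
      ← integral_prod_mul, ← integral_const_mul]
    refine integral_congr_ae (.of_forall fun p => ?_)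
    simp only [hF, hK, Complex.cpow_neg, div_eq_mul_inv, mul_inv]
    ring
  rw [tsum_eq_sum (s := Finset.Icc 1 N ×ˢ Finset.Icc 1 N), Finset.mul_sum]
  · refine Finset.sum_congr rfl fun n hn => ?_
    have hn' := Finset.mem_product.1 hn
    have h1 := Finset.mem_Icc.1 hn'.1
    have h2 := Finset.mem_Icc.1 hn'.2
    rw [hFint n (by lia) (by lia), if_pos h1.2, if_pos h2.2]
    ring
  · intro n hn
    by_cases hn1 : n.1 = 0
    · simp [hF, hcoef, hn1]
    by_cases hn2 : n.2 = 0
    · simp [hF, hcoef, hn2]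
    rw [hFint n hn1 hn2]
    by_cases h1 : n.1 ≤ N
    · by_cases h2 : n.2 ≤ N
      · exact absurd (Finset.mem_product.2 ⟨Finset.mem_Icc.2 ⟨by lia, h1⟩,
          Finset.mem_Icc.2 ⟨by lia, h2⟩⟩) hn
      · simp [h2]
    · simp [h1]

lemma charAvgNonprincipal_mul_right (r : ℕ) [NeZero r] (F : DirichletCharacter ℂ r → ℂ) (z : ℂ) :
    charAvgNonprincipal r (fun χ => F χ * z) = charAvgNonprincipal r F * z := by
  simp only [charAvgNonprincipal]
  rw [← Finset.sum_mul, div_mul_eq_mul_div]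

/-- From a twisted estimate on the line `Re s = σ` to the second moment of partial sums: both sides
are double Perron integrals of the two sides of the estimate. -/
lemma norm_charAvgNonprincipal_sum_sub_le {r : ℕ} [NeZero r] {c : ArithmeticFunction ℤ}
    (hc : ∀ n, |c n| ≤ 1) {m₁ m₂ : ℕ} (h₁ : m₁ ≠ 0) (h₂ : m₂ ≠ 0) {N : ℕ} (hN : 1 ≤ N)
    {M : DirichletCharacter ℂ r → ℂ → ℂ} {σ B e E : ℝ} (hσ : 1 / 2 < σ) (hσ2 : σ ≤ 2)
    (he : 0 < e) (he' : e ≤ 1 / 2)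
    (hM : ∀ χ, DifferentiableOn ℂ (M χ) {s | 1 / 2 < s.re})
    (hMa : ∀ χ, ∀ s : ℂ, 1 < s.re → M χ s = LSeries (fun n => (c n : ℂ) * χ (n : ZMod r)) s)
    (hB : ∀ χ, ∀ s : ℂ, σ ≤ s.re → ‖M χ s‖ ≤ B * (1 + |s.im|) ^ e)
    (hE0 : 0 ≤ E)
    (hE : ∀ s₁ s₂ : ℂ, s₁.re = σ → s₂.re = σ →
      ‖charAvgNonprincipal r (fun χ => χ (m₁ : ZMod r) * (star χ) (m₂ : ZMod r) *
          (M χ s₁ * M (star χ) s₂)) - steinhausTwistedSeries c r m₁ m₂ s₁ s₂‖ ≤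
        E * (1 + max |s₁.im| |s₂.im|) ^ e) :
    ‖charAvgNonprincipal r (fun χ => χ (m₁ : ZMod r) * (star χ) (m₂ : ZMod r) *
        ((∑ n ∈ Finset.Icc 1 N, (c n : ℂ) * χ (n : ZMod r)) *
          ∑ n ∈ Finset.Icc 1 N, (c n : ℂ) * (star χ) (n : ZMod r))) -
      ∑ n ∈ Finset.Icc 1 N ×ˢ Finset.Icc 1 N, c n.1 * c n.2 * diagCoeff r m₁ m₂ n‖ ≤
      E * (perronConst e * ((N : ℝ) + 1) ^ (σ + 2 * e)) ^ 2 := by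
  set K : ℝ → ℂ := fun t => perronKernel N ((σ : ℂ) + t * I) with hK
  have hac : ∀ (χ : DirichletCharacter ℂ r) (n : ℕ), ‖(c n : ℂ) * χ (n : ZMod r)‖ ≤ 1 := by
    intro χ n
    rw [norm_mul]
    refine mul_le_one₀ ?_ (norm_nonneg _) (χ.norm_le_one _)
    rw [Complex.norm_intCast]
    exact_mod_cast hc n
  have hMK : ∀ χ, Integrable fun t : ℝ => M χ ((σ : ℂ) + t * I) * K t := fun χ =>
    integrable_mul_perronKernel hN hσ he he' (hM χ) (hB χ)
  have hperron : ∀ χ, ∫ t : ℝ, M χ ((σ : ℂ) + t * I) * K t =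
      2 * Real.pi * ∑ n ∈ Finset.Icc 1 N, (c n : ℂ) * χ (n : ZMod r) := fun χ =>
    integral_mul_perronKernel_eq_sum (hac χ) hN hσ hσ2 he' (hM χ) (hMa χ) (hB χ)
  set Φ : ℝ × ℝ → DirichletCharacter ℂ r → ℂ := fun p χ =>
    χ (m₁ : ZMod r) * (star χ) (m₂ : ZMod r) *
      (M χ ((σ : ℂ) + p.1 * I) * M (star χ) ((σ : ℂ) + p.2 * I)) with hΦ
  have hΦi : ∀ χ, Integrable fun p : ℝ × ℝ => Φ p χ * (K p.1 * K p.2) := by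
    intro χ
    have := ((hMK χ).mul_prod (hMK (star χ))).const_mul (χ (m₁ : ZMod r) * (star χ) (m₂ : ZMod r))
    refine this.congr (.of_forall fun p => ?_)
    simp only [hΦ]
    ring
  have hΦint : ∀ χ, ∫ p : ℝ × ℝ, Φ p χ * (K p.1 * K p.2) = (2 * Real.pi) ^ 2 *
      (χ (m₁ : ZMod r) * (star χ) (m₂ : ZMod r) *
        ((∑ n ∈ Finset.Icc 1 N, (c n : ℂ) * χ (n : ZMod r)) *
          ∑ n ∈ Finset.Icc 1 N, (c n : ℂ) * (star χ) (n : ZMod r))) := by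
    intro χ
    have : ∫ p : ℝ × ℝ, Φ p χ * (K p.1 * K p.2) = χ (m₁ : ZMod r) * (star χ) (m₂ : ZMod r) *
        ((∫ t : ℝ, M χ ((σ : ℂ) + t * I) * K t) *
          ∫ t : ℝ, M (star χ) ((σ : ℂ) + t * I) * K t) := by
      rw [← integral_prod_mul, ← integral_const_mul]
      refine integral_congr_ae (.of_forall fun p => ?_)
      simp only [hΦ]
      ring
    rw [this, hperron, hperron]
    ring
  have hpull : ∀ p : ℝ × ℝ, charAvgNonprincipal r (Φ p) * (K p.1 * K p.2) =
      charAvgNonprincipal r (fun χ => Φ p χ * (K p.1 * K p.2)) := fun p =>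
    (charAvgNonprincipal_mul_right r (Φ p) _).symm
  have hAi : Integrable fun p : ℝ × ℝ => charAvgNonprincipal r (Φ p) * (K p.1 * K p.2) := by
    simp only [hpull]
    simp only [charAvgNonprincipal]
    exact (integrable_finsetSum _ fun χ _ => hΦi χ).div_const _
  have hAint : ∫ p : ℝ × ℝ, charAvgNonprincipal r (Φ p) * (K p.1 * K p.2) =
      (2 * Real.pi) ^ 2 * charAvgNonprincipal r (fun χ => χ (m₁ : ZMod r) *
        (star χ) (m₂ : ZMod r) * ((∑ n ∈ Finset.Icc 1 N, (c n : ℂ) * χ (n : ZMod r)) *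
          ∑ n ∈ Finset.Icc 1 N, (c n : ℂ) * (star χ) (n : ZMod r))) := by
    simp only [hpull]
    simp only [charAvgNonprincipal]
    rw [integral_div, integral_finsetSum _ fun χ _ => hΦi χ, Finset.sum_congr rfl fun χ _ => hΦint χ,
      ← Finset.mul_sum, mul_div_assoc]
  obtain ⟨hSi, hSint⟩ := integral_steinhausTwistedSeries hc r h₁ h₂ hN hσ
  have hdiff : ‖∫ p : ℝ × ℝ, (charAvgNonprincipal r (Φ p) * (K p.1 * K p.2) -
      steinhausTwistedSeries c r m₁ m₂ ((σ : ℂ) + p.1 * I) ((σ : ℂ) + p.2 * I) *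
        (K p.1 * K p.2))‖ ≤ E * (perronConst e * ((N : ℝ) + 1) ^ (σ + 2 * e)) ^ 2 := by
    set β : ℝ → ℝ := fun t => 32 * ((N : ℝ) + 1) ^ (σ + 2 * e) * (1 + |t|) ^ (-(1 + e)) with hβ
    have hβi : Integrable β := (integrable_one_add_abs_rpow (by linarith)).const_mul _
    have hβint : ∫ p : ℝ × ℝ, E * (β p.1 * β p.2) =
        E * (perronConst e * ((N : ℝ) + 1) ^ (σ + 2 * e)) ^ 2 := by
      rw [integral_const_mul, pow_two, ← integral_bound_eq]
      congr 1
      exact integral_prod_mul β β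
    rw [← hβint]
    refine norm_integral_le_of_norm_le ((hβi.mul_prod hβi).const_mul E) (.of_forall fun p => ?_)
    rw [← sub_mul, norm_mul, norm_mul]
    have hEp := hE ((σ : ℂ) + p.1 * I) ((σ : ℂ) + p.2 * I) (by simp) (by simp)
    simp only [add_im, ofReal_im, mul_im, ofReal_re, I_im, mul_one, I_re, mul_zero, add_zero,
      zero_add] at hEp
    have hmax : (1 + max |p.1| |p.2|) ^ e ≤ (1 + |p.1|) ^ e * (1 + |p.2|) ^ e := by
      rw [← Real.mul_rpow (by positivity) (by positivity)]
      refine Real.rpow_le_rpow (by positivity) ?_ he.le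
      have h1 := abs_nonneg p.1
      have h2 := abs_nonneg p.2
      rcases max_cases |p.1| |p.2| with h | h <;> rw [h.1] <;> nlinarith
    have k1 := norm_perronKernel_mul_rpow_le hN hσ.le he.le he' p.1
    have k2 := norm_perronKernel_mul_rpow_le hN hσ.le he.le he' p.2
    calc _ ≤ E * (1 + max |p.1| |p.2|) ^ e * (‖K p.1‖ * ‖K p.2‖) := by gcongr
      _ ≤ E * ((1 + |p.1|) ^ e * (1 + |p.2|) ^ e) * (‖K p.1‖ * ‖K p.2‖) := by gcongr
      _ = E * ((‖K p.1‖ * (1 + |p.1|) ^ e) * (‖K p.2‖ * (1 + |p.2|) ^ e)) := by ring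
      _ ≤ E * (β p.1 * β p.2) := by
          have : 0 ≤ β p.1 := by positivity
          gcongr
  rw [integral_sub hAi hSi, hAint, hSint, ← mul_sub, norm_mul] at hdiff
  refine le_trans (le_mul_of_one_le_left (norm_nonneg _) ?_) hdiff
  rw [norm_pow, norm_mul, Complex.norm_real, Real.norm_eq_abs, abs_of_pos Real.pi_pos]
  refine one_le_pow₀ ?_
  norm_num
  linarith [Real.pi_gt_three]

end

section

open Complex

/-! ### The second moment of partial sums -/

/-- The complete Steinhaus second moment: only `m₁ n₁ = m₂ n₂` contributes. -/
lemma steinhausAvg_partialSum (c : ArithmeticFunction ℤ) {m₁ m₂ : ℕ} (h₁ : m₁ ≠ 0) (h₂ : m₂ ≠ 0)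
    (x : ℝ) :
    steinhausAvg (fun f => f m₁ * star (f m₂) * ((‖partialSum c f x‖ ^ 2 : ℝ) : ℂ)) =
      ∑ n ∈ Finset.Icc 1 ⌊x⌋₊ ×ˢ Finset.Icc 1 ⌊x⌋₊,
        (c n.1 * c n.2 * if m₁ * n.1 = m₂ * n.2 then 1 else 0 : ℂ) := by
  set S := Finset.Icc 1 ⌊x⌋₊ with hS
  have hne : ∀ n ∈ S, n ≠ 0 := fun n hn => by have := (Finset.mem_Icc.1 hn).1; lia
  have key := steinhausAvg_sum_mul_star_sum S S (fun n => (c n : ℂ)) (fun n => (c n : ℂ))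
    (fun n => m₁ * n) (fun n => m₂ * n) (fun n hn => mul_ne_zero h₁ (hne n hn))
    (fun n hn => mul_ne_zero h₂ (hne n hn))
  have hpt : ∀ θ, steinhausFun θ m₁ * star (steinhausFun θ m₂) *
      ((‖partialSum c (steinhausFun θ) x‖ ^ 2 : ℝ) : ℂ) =
      (∑ n ∈ S, (c n : ℂ) * steinhausFun θ (m₁ * n)) *
        star (∑ n ∈ S, (c n : ℂ) * steinhausFun θ (m₂ * n)) := by
    intro θ
    have e : ∀ m : ℕ, m ≠ 0 → ∑ n ∈ S, (c n : ℂ) * steinhausFun θ (m * n) =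
        steinhausFun θ m * partialSum c (steinhausFun θ) x := by
      intro m hm
      rw [partialSum, Finset.mul_sum]
      refine Finset.sum_congr rfl fun n hn => ?_
      rw [steinhausFun_mul θ hm (hne n hn)]
      ring
    rw [e m₁ h₁, e m₂ h₂, star_mul', Complex.ofReal_pow, ← Complex.mul_conj']
    simp only [RCLike.star_def]
    ring
  rw [steinhausAvg] at key ⊢
  simp only [hpt]
  rw [key, Finset.sum_product]
  refine Finset.sum_congr rfl fun i _ => Finset.sum_congr rfl fun j _ => ?_
  simp

/-- On the diagonal `m₁ n₁ = m₂ n₂` the first variable determines the second. -/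
lemma norm_sum_diag_le {m₁ m₂ N : ℕ} (h₂ : m₂ ≠ 0) (P : ℕ → Prop) [DecidablePred P]
    {F : ℕ × ℕ → ℂ} (hF : ∀ n, ‖F n‖ ≤ 1)
    (hF0 : ∀ n ∈ Finset.Icc 1 N ×ˢ Finset.Icc 1 N, ¬ (m₁ * n.1 = m₂ * n.2 ∧ P n.1) → F n = 0) :
    ‖∑ n ∈ Finset.Icc 1 N ×ˢ Finset.Icc 1 N, F n‖ ≤ ((Finset.Icc 1 N).filter P).card := by
  set T := (Finset.Icc 1 N ×ˢ Finset.Icc 1 N).filter fun n => m₁ * n.1 = m₂ * n.2 ∧ P n.1 with hT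
  have h1 : ∑ n ∈ Finset.Icc 1 N ×ˢ Finset.Icc 1 N, F n = ∑ n ∈ T, F n := by
    refine (Finset.sum_subset (Finset.filter_subset _ _) fun n hn hnT => hF0 n hn fun h => ?_).symm
    exact hnT (Finset.mem_filter.2 ⟨hn, h⟩)
  have h2 : T.card ≤ ((Finset.Icc 1 N).filter P).card := by
    refine Finset.card_le_card_of_injOn Prod.fst (fun n hn => ?_) ?_
    · have hn' := Finset.mem_filter.1 hn
      exact Finset.mem_coe.2 (Finset.mem_filter.2 ⟨(Finset.mem_product.1 hn'.1).1, hn'.2.2⟩)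
    · rintro ⟨a, b⟩ hab ⟨a', b'⟩ hab' h
      have e1 := (Finset.mem_filter.1 hab).2.1
      have e2 := (Finset.mem_filter.1 hab').2.1
      simp only at e1 e2 h
      subst h
      have : b = b' := Nat.eq_of_mul_eq_mul_left (Nat.pos_of_ne_zero h₂) (e1.symm.trans e2)
      rw [this]
  rw [h1]
  refine (norm_sum_le _ _).trans ((Finset.sum_le_sum fun n _ => hF n).trans ?_)
  simpa using h2

lemma norm_coeff_le {c : ArithmeticFunction ℤ} (hc : ∀ n, |c n| ≤ 1) (n : ℕ) :
    ‖(c n : ℂ)‖ ≤ 1 := by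
  rw [Complex.norm_intCast]; exact_mod_cast hc n

lemma norm_sum_diag_coeff_le {c : ArithmeticFunction ℤ} (hc : ∀ n, |c n| ≤ 1) {m₁ m₂ : ℕ}
    (h₂ : m₂ ≠ 0) (N : ℕ) :
    ‖∑ n ∈ Finset.Icc 1 N ×ˢ Finset.Icc 1 N,
        (c n.1 * c n.2 * if m₁ * n.1 = m₂ * n.2 then 1 else 0 : ℂ)‖ ≤ N := by
  refine (norm_sum_diag_le (m₁ := m₁) h₂ (fun _ => True) (fun n => ?_) fun n _ hn => ?_).trans ?_
  · rw [norm_mul, norm_mul]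
    refine mul_le_one₀ (mul_le_one₀ (norm_coeff_le hc _) (norm_nonneg _) (norm_coeff_le hc _))
      (norm_nonneg _) ?_
    split_ifs <;> simp
  · rw [if_neg fun h => hn ⟨h, trivial⟩, mul_zero]
  · simp

lemma norm_sum_diagCoeff_le {c : ArithmeticFunction ℤ} (hc : ∀ n, |c n| ≤ 1) (r : ℕ) {m₁ m₂ : ℕ}
    (h₂ : m₂ ≠ 0) (N : ℕ) :
    ‖∑ n ∈ Finset.Icc 1 N ×ˢ Finset.Icc 1 N, (c n.1 * c n.2 * diagCoeff r m₁ m₂ n : ℂ)‖ ≤ N := by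
  refine (norm_sum_diag_le (m₁ := m₁) h₂ (fun _ => True) (fun n => ?_) fun n _ hn => ?_).trans ?_
  · rw [norm_mul, norm_mul]
    exact mul_le_one₀ (mul_le_one₀ (norm_coeff_le hc _) (norm_nonneg _) (norm_coeff_le hc _))
      (norm_nonneg _) (norm_diagCoeff_le _ _ _ _)
  · rw [diagCoeff_eq_zero fun h => hn ⟨h, trivial⟩, mul_zero]
  · simp

/-- Passing from `f` to `f^*` only affects `n₁, n₂` divisible by `r`. -/
lemma norm_sum_diag_sub_le {c : ArithmeticFunction ℤ} (hc : ∀ n, |c n| ≤ 1) {r : ℕ}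
    (hr : r.Prime) {m₁ m₂ : ℕ} (h₁ : m₁ ≠ 0) (h₂ : m₂ ≠ 0) (h₁r : m₁ < r) (h₂r : m₂ < r) (N : ℕ) :
    ‖∑ n ∈ Finset.Icc 1 N ×ˢ Finset.Icc 1 N, (c n.1 * c n.2 * diagCoeff r m₁ m₂ n : ℂ) -
      ∑ n ∈ Finset.Icc 1 N ×ˢ Finset.Icc 1 N,
        (c n.1 * c n.2 * if m₁ * n.1 = m₂ * n.2 then 1 else 0 : ℂ)‖ ≤ (N : ℝ) / r := by
  have hm₁ : ¬ r ∣ m₁ := Nat.not_dvd_of_pos_of_lt (Nat.pos_of_ne_zero h₁) h₁r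
  have hm₂ : ¬ r ∣ m₂ := Nat.not_dvd_of_pos_of_lt (Nat.pos_of_ne_zero h₂) h₂r
  have hcop : ∀ m : ℕ, m.Coprime r ↔ ¬ r ∣ m := fun m => by
    rw [Nat.coprime_comm, hr.coprime_iff_not_dvd]
  rw [← Finset.sum_sub_distrib]
  refine (norm_sum_diag_le (m₁ := m₁) h₂ (fun n => r ∣ n) (fun n => ?_) fun n _ hn => ?_).trans ?_
  · rw [← mul_sub, norm_mul, norm_mul]
    refine mul_le_one₀ (mul_le_one₀ (norm_coeff_le hc _) (norm_nonneg _) (norm_coeff_le hc _))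
      (norm_nonneg _) ?_
    rw [diagCoeff]
    by_cases h : m₁ * n.1 = m₂ * n.2
    · simp only [h, true_and, if_true]
      split_ifs <;> simp
    · simp [h]
  · by_cases h : m₁ * n.1 = m₂ * n.2
    · have hn1 : ¬ r ∣ n.1 := fun h' => hn ⟨h, h'⟩
      have hn2 : ¬ r ∣ n.2 := fun h' => by
        have : r ∣ m₁ * n.1 := h ▸ h'.mul_left _
        rcases hr.dvd_mul.1 this with h | h <;> contradiction
      rw [diagCoeff, if_pos ⟨h, (hcop _).2 hm₁, (hcop _).2 hm₂, (hcop _).2 hn1, (hcop _).2 hn2⟩,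
        if_pos h, sub_self]
    · rw [diagCoeff_eq_zero h, if_neg h, sub_self]
  · have : ((Finset.Icc 1 N).filter fun n => r ∣ n).card = N / r := by
      have := Nat.Ioc_filter_dvd_card_eq_div N r
      rwa [← Finset.Icc_succ_left_eq_Ioc] at this
    rw [this]
    exact Nat.cast_div_le

lemma charAvgNonprincipal_congr {r : ℕ} [NeZero r] {F G : DirichletCharacter ℂ r → ℂ}
    (h : ∀ χ, χ ≠ 1 → F χ = G χ) : charAvgNonprincipal r F = charAvgNonprincipal r G := by
  classical
  simp only [charAvgNonprincipal]
  congr 1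
  exact Finset.sum_congr rfl fun χ hχ => h χ (Finset.mem_filter.1 hχ).2

lemma charAvg_eq {r : ℕ} [NeZero r] (hr : 2 < r) (F : DirichletCharacter ℂ r → ℂ) :
    charAvg r F = (((r : ℂ) - 2) * charAvgNonprincipal r F + F 1) / ((r : ℂ) - 1) := by
  classical
  have hr2 : (r : ℂ) - 2 ≠ 0 := by
    rw [sub_ne_zero]; exact_mod_cast hr.ne'
  rw [charAvg, charAvgNonprincipal, mul_div_cancel₀ _ hr2]
  congr 1
  rw [← Finset.sum_filter_add_sum_filter_not Finset.univ (fun χ => χ ≠ 1) F]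
  congr 1
  simp [Finset.filter_eq']

lemma norm_partialSum_char_le {r : ℕ} {c : ArithmeticFunction ℤ} (hc : ∀ n, |c n| ≤ 1)
    (χ : DirichletCharacter ℂ r) {x : ℝ} (hx : 0 ≤ x) :
    ‖partialSum c (fun n => χ (n : ZMod r)) x‖ ≤ x := by
  refine (norm_sum_le _ _).trans ((Finset.sum_le_sum (g := fun _ => (1 : ℝ)) fun n _ => ?_).trans ?_)
  · rw [norm_mul]
    exact mul_le_one₀ (norm_coeff_le hc _) (norm_nonneg _) (χ.norm_le_one _)
  · simpa using Nat.floor_le hx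

/-- The bound for small moduli, from `|∑_{n ≤ x} c(n) χ(n)| ≤ x`. -/
lemma norm_charAvg_sub_le_trivial {r : ℕ} [Fact r.Prime] {c : ArithmeticFunction ℤ}
    (hc : ∀ n, |c n| ≤ 1) {m₁ m₂ : ℕ} (h₁ : m₁ ≠ 0) (h₂ : m₂ ≠ 0) {x : ℝ} (hx : 1 ≤ x) :
    ‖charAvg r (fun χ => χ (m₁ : ZMod r) * (star χ) (m₂ : ZMod r) *
        ((‖partialSum c (fun n => χ (n : ZMod r)) x‖ ^ 2 : ℝ) : ℂ)) -
      steinhausAvg (fun f => f m₁ * star (f m₂) * ((‖partialSum c f x‖ ^ 2 : ℝ) : ℂ))‖ ≤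
      2 * x ^ 2 := by
  have hr2 : (2 : ℝ) ≤ r := by exact_mod_cast (Fact.out : r.Prime).two_le
  have hr1 : (0 : ℝ) < (r : ℝ) - 1 := by linarith
  have hS : ‖steinhausAvg (fun f => f m₁ * star (f m₂) * ((‖partialSum c f x‖ ^ 2 : ℝ) : ℂ))‖ ≤
      x ^ 2 := by
    rw [steinhausAvg_partialSum c h₁ h₂]
    refine (norm_sum_diag_coeff_le hc h₂ _).trans ((Nat.floor_le (by linarith)).trans ?_)
    nlinarith
  refine (norm_sub_le _ _).trans ?_
  rw [two_mul]
  refine add_le_add ?_ hS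
  rw [charAvg, norm_div, show (r : ℂ) - 1 = ((r - 1 : ℝ) : ℂ) by push_cast; ring,
    Complex.norm_real, Real.norm_eq_abs, abs_of_pos hr1, div_le_iff₀ hr1]
  refine (norm_sum_le _ _).trans ((Finset.sum_le_sum (g := fun _ => x ^ 2) fun χ _ => ?_).trans ?_)
  · rw [norm_mul, norm_mul, Complex.norm_real, Real.norm_eq_abs, abs_of_nonneg (by positivity)]
    have h := norm_partialSum_char_le hc χ (by linarith : 0 ≤ x)
    calc _ ≤ 1 * 1 * x ^ 2 := by
          gcongr
          · exact χ.norm_le_one _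
          · exact (star χ).norm_le_one _
      _ = x ^ 2 := by ring
  · rw [Finset.sum_const, Finset.card_univ, card_char, nsmul_eq_mul,
      Nat.cast_sub (Fact.out : r.Prime).one_le]
    simp [mul_comm]

lemma partialSum_char_star {r : ℕ} (c : ArithmeticFunction ℤ) (χ : DirichletCharacter ℂ r) (x : ℝ) :
    ((‖partialSum c (fun n => χ (n : ZMod r)) x‖ ^ 2 : ℝ) : ℂ) =
      (∑ n ∈ Finset.Icc 1 ⌊x⌋₊, (c n : ℂ) * χ (n : ZMod r)) *
        ∑ n ∈ Finset.Icc 1 ⌊x⌋₊, (c n : ℂ) * (star χ) (n : ZMod r) := by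
  rw [Complex.ofReal_pow, ← Complex.mul_conj', partialSum, map_sum]
  congr 1
  refine Finset.sum_congr rfl fun n _ => ?_
  rw [map_mul, MulChar.star_apply, RCLike.star_def]
  simp

/-- The second moment over characters for one modulus, given a twisted estimate on `Re s = σ` with
error `E`, and bounds for the Dirichlet series which are needed for the principal character. -/
lemma norm_charAvg_sub_steinhausAvg_le {r : ℕ} [Fact r.Prime] (hr : 2 < r)
    {c : ArithmeticFunction ℤ} (hc : ∀ n, |c n| ≤ 1) {m₁ m₂ : ℕ} (h₁ : m₁ ≠ 0) (h₂ : m₂ ≠ 0)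
    (h₁r : m₁ < r) (h₂r : m₂ < r) {x : ℝ} (hx : 1 ≤ x)
    {M : DirichletCharacter ℂ r → ℂ → ℂ} {σ B e E : ℝ} (hσ : 1 / 2 < σ) (hσ2 : σ ≤ 2)
    (he : 0 < e) (he' : e ≤ 1 / 2)
    (hM : ∀ χ, DifferentiableOn ℂ (M χ) {s | 1 / 2 < s.re})
    (hMa : ∀ χ, ∀ s : ℂ, 1 < s.re → M χ s = LSeries (fun n => (c n : ℂ) * χ (n : ZMod r)) s)
    (hB : ∀ χ, ∀ s : ℂ, σ ≤ s.re → ‖M χ s‖ ≤ B * (1 + |s.im|) ^ e)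
    (hE0 : 0 ≤ E)
    (hE : ∀ s₁ s₂ : ℂ, s₁.re = σ → s₂.re = σ →
      ‖charAvgNonprincipal r (fun χ => χ (m₁ : ZMod r) * (star χ) (m₂ : ZMod r) *
          (M χ s₁ * M (star χ) s₂)) - steinhausTwistedSeries c r m₁ m₂ s₁ s₂‖ ≤
        E * (1 + max |s₁.im| |s₂.im|) ^ e) :
    ‖charAvg r (fun χ => χ (m₁ : ZMod r) * (star χ) (m₂ : ZMod r) *
        ((‖partialSum c (fun n => χ (n : ZMod r)) x‖ ^ 2 : ℝ) : ℂ)) -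
      steinhausAvg (fun f => f m₁ * star (f m₂) * ((‖partialSum c f x‖ ^ 2 : ℝ) : ℂ))‖ ≤
      2 * E * (perronConst e * ((⌊x⌋₊ : ℝ) + 1) ^ (σ + 2 * e)) ^ 2 + 3 * (x / r) +
      2 * B ^ 2 * (perronConst e * ((⌊x⌋₊ : ℝ) + 1) ^ (σ + 2 * e)) ^ 2 / r := by
  have hN : 1 ≤ ⌊x⌋₊ := Nat.le_floor (by simpa using hx)
  have hNx : (⌊x⌋₊ : ℝ) ≤ x := Nat.floor_le (by linarith)
  have hr3 : (3 : ℝ) ≤ r := by exact_mod_cast hr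
  set Q := perronConst e * ((⌊x⌋₊ : ℝ) + 1) ^ (σ + 2 * e) with hQ
  have hmain := norm_charAvgNonprincipal_sum_sub_le hc h₁ h₂ hN hσ hσ2 he he' hM hMa hB hE0 hE
  simp only [← partialSum_char_star c _ x] at hmain
  rw [← hQ] at hmain
  set F : DirichletCharacter ℂ r → ℂ := fun χ => χ (m₁ : ZMod r) * (star χ) (m₂ : ZMod r) *
        ((‖partialSum c (fun n => χ (n : ZMod r)) x‖ ^ 2 : ℝ) : ℂ) with hF
  have hfin := norm_sum_diagCoeff_le hc r (m₁ := m₁) h₂ ⌊x⌋₊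
  have hsub := norm_sum_diag_sub_le hc (Fact.out : r.Prime) h₁ h₂ h₁r h₂r ⌊x⌋₊
  rw [steinhausAvg_partialSum c h₁ h₂]
  set fin := ∑ n ∈ Finset.Icc 1 ⌊x⌋₊ ×ˢ Finset.Icc 1 ⌊x⌋₊,
    (c n.1 * c n.2 * diagCoeff r m₁ m₂ n : ℂ)
  set full := ∑ n ∈ Finset.Icc 1 ⌊x⌋₊ ×ˢ Finset.Icc 1 ⌊x⌋₊,
    (c n.1 * c n.2 * if m₁ * n.1 = m₂ * n.2 then 1 else 0 : ℂ)
  set NP := charAvgNonprincipal r F with hNP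
  have hF1 : ‖F 1‖ ≤ B ^ 2 * Q ^ 2 := by
    have hS := norm_sum_Icc_le (a := fun n => (c n : ℂ) * (1 : DirichletCharacter ℂ r) (n : ZMod r))
      (fun n => by
        rw [norm_mul]
        exact mul_le_one₀ (norm_coeff_le hc _) (norm_nonneg _) (DirichletCharacter.norm_le_one _ _))
      hN hσ hσ2 he he' (hM 1) (hMa 1) (hB 1)
    rw [← hQ] at hS
    simp only [hF]
    rw [norm_mul, norm_mul, Complex.norm_real, Real.norm_eq_abs, abs_of_nonneg (by positivity),
      ← mul_pow]
    calc _ ≤ 1 * 1 * (B * Q) ^ 2 := by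
          gcongr
          · exact DirichletCharacter.norm_le_one _ _
          · exact DirichletCharacter.norm_le_one _ _
          · exact hS
      _ = _ := by ring
  have hNPb : ‖NP‖ ≤ x + E * Q ^ 2 := by
    calc ‖NP‖ = ‖fin + (NP - fin)‖ := by congr 1; ring
      _ ≤ ‖fin‖ + ‖NP - fin‖ := norm_add_le _ _
      _ ≤ _ := add_le_add (hfin.trans hNx) hmain
  have hr1 : (r : ℂ) - 1 ≠ 0 := by
    rw [sub_ne_zero]; exact_mod_cast (by lia : r ≠ 1)
  have hdecomp : charAvg r F - full =
      (NP - fin) + (fin - full) + (F 1 - NP) * ((r : ℂ) - 1)⁻¹ := by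
    rw [charAvg_eq hr, ← hNP]
    field_simp
    ring
  have hinv : ‖((r : ℂ) - 1)⁻¹‖ = ((r : ℝ) - 1)⁻¹ := by
    rw [norm_inv, show (r : ℂ) - 1 = ((r - 1 : ℝ) : ℂ) by push_cast; ring, Complex.norm_real,
      Real.norm_eq_abs, abs_of_pos (by linarith)]
  have hinv2 : ((r : ℝ) - 1)⁻¹ ≤ 2 * (r : ℝ)⁻¹ := by
    rw [← div_eq_mul_inv, le_div_iff₀ (by linarith), inv_mul_le_iff₀ (by linarith)]
    linarith
  have hinv1 : 2 * (r : ℝ)⁻¹ ≤ 1 := by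
    rw [← div_eq_mul_inv, div_le_one (by linarith)]
    linarith
  have hEQ : 0 ≤ E * Q ^ 2 := by positivity
  rw [hdecomp]
  calc _ ≤ ‖NP - fin‖ + ‖fin - full‖ + ‖(F 1 - NP) * ((r : ℂ) - 1)⁻¹‖ := norm_add₃_le
    _ ≤ E * Q ^ 2 + x / r + (B ^ 2 * Q ^ 2 + (x + E * Q ^ 2)) * (2 * (r : ℝ)⁻¹) := by
        rw [norm_mul, hinv]
        refine add_le_add (add_le_add hmain (hsub.trans (by gcongr))) ?_
        refine mul_le_mul ?_ hinv2 (by rw [inv_nonneg]; linarith) (by positivity)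
        exact (norm_sub_le _ _).trans (add_le_add hF1 hNPb)
    _ = E * Q ^ 2 + (E * Q ^ 2) * (2 * (r : ℝ)⁻¹) + 3 * (x / r) + 2 * B ^ 2 * Q ^ 2 / r := by
        simp only [div_eq_mul_inv]
        ring
    _ ≤ E * Q ^ 2 + (E * Q ^ 2) * 1 + 3 * (x / r) + 2 * B ^ 2 * Q ^ 2 / r := by gcongr
    _ = _ := by ring

/-- A twisted estimate with saving `r^{-w}` gives the second moment of partial sums with saving
`r^{-η/2}` for `η ≤ w`. The line of integration `Re s = 1/2 + e` has `e` small in terms of `A` and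
`η`, so that `x^{6e} ≤ r^{η/2}`. -/
theorem exists_moment_bound {R : Set ℕ} {η w A : ℝ} (hη : 0 < η) (hη1 : η ≤ 1 / 2) (hηw : η ≤ w)
    (hA : 0 < A) {𝓛 : ∀ (r : ℕ) [NeZero r], DirichletCharacter ℂ r → ℂ → ℂ}
    {c : ArithmeticFunction ℤ} (hc : ∀ n, |c n| ≤ 1) (hT : TwistedEstimate R 𝓛 c w)
    {M : ∀ (r : ℕ) [NeZero r], DirichletCharacter ℂ r → ℂ → ℂ}
    (hM : ∀ (r : ℕ) [Fact r.Prime], r ∈ R → ∀ χ, DifferentiableOn ℂ (M r χ) {s | 1 / 2 < s.re})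
    (hMa : ∀ (r : ℕ) [Fact r.Prime], r ∈ R → ∀ χ, ∀ s : ℂ, 1 < s.re →
      M r χ s = LSeries (fun n => (c n : ℂ) * χ (n : ZMod r)) s)
    (hM𝓛 : ∀ (r : ℕ) [Fact r.Prime], r ∈ R → ∀ χ, χ ≠ 1 → ∀ s : ℂ, M r χ s = (𝓛 r χ s)⁻¹)
    (hMb : ∀ e : ℝ, 0 < e → e ≤ 1 / 2 → ∃ C : ℝ, 0 < C ∧ ∀ (r : ℕ) [Fact r.Prime], r ∈ R →
      ∀ χ, ∀ s : ℂ, 1 / 2 + e ≤ s.re → ‖M r χ s‖ ≤ C * ((r : ℝ) * (1 + |s.im|)) ^ e) :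
    ∃ ε₀ : ℝ, 0 < ε₀ ∧ ∃ C : ℝ, ∀ ε : ℝ, 0 < ε → ε ≤ ε₀ → ∀ (r : ℕ) [Fact r.Prime], r ∈ R →
      ∀ x : ℝ, 1 ≤ x → x ≤ (r : ℝ) ^ A → ∀ m₁ m₂ : ℕ, 1 ≤ m₁ → 1 ≤ m₂ →
      (m₁ : ℝ) ≤ (r : ℝ) ^ ε → (m₂ : ℝ) ≤ (r : ℝ) ^ ε →
      ‖charAvg r (fun χ => χ (m₁ : ZMod r) * (star χ) (m₂ : ZMod r) *
          ((‖partialSum c (fun n => χ (n : ZMod r)) x‖ ^ 2 : ℝ) : ℂ)) -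
        steinhausAvg (fun f => f m₁ * star (f m₂) * ((‖partialSum c f x‖ ^ 2 : ℝ) : ℂ))‖ ≤
        C * (x / (r : ℝ) ^ (η / 2)) := by
  obtain ⟨δ, hδ, hest⟩ := hT
  -- `η / (12 A)` gives `x^{6e} ≤ r^{η/2}`; `e ≤ 1/8` keeps `2e` below `1/4`
  set e := min (δ / 2) (min (1 / 8) (η / (12 * A))) with hedef
  have he : 0 < e := lt_min (by positivity) (lt_min (by norm_num) (by positivity))
  have heδ : e < δ := (min_le_left _ _).trans_lt (by linarith)
  have he8 : e ≤ 1 / 8 := (min_le_right _ _).trans (min_le_left _ _)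
  have heA : 6 * A * e ≤ η / 2 := by
    have : e ≤ η / (12 * A) := (min_le_right _ _).trans (min_le_right _ _)
    rw [le_div_iff₀ (by positivity)] at this
    linarith
  obtain ⟨C₁, hC₁⟩ := hest e he heδ
  obtain ⟨C₂, hC₂0, hC₂⟩ := hMb e he (by linarith)
  set q := perronConst e with hq
  have hq0 : 0 ≤ q := perronConst_nonneg e
  refine ⟨min (δ / 2) (1 / 2), lt_min (by positivity) (by norm_num),
    8 * |C₁| * q ^ 2 + 8 * C₂ ^ 2 * q ^ 2 + 3 + 4 * 2 ^ A, ?_⟩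
  intro ε hε hεε₀ r _ hrR x hx hxr m₁ m₂ hm₁ hm₂ hm₁r hm₂r
  have hεδ : ε < δ := (hεε₀.trans (min_le_left _ _)).trans_lt (by linarith)
  have hε2 : ε ≤ 1 / 2 := hεε₀.trans (min_le_right _ _)
  have hr2 : 2 ≤ r := (Fact.out : r.Prime).two_le
  have hr1 : (1 : ℝ) < r := by exact_mod_cast hr2
  have hr0 : (0 : ℝ) < r := by linarith
  have hx0 : 0 < x := by linarith
  have hX : 0 ≤ x / (r : ℝ) ^ (η / 2) := by positivity
  rcases hr2.eq_or_lt with h2 | h2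
  · -- for `r = 2` there is no nonprincipal character, and `x ≤ 2 ^ A` is bounded
    refine (norm_charAvg_sub_le_trivial hc (by lia) (by lia) hx).trans ?_
    have hrr : (r : ℝ) = 2 := by exact_mod_cast h2.symm
    have h3 : (r : ℝ) ^ (η / 2) ≤ 2 := by
      rw [hrr]
      calc (2 : ℝ) ^ (η / 2) ≤ 2 ^ (1 : ℝ) :=
            Real.rpow_le_rpow_of_exponent_le (by norm_num) (by linarith)
        _ = 2 := Real.rpow_one 2
    have h4 : 2 * x ^ 2 ≤ 4 * 2 ^ A * (x / (r : ℝ) ^ (η / 2)) := by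
      rw [mul_div_assoc', le_div_iff₀ (by positivity)]
      rw [hrr] at hxr
      calc 2 * x ^ 2 * (r : ℝ) ^ (η / 2) ≤ 2 * (2 ^ A * x) * 2 := by
            gcongr
            nlinarith
        _ = _ := by ring
    refine h4.trans (mul_le_mul_of_nonneg_right ?_ hX)
    have : 0 ≤ 8 * |C₁| * q ^ 2 + 8 * C₂ ^ 2 * q ^ 2 + 3 := by positivity
    linarith
  have hmr : ∀ m : ℕ, (m : ℝ) ≤ (r : ℝ) ^ ε → m < r := by
    intro m hm
    have : (m : ℝ) < r := by
      calc (m : ℝ) ≤ (r : ℝ) ^ ε := hm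
        _ < (r : ℝ) ^ (1 : ℝ) := Real.rpow_lt_rpow_of_exponent_lt hr1 (by linarith)
        _ = r := Real.rpow_one _
    exact_mod_cast this
  have hstar1 : ∀ χ : DirichletCharacter ℂ r, χ ≠ 1 → star χ ≠ 1 := by
    intro χ hχ h
    apply hχ
    rw [MulChar.star_eq_inv] at h
    exact inv_eq_one.1 h
  have key := norm_charAvg_sub_steinhausAvg_le h2 hc (by lia : m₁ ≠ 0) (by lia : m₂ ≠ 0)
    (hmr m₁ hm₁r) (hmr m₂ hm₂r) hx (M := M r) (σ := 1 / 2 + e) (B := C₂ * (r : ℝ) ^ e) (e := e)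
    (E := |C₁| * (r : ℝ) ^ (-w)) (by linarith) (by linarith) he (by linarith) (hM r hrR) (hMa r hrR)
    (fun χ s hs => by
      refine (hC₂ r hrR χ s hs).trans_eq ?_
      rw [Real.mul_rpow hr0.le (by positivity), mul_assoc])
    (by positivity)
    (fun s₁ s₂ hs₁ hs₂ => by
      have := hC₁ ε hε hεδ r hrR h2 s₁ s₂ hs₁ hs₂ m₁ m₂ hm₁ hm₂ hm₁r hm₂r
      rw [charAvgNonprincipal_congr (G := fun χ => χ (m₁ : ZMod r) * (star χ) (m₂ : ZMod r) /
        (𝓛 r χ s₁ * 𝓛 r (star χ) s₂)) fun χ hχ => by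
          rw [hM𝓛 r hrR χ hχ, hM𝓛 r hrR (star χ) (hstar1 χ hχ), div_eq_mul_inv, mul_inv]]
      refine this.trans ?_
      rw [mul_right_comm]
      gcongr
      exact le_abs_self _)
  rw [← hq] at key
  refine key.trans ?_
  have hQ : (q * ((⌊x⌋₊ : ℝ) + 1) ^ (1 / 2 + e + 2 * e)) ^ 2 ≤
      q ^ 2 * (4 * (x * (r : ℝ) ^ (6 * A * e))) := by
    rw [mul_pow]
    refine mul_le_mul_of_nonneg_left ?_ (by positivity)
    have hNx : (⌊x⌋₊ : ℝ) + 1 ≤ 2 * x := by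
      have := Nat.floor_le hx0.le
      linarith
    calc (((⌊x⌋₊ : ℝ) + 1) ^ (1 / 2 + e + 2 * e)) ^ 2 ≤ ((2 * x) ^ (1 / 2 + e + 2 * e)) ^ 2 := by
          gcongr
      _ = (2 * x) ^ (1 + 6 * e) := by
          rw [← Real.rpow_natCast, ← Real.rpow_mul (by positivity)]
          congr 1
          push_cast
          ring
      _ = 2 ^ (1 + 6 * e) * (x * (x ^ (6 * e))) := by
          rw [Real.mul_rpow (by norm_num) hx0.le, Real.rpow_add hx0, Real.rpow_one]
      _ ≤ 2 ^ (2 : ℝ) * (x * ((r : ℝ) ^ A) ^ (6 * e)) := by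
          gcongr
          · norm_num
          · linarith
      _ = 4 * (x * (r : ℝ) ^ (6 * A * e)) := by
          rw [← Real.rpow_mul hr0.le, show A * (6 * e) = 6 * A * e by ring]
          norm_num
  have hsave : ∀ p : ℝ, p ≤ -(η / 2) → x * (r : ℝ) ^ p ≤ x / (r : ℝ) ^ (η / 2) := by
    intro p hp
    rw [div_eq_mul_inv, ← Real.rpow_neg hr0.le]
    gcongr
    exact hr1.le
  -- each term is `x r^p` with `p ≤ -η/2`; the last two use `η ≤ 1/2`
  have t1 : 2 * (|C₁| * (r : ℝ) ^ (-w)) * (q * ((⌊x⌋₊ : ℝ) + 1) ^ (1 / 2 + e + 2 * e)) ^ 2 ≤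
      8 * |C₁| * q ^ 2 * (x / (r : ℝ) ^ (η / 2)) := by
    calc _ ≤ 2 * (|C₁| * (r : ℝ) ^ (-w)) * (q ^ 2 * (4 * (x * (r : ℝ) ^ (6 * A * e)))) := by gcongr
      _ = 8 * |C₁| * q ^ 2 * (x * (r : ℝ) ^ (-w + 6 * A * e)) := by
          rw [Real.rpow_add hr0]; ring
      _ ≤ _ := mul_le_mul_of_nonneg_left (hsave _ (by linarith)) (by positivity)
  have t2 : 3 * (x / r) ≤ 3 * (x / (r : ℝ) ^ (η / 2)) := by
    have := hsave (-1) (by linarith)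
    rw [Real.rpow_neg_one, ← div_eq_mul_inv] at this
    linarith
  have t3 : 2 * (C₂ * (r : ℝ) ^ e) ^ 2 * (q * ((⌊x⌋₊ : ℝ) + 1) ^ (1 / 2 + e + 2 * e)) ^ 2 / r ≤
      8 * C₂ ^ 2 * q ^ 2 * (x / (r : ℝ) ^ (η / 2)) := by
    calc _ ≤ 2 * (C₂ * (r : ℝ) ^ e) ^ 2 * (q ^ 2 * (4 * (x * (r : ℝ) ^ (6 * A * e)))) / r := by
          gcongr
      _ = 8 * C₂ ^ 2 * q ^ 2 * (x * (r : ℝ) ^ (2 * e + 6 * A * e + -1)) := by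
          rw [show 2 * e + 6 * A * e + -1 = e + (e + (6 * A * e + -1)) by ring,
            Real.rpow_add hr0, Real.rpow_add hr0, Real.rpow_add hr0, Real.rpow_neg_one]
          ring
      _ ≤ _ := mul_le_mul_of_nonneg_left (hsave _ (by linarith)) (by positivity)
  have t4 : 0 ≤ 4 * 2 ^ A * (x / (r : ℝ) ^ (η / 2)) := by positivity
  linarith

/-! ### The two choices of coefficients -/

/-- The continuation `L(2s, χ²) / L(s, χ)` of `∑ λ(n) χ(n) n^{-s}`. -/
def LFlatInv {r : ℕ} [NeZero r] (χ : DirichletCharacter ℂ r) (s : ℂ) : ℂ :=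
  (χ ^ 2).LFunction (2 * s) * LInv χ s

lemma differentiableOn_LFlatInv {r : ℕ} [NeZero r] (h : GRH r) (χ : DirichletCharacter ℂ r) :
    DifferentiableOn ℂ (LFlatInv χ) {s | 1 / 2 < s.re} := by
  refine DifferentiableOn.mul (fun s hs => ?_) (differentiableOn_LInv h χ)
  have hs' : 1 / 2 < s.re := hs
  have h2 : 2 * s ≠ 1 := by
    intro h
    have := congrArg Complex.re h
    simp at this
    linarith
  have h3 := DirichletCharacter.differentiableAt_LFunction (χ ^ 2) (2 * s) (Or.inl h2)
  exact (DifferentiableAt.comp s h3 (by fun_prop)).differentiableWithinAt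

lemma LFlatInv_eq_LSeries {r : ℕ} [NeZero r] (χ : DirichletCharacter ℂ r) {s : ℂ}
    (hs : 1 < s.re) :
    LFlatInv χ s =
      LSeries (fun n => (ArithmeticFunction.liouville n : ℂ) * χ (n : ZMod r)) s := by
  rw [LSeries_liouville_eq χ hs, LFlatInv, LInv_eq_LSeries χ hs]

lemma LFlatInv_eq_inv {r : ℕ} [NeZero r] {χ : DirichletCharacter ℂ r} (hχ : χ ≠ 1) (s : ℂ) :
    LFlatInv χ s = (LFlat χ s)⁻¹ := by
  rw [LFlatInv, LFlat, LInv_of_ne_one hχ, inv_div, div_eq_mul_inv]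

lemma exists_norm_LFlatInv_le {e : ℝ} (he : 0 < e) (he' : e ≤ 1 / 2) :
    ∃ C : ℝ, 0 < C ∧ ∀ (r : ℕ) [NeZero r], GRH r → ∀ (χ : DirichletCharacter ℂ r) (s : ℂ),
      1 / 2 + e ≤ s.re → ‖LFlatInv χ s‖ ≤ C * ((r : ℝ) * (1 + |s.im|)) ^ e := by
  obtain ⟨C, hC, h⟩ := exists_norm_LInv_le he he' he
  have hZ : 1 ≤ zetaSum (1 + 2 * e) := one_le_zetaSum (by linarith)
  refine ⟨zetaSum (1 + 2 * e) * C, by positivity, fun r _ hr χ s hs => ?_⟩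
  rw [LFlatInv, norm_mul, mul_assoc]
  refine mul_le_mul ?_ (h r hr χ s hs) (norm_nonneg _) (by linarith)
  exact norm_LFunction_le _ (by linarith) (by simp; linarith)

end

end EvenMoment

end

theorem lemma2p5 :
    (∀ (R : Set ℕ) (ω : ℝ), 0 < ω → ω ≤ 1 / 2 →
      (∀ (r : ℕ) [Fact r.Prime], r ∈ R → EvenMoment.GRH r) →
      EvenMoment.TwistedRatiosConjecture R ω →
      (∃ η : ℝ, 0 < η ∧ η ≤ ω ∧ EvenMoment.LiouvilleTwistedEstimate R η) ∧
      ∀ η : ℝ, 0 < η → η ≤ ω → EvenMoment.LiouvilleTwistedEstimate R η →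
        ∀ A : ℝ, 0 < A → ∃ ε₀ : ℝ, 0 < ε₀ ∧ ∃ C : ℝ, ∀ ε : ℝ, 0 < ε → ε ≤ ε₀ →
          ∀ (r : ℕ) [Fact r.Prime], r ∈ R →
          ∀ c : ArithmeticFunction ℤ,
            (c = ArithmeticFunction.moebius ∨ c = ArithmeticFunction.liouville) →
          ∀ P : Finset ℕ, P.Nonempty → (∀ p ∈ P, p.Prime) →
          ∀ k : ℕ, ((EvenMoment.maxQ P : ℝ)) ^ k ≤ (r : ℝ) ^ ε →
          ∀ x : ℝ, 1 ≤ x → x ≤ (r : ℝ) ^ A →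
          ∀ m₁ m₂ : ℕ, 1 ≤ m₁ → 1 ≤ m₂ →
            m₁ ≤ EvenMoment.maxQ P ^ k → m₂ ≤ EvenMoment.maxQ P ^ k →
            ‖EvenMoment.charAvg r (fun χ =>
                  χ (m₁ : ZMod r) * (star χ) (m₂ : ZMod r) *
                    ((‖EvenMoment.partialSum c (fun n => χ (n : ZMod r)) x‖ ^ 2 : ℝ) : ℂ))
                - EvenMoment.steinhausAvg (fun f =>
                  f m₁ * star (f m₂) *
                    ((‖EvenMoment.partialSum c f x‖ ^ 2 : ℝ) : ℂ))‖
              ≤ C * (x / (r : ℝ) ^ (η / 2))) ∧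
    (∃ C : ℝ, ∀ c : ArithmeticFunction ℤ,
        (c = ArithmeticFunction.moebius ∨ c = ArithmeticFunction.liouville) →
      ∀ P : Finset ℕ, P.Nonempty → (∀ p ∈ P, p.Prime) →
      ∀ (a : ℕ → ℂ) (k : ℕ) (x : ℝ), 1 ≤ x →
        EvenMoment.steinhausAvg (fun f =>
            ‖EvenMoment.weightSum P a f‖ ^ (2 * k) * ‖EvenMoment.partialSum c f x‖ ^ 2)
          ≤ C * (∑ n ∈ Finset.Icc 1 ⌊x⌋₊, (EvenMoment.dTilde P n : ℝ) * |(c n : ℝ)| ^ 2) *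
            ((k.factorial : ℝ) *
              (2 * ∑ q ∈ EvenMoment.withSquares P,
                (q : ℝ)⁻¹ * EvenMoment.vWeight P q * ‖a q‖ ^ 2) ^ k)) := by
  refine ⟨fun R ω hω hω2 hGRH hTRC => ⟨?_, ?_⟩, ?_⟩
  · exact EvenMoment.exists_liouvilleTwistedEstimate hω hGRH hTRC
  · intro η hη hηω hLTE A hA
    obtain ⟨ε₁, hε₁, C₁, h₁⟩ := EvenMoment.exists_moment_bound hη (hηω.trans hω2) hηω hA
      EvenMoment.abs_moebius_le hTRC (M := fun _ _ χ s => EvenMoment.LInv χ s)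
      (fun r _ hr χ => EvenMoment.differentiableOn_LInv (hGRH r hr) χ)
      (fun r _ _ χ s hs => EvenMoment.LInv_eq_LSeries χ hs)
      (fun r _ _ χ hχ s => EvenMoment.LInv_of_ne_one hχ s)
      (fun e he he' => by
        obtain ⟨C, hC, h⟩ := EvenMoment.exists_norm_LInv_le he he' he
        exact ⟨C, hC, fun r _ hr => h r (hGRH r hr)⟩)
    obtain ⟨ε₂, hε₂, C₂, h₂⟩ := EvenMoment.exists_moment_bound hη (hηω.trans hω2) le_rfl hA
      EvenMoment.abs_liouville_le hLTE (M := fun _ _ χ s => EvenMoment.LFlatInv χ s)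
      (fun r _ hr χ => EvenMoment.differentiableOn_LFlatInv (hGRH r hr) χ)
      (fun r _ _ χ s hs => EvenMoment.LFlatInv_eq_LSeries χ hs)
      (fun r _ _ χ hχ s => EvenMoment.LFlatInv_eq_inv hχ s)
      (fun e he he' => by
        obtain ⟨C, hC, h⟩ := EvenMoment.exists_norm_LFlatInv_le he he'
        exact ⟨C, hC, fun r _ hr => h r (hGRH r hr)⟩)
    refine ⟨min ε₁ ε₂, lt_min hε₁ hε₂, max C₁ C₂, ?_⟩
    intro ε hε hεε r _ hr c hc P _ _ k hk x hx hxr m₁ m₂ hm₁ hm₂ hm₁k hm₂k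
    have hm : ∀ m : ℕ, m ≤ EvenMoment.maxQ P ^ k → (m : ℝ) ≤ (r : ℝ) ^ ε := fun m hm =>
      le_trans (by exact_mod_cast hm) hk
    rcases hc with rfl | rfl
    · refine (h₁ ε hε (hεε.trans (min_le_left _ _)) r hr x hx hxr m₁ m₂ hm₁ hm₂ (hm m₁ hm₁k)
        (hm m₂ hm₂k)).trans ?_
      gcongr
      exact le_max_left _ _
    · refine (h₂ ε hε (hεε.trans (min_le_right _ _)) r hr x hx hxr m₁ m₂ hm₁ hm₂ (hm m₁ hm₁k)
        (hm m₂ hm₂k)).trans ?_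
      gcongr
      exact le_max_right _ _
  · refine ⟨1, fun c _ P _ hP a k x _ => ?_⟩
    rw [one_mul]
    exact EvenMoment.steinhausAvg_weightSum_pow_mul_le c hP a k x
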